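/- **Setting.** Let $d\ge 1$ and let $C\subset\mathbb R^d$ be a bounded measurable set with $|C|=1$ and $|\partial C|=0$, where $|\cdot|$ is Lebesgue measure. Let $V>0$ be a random variable with $\mathbb E V=1$, distribution function $F$ and tail $\bar F=1-F$ that is regularly varying with exponent $\gamma\in(1,2)$: $\bar F(av)/\bar F(v)\to a^{-\gamma}$ as $v\to\infty$ for all $a>0$. Put $F_\rho(v)=F(v/\rho)$, $\bar F_\rho=1-F_\rho$, and $(1/\bar F_\rho)^{\leftarrow}(u)=\inf\{v\ge 0:1/\bar F_\rho(v)\ge u\}$. Let $d\theta$ be the Haar probability measure on $SO(d)$. For $\lambda,\rho>0$ let $N_{\lambda,\rho}$ be a Poisson random measure on $\mathbb R^d\times\mathbb R_+\times SO(d)$ with intensity $\lambda\,dx\,F_\rho(dv)\,d\theta$, and for a finite signed measure $\phi$ on $\mathbb R^d$ let $$\tilde J_{\lambda,\rho}(\phi)=\int\phi(x+v^{1/d}\theta C)\,N_{\lambda,\rho}(dx,dv,d\theta),$$ which converges absolutely almost surely and has a finite mean. A function $\phi\in L^1(\mathbb R^d)$ is identified with the measure $\phi(x)\,dx$. For $0<a<1$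 let $M^{a}$ be the set of finite signed measures $\phi$ on $\mathbb R^d$ with $\iint|x-y|^{-(1-a)d}\,|\phi|(dx)\,|\phi|(dy)<\infty$, and let $$c_{a,d}=\pi^{(a-1/2)d}\,\Gamma\big((1-a)d/2\big)/\Gamma(ad/2).$$ For $1/2<H<1$ let $W_H$ be the centered Gaussian random linear functional on $M^{2H-1}$ with $$\mathbb E\,W_H(\phi)W_H(\psi)=c_{2H-1,d}\iint|x-y|^{-(2-2H)d}\,\phi(dx)\,\psi(dy).$$ Let $\Lambda_\gamma$ be the independently scattered $\gamma$-stable random measure with Lebesgue control measure and unit skewness, i.e. the random linear functional on $L^\gamma(\mathbb R^d)$ with $$\mathbb E e^{i\Lambda_\gamma(\phi)}=\exp\big(-\|\phi\|_\gamma^\gamma(1-i\beta_\phi\tan(\pi\gamma/2))\big),\qquad \beta_\phi=\|\phi\|_\gamma^{-\gamma}\big(\|\phi_+\|_\gamma^\gamma-\|\phi_-\|_\gamma^\gamma\big).$$ **Theorem.** Let $\alpha\in(0,2-\gamma)$, and let $\lambda\to\infty$ and $\rho\to0$. The following limits hold in the sense of convergence of finite-dimensional distributions of random functionals. (i) (Large-grain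 scaling) If $\lambda\bar F_\rho(1)\to\infty$, then $$\frac{\tilde J_{\lambda,\rho}(\phi)-\mathbb E\tilde J_{\lambda,\rho}(\phi)}{(\gamma\lambda\bar F_\rho(1))^{1/2}}\longrightarrow c\,W_H(\phi),\qquad\phi\in M^\alpha,$$ where $H=(3-\gamma)/2$ and, for an arbitrary unit vector $e_1$, $$c=\Big(c_{2H-1,d}^{-1}\int_{SO(d)}\int_0^\infty\big|(v^{-1/d}\theta e_1+C)\cap C\big|\,v^{-\gamma}\,dv\,d\theta\Big)^{1/2}.$$ (ii) (Intermediate scaling) If $\lambda\bar F_\rho(1)\to\sigma_0\in(0,\infty)$, then $$\tilde J_{\lambda,\rho}(\phi)-\mathbb E\tilde J_{\lambda,\rho}(\phi)\longrightarrow\int\phi_\sigma(x+v^{1/d}\theta C)\,\big(N_\gamma(dx,dv,d\theta)-dx\,v^{-\gamma-1}dv\,d\theta\big),\qquad\phi\in M^\alpha,$$ where $N_\gamma$ is a Poisson random measure on $\mathbb R^d\times(0,\infty)\times SO(d)$ with intensity $dx\,v^{-\gamma-1}dv\,d\theta$, $\sigma=(\gamma\sigma_0)^{1/((\gamma-1)d)}$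 and $\phi_\sigma(A)=\phi(\sigma A)$. The centered Poisson integral on the right exists as a limit in probability. (iii) (Small-grain scaling) If $\lambda\bar F_\rho(1)\to0$, then $$\frac{\tilde J_{\lambda,\rho}(\phi)-\mathbb E\tilde J_{\lambda,\rho}(\phi)}{c_\gamma\,(1/\bar F_\rho)^{\leftarrow}(\gamma\lambda)}\longrightarrow\Lambda_\gamma(\phi),\qquad\phi\in L^1\cap L^2,$$ where $$c_\gamma=\Big(-\frac{\Gamma(2-\gamma)}{\gamma(\gamma-1)}\cos\frac{\pi\gamma}{2}\Big)^{1/\gamma}.$$ -/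

import Mathlib

open MeasureTheory ProbabilityTheory Filter Topology Set
open scoped ENNReal NNReal

noncomputable section

/-! ### The rotation group and its Haar measure -/

/-- `SO d` is the group of rotations of `ℝ^d`, as matrices. -/
abbrev SO (d : ℕ) : Type := Matrix.specialOrthogonalGroup (Fin d) ℝ

/-- `SO d` carries the topology of matrices and its Borel σ-algebra. -/
instance SO.instMeasurableSpace (d : ℕ) : MeasurableSpace (SO d) := borel _

instance SO.instBorelSpace (d : ℕ) : BorelSpace (SO d) := ⟨rfl⟩

instance SO.instIsTopologicalGroup (d : ℕ) : IsTopologicalGroup (SO d) where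
  continuous_mul := continuous_mul
  continuous_inv := by
    refine Continuous.subtype_mk ?_ _
    exact continuous_star.comp continuous_subtype_val

theorem SO.isClosed_range (d : ℕ) :
    IsClosed ((Matrix.specialOrthogonalGroup (Fin d) ℝ : Submonoid (Matrix (Fin d) (Fin d) ℝ)) :
      Set (Matrix (Fin d) (Fin d) ℝ)) := by
  have h : ((Matrix.specialOrthogonalGroup (Fin d) ℝ :
      Submonoid (Matrix (Fin d) (Fin d) ℝ)) : Set (Matrix (Fin d) (Fin d) ℝ))
      = {A | A * A.transpose = 1} ∩ {A | A.det = 1} := by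
    ext A
    simp only [SetLike.mem_coe, Matrix.mem_specialOrthogonalGroup_iff,
      Matrix.mem_orthogonalGroup_iff, mem_inter_iff, mem_ofPred_eq]
  rw [h]
  refine (isClosed_eq ?_ continuous_const).inter (isClosed_eq ?_ continuous_const)
  · exact continuous_id.matrix_mul continuous_id.matrix_transpose
  · exact continuous_id.matrix_det

instance SO.instCompactSpace (d : ℕ) : CompactSpace (SO d) := by
  have hK : IsCompact (Set.univ.pi fun _ : Fin d => Set.univ.pi fun _ : Fin d =>
      Set.Icc (-1 : ℝ) 1) :=
    isCompact_univ_pi fun _ => isCompact_univ_pi fun _ => isCompact_Icc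
  refine isCompact_iff_compactSpace.mp (hK.of_isClosed_subset (SO.isClosed_range d) ?_)
  intro A hA i _ j _
  have h := entry_norm_bound_of_unitary (𝕜 := ℝ) (U := A) hA.1 i j
  exact abs_le.mp h

/-- The Haar measure on `SO d`, normalised to be a probability measure. -/
def haarSO (d : ℕ) : Measure (SO d) := Measure.haarMeasure ⊤

instance haarSO.instIsProbabilityMeasure (d : ℕ) : IsProbabilityMeasure (haarSO d) :=
  ⟨by simpa [haarSO] using Measure.haarMeasure_self (G := SO d) (K₀ := ⊤)⟩

/-- The action of a rotation on a point of `ℝ^d`. -/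
def rotate {d : ℕ} (θ : SO d) (x : EuclideanSpace ℝ (Fin d)) : EuclideanSpace ℝ (Fin d) :=
  WithLp.toLp 2 ((θ : Matrix (Fin d) (Fin d) ℝ).mulVec x.ofLp)

/-! ### Poisson random measures and centred Poisson integrals -/

/-- `N` is a Poisson random measure with intensity measure `η`: a random measure which takes a
Poisson distributed value with mean `η A` on every set `A` of finite intensity, and independent
values on disjoint sets. -/
structure IsPoissonRandomMeasure {Ω S : Type*} [MeasurableSpace Ω] [MeasurableSpace S]
    (N : Ω → Measure S) (η : Measure S) (P : Measure Ω) : Prop where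
  measurable : Measurable N
  map_eq : ∀ A : Set S, MeasurableSet A → η A ≠ ∞ →
    P.map (fun ω => N ω A) = (poissonMeasure (η A).toNNReal).map (fun k : ℕ => (k : ℝ≥0∞))
  indep : ∀ (n : ℕ) (A : Fin n → Set S), (∀ k, MeasurableSet (A k)) →
    Pairwise (fun j k => Disjoint (A j) (A k)) → iIndepFun (fun k ω => N ω (A k)) P

/-- `Y` is the centred integral `∫ f (dN - dη)`: the limit in probability, as `ε ↓ 0`, of the
difference of the integrals of the truncation `f 1{|f| > ε}` with respect to `N` and to `η`. -/
def IsCentredIntegral {Ω S : Type*} [MeasurableSpace Ω] [MeasurableSpace S]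
    (P : Measure Ω) (N : Ω → Measure S) (η : Measure S) (f : S → ℝ) (Y : Ω → ℝ) : Prop :=
  TendstoInMeasure P
    (fun (ε : ℝ) ω => (∫ z, (if ε < |f z| then f z else 0) ∂(N ω))
      - ∫ z, (if ε < |f z| then f z else 0) ∂η)
    (𝓝[>] 0) Y

open Classical in
/-- The centred integral `∫ f (dN - dη)` (an almost surely unique version of it), with the value
`0` if the limit in probability does not exist. -/
def centredIntegral {Ω S : Type*} [MeasurableSpace Ω] [MeasurableSpace S]
    (P : Measure Ω) (N : Ω → Measure S) (η : Measure S) (f : S → ℝ) : Ω → ℝ :=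
  if h : ∃ Y : Ω → ℝ, IsCentredIntegral P N η f Y then h.choose else 0

/-! ### Convergence of finite-dimensional distributions -/

/-- Convergence of the finite-dimensional distributions of the random functionals `X i`, indexed
by `T`, to those of `Z`. -/
def TendstoFidi {ι E Ω' : Type*} {Ω : ι → Type*} [∀ i, MeasurableSpace (Ω i)]
    [MeasurableSpace Ω'] (T : Set E) (X : (i : ι) → E → Ω i → ℝ) (l : Filter ι)
    (Z : E → Ω' → ℝ) (P : (i : ι) → Measure (Ω i)) [∀ i, IsProbabilityMeasure (P i)]
    (P' : Measure Ω') [IsProbabilityMeasure P'] : Prop :=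
  ∀ (n : ℕ) (φ : Fin n → E), (∀ k, φ k ∈ T) →
    TendstoInDistribution (fun i ω k => X i (φ k) ω) l (fun ω k => Z (φ k) ω) P P'

/-! ### Test measures with finite Riesz energy and the Gaussian limit -/

/-- The space `M^α` of signed measures `φ` (of finite total variation) on `ℝ^d` with
`∫∫ |φ|(dx) |φ|(dy) / |x - y|^((1-α)d) < ∞`; the integrand is `∞` on the diagonal. -/
def rieszSpace (d : ℕ) (α : ℝ) : Set (SignedMeasure (EuclideanSpace ℝ (Fin d))) :=
  {φ | ∫⁻ x, ∫⁻ y, edist x y ^ (-((1 - α) * d)) ∂φ.totalVariation ∂φ.totalVariation < ∞}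

/-- The constant `c_{α,d}`. -/
def rieszConst (α : ℝ) (d : ℕ) : ℝ :=
  Real.pi ^ ((α - 1 / 2) * d) * Real.Gamma ((1 - α) * d / 2) / Real.Gamma (α * d / 2)

/-- The Riesz inner product
`⟨φ, ψ⟩_α = c_{α,d} ∫∫ φ(dx) ψ(dy) / |x - y|^((1-α)d)`. -/
def rieszInner {d : ℕ} (α : ℝ) (φ ψ : SignedMeasure (EuclideanSpace ℝ (Fin d))) : ℝ :=
  rieszConst α d * ∫ᵛ x, (∫ᵛ y, ‖x - y‖ ^ (-((1 - α) * d)) ∂•ψ) ∂•φ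

/-- `W` is (a version of) `W_H`, the centred Gaussian random functional on `M^(2H-1)` whose
covariance is the Riesz inner product `⟨φ, ψ⟩_{2H-1}`. (Almost sure linearity is a consequence of
the bilinearity of the covariance.) Only the values of `W` on `M^(2H-1)` matter. -/
structure IsRieszGaussian {d : ℕ} {Ω : Type*} [MeasurableSpace Ω] (H : ℝ)
    (W : SignedMeasure (EuclideanSpace ℝ (Fin d)) → Ω → ℝ) (P : Measure Ω) : Prop where
  gaussian : IsGaussianProcess (fun φ : rieszSpace d (2 * H - 1) => W φ.1) P
  centred : ∀ φ ∈ rieszSpace d (2 * H - 1), ∫ ω, W φ ω ∂P = 0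
  covariance : ∀ φ ∈ rieszSpace d (2 * H - 1), ∀ ψ ∈ rieszSpace d (2 * H - 1),
    ∫ ω, W φ ω * W ψ ω ∂P = rieszInner (2 * H - 1) φ ψ

/-! ### The stable limit -/

/-- The norm of `L^γ(ℝ^d)`. -/
def normL {d : ℕ} (γ : ℝ) (f : EuclideanSpace ℝ (Fin d) → ℝ) : ℝ :=
  (eLpNorm f (ENNReal.ofReal γ) volume).toReal

/-- The skewness parameter `β_f = ‖f‖_γ^(-γ) (‖f₊‖_γ^γ - ‖f₋‖_γ^γ)`. -/
def skewness {d : ℕ} (γ : ℝ) (f : EuclideanSpace ℝ (Fin d) → ℝ) : ℝ :=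
  normL γ f ^ (-γ) *
    (normL γ (fun x => max (f x) 0) ^ γ - normL γ (fun x => -min (f x) 0) ^ γ)

/-- `Λ` is (a version of) `Λ_γ`, the independently scattered `γ`-stable random measure on `ℝ^d`
with Lebesgue control measure and unit skewness: the random linear functional on `L^γ` with
characteristic functional
`E exp(i Λ(f)) = exp(-‖f‖_γ^γ (1 - i β_f tan(πγ/2)))`. Only the values on `L^γ` matter. -/
structure IsStableRandomMeasure {d : ℕ} {Ω : Type*} [MeasurableSpace Ω] (γ : ℝ)
    (Λ : (EuclideanSpace ℝ (Fin d) → ℝ) → Ω → ℝ) (P : Measure Ω) : Prop where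
  aemeasurable : ∀ f, MemLp f (ENNReal.ofReal γ) volume → AEMeasurable (Λ f) P
  linear : ∀ f g, MemLp f (ENNReal.ofReal γ) volume → MemLp g (ENNReal.ofReal γ) volume →
    ∀ a b : ℝ, Λ (fun x => a * f x + b * g x) =ᵐ[P] fun ω => a * Λ f ω + b * Λ g ω
  charFun_eq : ∀ f, MemLp f (ENNReal.ofReal γ) volume →
    ∫ ω, Complex.exp (Complex.I * (Λ f ω : ℂ)) ∂P =
      Complex.exp (-((normL γ f ^ γ : ℝ) : ℂ) *
        (1 - Complex.I * ((skewness γ f * Real.tan (Real.pi * γ / 2) : ℝ) : ℂ)))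

/-- The constant `c_γ`. -/
def stableConst (γ : ℝ) : ℝ :=
  (-(Real.Gamma (2 - γ) / (γ * (γ - 1)) * Real.cos (Real.pi * γ / 2))) ^ (1 / γ)

/-! ### The random grain model with randomly rotated grains -/

/-- The grain `x + v^(1/d) θ C` with location `x`, volume `v > 0` and orientation `θ`. -/
def grain {d : ℕ} (C : Set (EuclideanSpace ℝ (Fin d)))
    (z : EuclideanSpace ℝ (Fin d) × ℝ × SO d) : Set (EuclideanSpace ℝ (Fin d)) :=
  (fun y => z.1 + (z.2.1 ^ (1 / (d : ℝ))) • rotate z.2.2 y) '' C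

/-- The distribution `F_ρ(v) = F(v / ρ)` of the scaled volume `ρ V`, where `V` has distribution
`F`. -/
def scaledLaw (F : Measure ℝ) (ρ : ℝ) : Measure ℝ := F.map (fun v => ρ * v)

/-- The tail `1 - F(v)` of a probability distribution `F` on the real line. -/
def tail (F : Measure ℝ) (v : ℝ) : ℝ := F.real (Ioi v)

/-- The tail of `F` is regularly varying with exponent `γ`. -/
def HasRegularlyVaryingTail (F : Measure ℝ) (γ : ℝ) : Prop :=
  ∀ a : ℝ, 0 < a → Tendsto (fun v => tail F (a * v) / tail F v) atTop (𝓝 (a ^ (-γ)))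

/-- The quantile function `(1 / (1 - F))^←(u) = inf {v ≥ 0 : 1 / (1 - F(v)) ≥ u}`. -/
def tailQuantile (F : Measure ℝ) (u : ℝ) : ℝ :=
  sInf {v : ℝ | 0 ≤ v ∧ ENNReal.ofReal u ≤ 1 / F (Ioi v)}

/-- The intensity measure `λ dx F_ρ(dv) dθ` of the grains. -/
def grainIntensity (d : ℕ) (lam ρ : ℝ) (F : Measure ℝ) :
    Measure (EuclideanSpace ℝ (Fin d) × ℝ × SO d) :=
  ENNReal.ofReal lam •
    (volume : Measure (EuclideanSpace ℝ (Fin d))).prod ((scaledLaw F ρ).prod (haarSO d))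

/-- The intensity measure `dx v^(-γ-1) dv dθ` on `ℝ^d × (0, ∞) × SO(d)`. -/
def limitIntensity (d : ℕ) (γ : ℝ) : Measure (EuclideanSpace ℝ (Fin d) × ℝ × SO d) :=
  (volume : Measure (EuclideanSpace ℝ (Fin d))).prod
    (((volume.restrict (Ioi (0 : ℝ))).withDensity
      (fun v => ENNReal.ofReal (v ^ (-γ - 1)))).prod (haarSO d))

/-- The rotated grain field `J̃(φ) = ∫ φ(x + v^(1/d) θ C) N(dx, dv, dθ)`. -/
def grainField {d : ℕ} {Ω : Type*} (C : Set (EuclideanSpace ℝ (Fin d)))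
    (N : Ω → Measure (EuclideanSpace ℝ (Fin d) × ℝ × SO d))
    (φ : SignedMeasure (EuclideanSpace ℝ (Fin d))) (ω : Ω) : ℝ :=
  ∫ z, φ (grain C z) ∂(N ω)

/-- The centred rotated grain field `J̃(φ) - E J̃(φ)`. -/
def centredField {d : ℕ} {Ω : Type*} [MeasurableSpace Ω] (C : Set (EuclideanSpace ℝ (Fin d)))
    (N : Ω → Measure (EuclideanSpace ℝ (Fin d) × ℝ × SO d)) (P : Measure Ω)
    (φ : SignedMeasure (EuclideanSpace ℝ (Fin d))) (ω : Ω) : ℝ :=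
  grainField C N φ ω - ∫ ω', grainField C N φ ω' ∂P

/-- The dilated measure `φ_s(A) = φ(s A)`, for `s > 0`. -/
def dilate {d : ℕ} (s : ℝ) (φ : SignedMeasure (EuclideanSpace ℝ (Fin d))) :
    SignedMeasure (EuclideanSpace ℝ (Fin d)) :=
  VectorMeasure.map φ (fun x => s⁻¹ • x)

/-- The constant `c` of the large-grain limit, for a unit vector `e` and `H = (3 - γ) / 2`:
`c² = c_{2H-1,d}⁻¹ ∫_{SO(d)} ∫_0^∞ |(v^(-1/d) θ e + C) ∩ C| v^(-γ) dv dθ`. -/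
def largeGrainConst {d : ℕ} (C : Set (EuclideanSpace ℝ (Fin d))) (γ H : ℝ)
    (e : EuclideanSpace ℝ (Fin d)) : ℝ :=
  Real.sqrt ((rieszConst (2 * H - 1) d)⁻¹ *
    ∫ θ, (∫ v in Ioi (0 : ℝ),
      volume.real ((fun y => v ^ (-1 / (d : ℝ)) • rotate θ e + y) '' C ∩ C) * v ^ (-γ))
      ∂(haarSO d))

end

/-! ### Integrals with respect to a Poisson random measure -/

/-! The proof compares characteristic functions. For a Poisson random measure `N` with intensity
`η`, the compensated integral of `f` has characteristic function `exp (∫ (e^{if} - 1 - if) dη)`.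
This is proved for simple functions from the Poisson law and independence, and extended by L¹ and L²
approximation. By Lévy's continuity theorem, and because a linear combination of the fields is the
field of `∑ k, t k • φ k`, each claim reduces to convergence of one exponent, `∫ expRem (φ(x +
v^{1/d} θ C) / s) dη`, for a single signed measure.

Integrating over location and orientation first leaves a function `g` of the volume, and the
exponent becomes `λ ∫ g(ρ v) F(dv)`. Regular variation says that `F_ρ(dv) / (1 - F_ρ(1))` looks like
`γ v^{-γ-1} dv` on `(0, ∞)`. `HasRegularlyVaryingTail.tendsto_integral` makes this precise: after
the quantile substitution the Potter bounds give a dominating function, provided `g` is bounded both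
by a multiple of `v^p` with `p > γ` and by a multiple of `v`. For finite signed measures the bound
in `v` is a Fubini computation. The bound in `v^p` comes from Riesz energy: two points lie in a
common grain of volume `v` only if their distance is at most a multiple of `v^{1/d}`, which gives `p
= 2 - α > γ`.

Intermediate scaling: `s = 1`, the function `g` is fixed, and the limiting exponent is `γ σ₀` times
the one of the limiting Poisson measure. The dilation `(x, v) ↦ (σ x, σ^d v)` multiplies the
limiting intensity by `σ^{(γ-1)d}`, and this absorbs the factor.

Large grains: `s → ∞` and `s² expRem (u / s) → -u²/2`, so the limit is Gaussian with covariance `∫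
φ(grain) ψ(grain)` under the limiting intensity. By Fubini this is a double integral of a kernel of
overlap volumes. Rotation invariance and scaling force the kernel to be a multiple of `|x -
y|^{-(γ-1)d}` (`lintegral_overlap_eq`), and the multiple is the constant `c`.

Small grains: the volumes that matter have the order of the quantile, which tends to zero. By
continuity of translation in L¹ a grain of small volume `v` at `x` carries mass about `v φ(x)`, so
the exponent tends to `∫∫ expRem (v φ(x) / c_γ) v^{-γ-1} dv dx`. Evaluating the `v`-integral by
Gamma functions gives the stable characteristic exponent. -/

theorem lintegral_natCast_poissonMeasure (r : ℝ≥0) :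
    ∫⁻ k : ℕ, (k : ℝ≥0∞) ∂(poissonMeasure r) = r := by
  have h1 : HasSum (fun n : ℕ => Real.exp (-r) * r ^ n / (n.factorial : ℝ) * n) (r : ℝ) := by
    -- The term `n = 0` vanishes; after the shift, `(n + 1) r^{n+1} / (n + 1)! = r · r^n / n!`.
    rw [← hasSum_nat_add_iff' 1]
    have h := (hasSum_one_poissonMeasure r).mul_left (r : ℝ)
    simp only [Finset.range_one, Finset.sum_singleton, Nat.cast_zero, mul_zero, sub_zero]
    convert! h using 1
    · ext n
      have : (n.factorial : ℝ) ≠ 0 := by positivity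
      rw [Nat.factorial_succ]
      push_cast
      field_simp
      ring
    · simp
  rw [poissonMeasure, lintegral_sum_measure]
  simp only [lintegral_smul_measure, lintegral_dirac, smul_eq_mul]
  have h2 : ∀ n : ℕ, ENNReal.ofReal (Real.exp (-r) * r ^ n / (n.factorial : ℝ)) * (n : ℝ≥0∞)
      = ENNReal.ofReal (Real.exp (-r) * r ^ n / (n.factorial : ℝ) * n) := fun n => by
    rw [ENNReal.ofReal_mul (by positivity), ENNReal.ofReal_natCast]
  simp_rw [h2]
  rw [← ENNReal.ofReal_tsum_of_nonneg (fun n => by positivity) h1.summable, h1.tsum_eq,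
    ENNReal.ofReal_coe_nnreal]

namespace IsPoissonRandomMeasure

variable {Ω S : Type*} [MeasurableSpace Ω] [MeasurableSpace S] {N : Ω → Measure S}
  {η : Measure S} {P : Measure Ω}

theorem measurable_apply (hN : IsPoissonRandomMeasure N η P) {A : Set S} (hA : MeasurableSet A) :
    Measurable fun ω => N ω A :=
  (Measure.measurable_coe hA).comp hN.measurable

theorem lintegral_apply (hN : IsPoissonRandomMeasure N η P) {A : Set S} (hA : MeasurableSet A)
    (hfin : η A ≠ ∞) : ∫⁻ ω, N ω A ∂P = η A := by
  have h := lintegral_map (μ := P) (f := fun x : ℝ≥0∞ => x) measurable_id (hN.measurable_apply hA)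
  rw [← h, hN.map_eq A hA hfin, lintegral_map (f := fun x : ℝ≥0∞ => x) measurable_id .of_discrete,
    lintegral_natCast_poissonMeasure, ENNReal.coe_toNNReal hfin]

/-- The Poisson means identify the mean measure only on sets of finite intensity; a countable cover
by such sets does the rest. Campbell's formula is then integration against `P.bind N`. -/
theorem bind_eq (hN : IsPoissonRandomMeasure N η P) [SigmaFinite η] : P.bind N = η := by
  refine (Measure.ext_iff_of_iUnion_eq_univ (iUnion_spanningSets η)).2 fun i => ?_
  ext A hA
  rw [Measure.restrict_apply hA, Measure.restrict_apply hA]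
  have hm := hA.inter (measurableSet_spanningSets η i)
  rw [Measure.bind_apply hm hN.measurable.aemeasurable, hN.lintegral_apply hm]
  exact ((measure_mono inter_subset_right).trans_lt (measure_spanningSets_lt_top η i)).ne

/-- Campbell's formula. -/
theorem lintegral_lintegral (hN : IsPoissonRandomMeasure N η P) [SigmaFinite η] {f : S → ℝ≥0∞}
    (hf : Measurable f) : ∫⁻ ω, ∫⁻ z, f z ∂(N ω) ∂P = ∫⁻ z, f z ∂η := by
  rw [← Measure.lintegral_bind hN.measurable.aemeasurable hf.aemeasurable, hN.bind_eq]

/-- The number of points in an `η`-null set is nonnegative with mean zero, hence almost surely zero.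
-/
theorem ae_ae (hN : IsPoissonRandomMeasure N η P) [SigmaFinite η] {p : S → Prop}
    (hp : ∀ᵐ z ∂η, p z) : ∀ᵐ ω ∂P, ∀ᵐ z ∂(N ω), p z := by
  rw [ae_iff] at hp
  set A := toMeasurable η {z | ¬ p z}
  have hA0 : η A = 0 := by rw [measure_toMeasurable, hp]
  have hA : MeasurableSet A := measurableSet_toMeasurable _ _
  have h := hN.lintegral_apply hA (by simp [hA0])
  rw [hA0, lintegral_eq_zero_iff (hN.measurable_apply hA)] at h
  filter_upwards [h] with ω hω
  rw [ae_iff]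
  exact measure_mono_null (subset_toMeasurable _ _) hω

theorem ae_integrable (hN : IsPoissonRandomMeasure N η P) [SigmaFinite η] {f : S → ℝ}
    (hf : Measurable f) (hfi : Integrable f η) : ∀ᵐ ω ∂P, Integrable f (N ω) := by
  have h := hN.lintegral_lintegral hf.enorm
  have h2 := ae_lt_top (((Measure.measurable_lintegral hf.enorm)).comp hN.measurable)
    (μ := P) (by simp only [Function.comp_def]; rw [h]; exact hfi.hasFiniteIntegral.ne)
  filter_upwards [h2] with ω hω
  exact ⟨hf.aestronglyMeasurable, hω⟩

/-- Almost surely the integral is a difference of two extended nonnegative integrals, and each of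
these is measurable in `ω`. -/
theorem aestronglyMeasurable_integral (hN : IsPoissonRandomMeasure N η P) [SigmaFinite η]
    {f : S → ℝ} (hf : Measurable f) (hfi : Integrable f η) :
    AEStronglyMeasurable (fun ω => ∫ z, f z ∂(N ω)) P := by
  have h1 : Measurable fun ω => (∫⁻ z, ENNReal.ofReal (f z) ∂(N ω)).toReal -
      (∫⁻ z, ENNReal.ofReal (-f z) ∂(N ω)).toReal :=
    ((Measure.measurable_lintegral hf.ennreal_ofReal).comp hN.measurable).ennreal_toReal.sub
    ((Measure.measurable_lintegral hf.neg.ennreal_ofReal).comp hN.measurable).ennreal_toReal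
  refine h1.aestronglyMeasurable.congr ?_
  filter_upwards [hN.ae_integrable hf hfi] with ω hω
  rw [integral_eq_lintegral_pos_part_sub_lintegral_neg_part hω]

theorem lintegral_enorm_integral_le (hN : IsPoissonRandomMeasure N η P) [SigmaFinite η]
    {f : S → ℝ} (hf : Measurable f) :
    ∫⁻ ω, ‖∫ z, f z ∂(N ω)‖ₑ ∂P ≤ ∫⁻ z, ‖f z‖ₑ ∂η := by
  rw [← hN.lintegral_lintegral hf.enorm]
  exact lintegral_mono fun ω => enorm_integral_le_lintegral_enorm _

theorem integrable_integral (hN : IsPoissonRandomMeasure N η P) [SigmaFinite η]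
    {f : S → ℝ} (hf : Measurable f) (hfi : Integrable f η) :
    Integrable (fun ω => ∫ z, f z ∂(N ω)) P :=
  ⟨hN.aestronglyMeasurable_integral hf hfi,
    (hN.lintegral_enorm_integral_le hf).trans_lt hfi.hasFiniteIntegral⟩

theorem integral_integral (hN : IsPoissonRandomMeasure N η P) [SigmaFinite η]
    {f : S → ℝ} (hf : Measurable f) (hfi : Integrable f η) :
    ∫ ω, ∫ z, f z ∂(N ω) ∂P = ∫ z, f z ∂η := by
  have hp : Measurable fun ω => ∫⁻ z, ENNReal.ofReal (f z) ∂(N ω) :=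
    (Measure.measurable_lintegral hf.ennreal_ofReal).comp hN.measurable
  have hn : Measurable fun ω => ∫⁻ z, ENNReal.ofReal (-f z) ∂(N ω) :=
    (Measure.measurable_lintegral hf.neg.ennreal_ofReal).comp hN.measurable
  have hp' := hN.lintegral_lintegral hf.ennreal_ofReal
  have hn' : ∫⁻ ω, ∫⁻ z, ENNReal.ofReal (-f z) ∂(N ω) ∂P = ∫⁻ z, ENNReal.ofReal (-f z) ∂η :=
    hN.lintegral_lintegral hf.neg.ennreal_ofReal
  have hpt : ∫⁻ z, ENNReal.ofReal (f z) ∂η ≠ ∞ := hfi.lintegral_lt_top.ne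
  have hnt : ∫⁻ z, ENNReal.ofReal (-f z) ∂η ≠ ∞ := hfi.neg.lintegral_lt_top.ne
  have h : (fun ω => ∫ z, f z ∂(N ω)) =ᵐ[P] fun ω => (∫⁻ z, ENNReal.ofReal (f z) ∂(N ω)).toReal -
      (∫⁻ z, ENNReal.ofReal (-f z) ∂(N ω)).toReal := by
    filter_upwards [hN.ae_integrable hf hfi] with ω hω
    rw [integral_eq_lintegral_pos_part_sub_lintegral_neg_part hω]
  rw [integral_congr_ae h, integral_sub, integral_toReal hp.aemeasurable, hp',
    integral_toReal hn.aemeasurable, hn', integral_eq_lintegral_pos_part_sub_lintegral_neg_part hfi]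
  · exact ae_lt_top hn (by rw [hn']; exact hnt)
  · exact ae_lt_top hp (by rw [hp']; exact hpt)
  · exact integrable_toReal_of_lintegral_ne_top hp.aemeasurable (by rw [hp']; exact hpt)
  · exact integrable_toReal_of_lintegral_ne_top hn.aemeasurable (by rw [hn']; exact hnt)

theorem integral_exp_apply (hN : IsPoissonRandomMeasure N η P) {A : Set S} (hA : MeasurableSet A)
    (hfin : η A ≠ ∞) (x : ℝ) :
    ∫ ω, Complex.exp (Complex.I * ((x * (N ω).real A : ℝ) : ℂ)) ∂P =
      Complex.exp (((η A).toReal : ℂ) * (Complex.exp (Complex.I * (x : ℂ)) - 1)) := by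
  have h1 : ∫ ω, Complex.exp (Complex.I * ((x * (N ω).real A : ℝ) : ℂ)) ∂P
      = ∫ y, Complex.exp (Complex.I * ((x * y.toReal : ℝ) : ℂ)) ∂(P.map fun ω => N ω A) := by
    rw [integral_map (hN.measurable_apply hA).aemeasurable]
    · rfl
    · exact Measurable.aestronglyMeasurable (by fun_prop)
  rw [h1, hN.map_eq A hA hfin, integral_map .of_discrete
    (Measurable.aestronglyMeasurable (by fun_prop))]
  have h := charFun_map_cast_poissonMeasure (η A).toNNReal x
  rw [charFun_apply_real, integral_map .of_discrete
    (Measurable.aestronglyMeasurable (by fun_prop))] at h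
  convert! h using 2
  · ext k
    simp only [ENNReal.toReal_natCast]
    push_cast
    ring_nf
  · rw [mul_comm Complex.I]; rfl

/-- The integral of a simple function is a finite combination of independent Poisson counts of its
level sets, so the characteristic function factors. -/
theorem charFun_simpleFunc (hN : IsPoissonRandomMeasure N η P) [SigmaFinite η]
    (f : SimpleFunc S ℝ) (hfi : Integrable f η) :
    ∫ ω, Complex.exp (Complex.I * ((∫ z, f z ∂(N ω) : ℝ) : ℂ)) ∂P =
      Complex.exp (∫ z, (Complex.exp (Complex.I * (f z : ℂ)) - 1) ∂η) := by
  classical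
  -- The value 0 is left out because its level set may have infinite intensity; it contributes
  -- nothing to either side.
  set s : Finset ℝ := f.range.filter (· ≠ 0) with hs
  have hfin : ∀ x ∈ s, η (f ⁻¹' {x}) ≠ ∞ := fun x hx =>
    (SimpleFunc.integrable_iff.1 hfi x (Finset.mem_filter.1 hx).2).ne
  have h1 : ∀ᵐ ω ∂P, ∫ z, f z ∂(N ω) = ∑ x ∈ s, x * (N ω).real (f ⁻¹' {x}) := by
    filter_upwards [hN.ae_integrable f.measurable hfi] with ω hω
    rw [← SimpleFunc.integral_eq_integral f hω, SimpleFunc.integral_eq]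
    rw [hs, Finset.sum_filter_of_ne]
    · simp [mul_comm]
    · rintro x - hx rfl; simp at hx
  have h2 : ∫ z, (Complex.exp (Complex.I * (f z : ℂ)) - 1) ∂η =
      ∑ x ∈ s, ((η (f ⁻¹' {x})).toReal : ℂ) * (Complex.exp (Complex.I * (x : ℂ)) - 1) := by
    have := SimpleFunc.map_integral f (fun x : ℝ => Complex.exp (Complex.I * (x : ℂ)) - 1) hfi
      (by simp)
    rw [SimpleFunc.integral_eq_integral] at this
    · simp only [SimpleFunc.map_apply] at this
      rw [this, hs, Finset.sum_filter_of_ne]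
      · rfl
      · rintro x - hx rfl; simp at hx
    · exact SimpleFunc.integrable_iff.2 fun y hy => by
        refine (measure_mono ?_).trans_lt ((SimpleFunc.finMeasSupp_iff.2 fun x hx =>
          SimpleFunc.integrable_iff.1 hfi x hx : f.FinMeasSupp η))
        intro z hz
        simp only [SimpleFunc.coe_map, mem_preimage, Function.comp_apply, mem_singleton_iff] at hz
        intro h0
        apply hy
        rw [← hz, h0]; simp
  rw [h2, Complex.exp_sum]
  -- Independence is stated for families indexed by `Fin n`, so the nonzero values are enumerated.
  set e := s.equivFin
  have hind := hN.indep s.card (fun k => f ⁻¹' {(e.symm k : ℝ)})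
    (fun k => f.measurableSet_fiber _) (fun j k hjk => by
      refine Disjoint.preimage _ ?_
      rw [disjoint_singleton]
      exact fun h => hjk (e.symm.injective (Subtype.ext h)))
  have h3 := hind.integral_fun_prod_comp
    (f := fun k y => Complex.exp (Complex.I * (((e.symm k : ℝ) * ENNReal.toReal y : ℝ) : ℂ)))
    (fun k => (hN.measurable_apply (f.measurableSet_fiber _)).aemeasurable)
    (fun k => Measurable.aestronglyMeasurable (by fun_prop))
  have h4 : ∀ ω, Complex.exp (Complex.I * ((∑ x ∈ s, x * (N ω).real (f ⁻¹' {x}) : ℝ) : ℂ)) =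
      ∏ k, Complex.exp (Complex.I *
        (((e.symm k : ℝ) * (N ω (f ⁻¹' {(e.symm k : ℝ)})).toReal : ℝ) : ℂ)) := by
    intro ω
    rw [← Complex.exp_sum]
    congr 1
    rw [← Finset.sum_coe_sort s, Complex.ofReal_sum, Finset.mul_sum]
    exact (Equiv.sum_comp e.symm (fun x : s => Complex.I *
      (((x : ℝ) * (N ω).real (f ⁻¹' {(x : ℝ)}) : ℝ) : ℂ))).symm
  have h5 : (fun ω => Complex.exp (Complex.I * ((∫ z, f z ∂(N ω) : ℝ) : ℂ))) =ᵐ[P]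
      fun ω => ∏ k, Complex.exp (Complex.I *
        (((e.symm k : ℝ) * (N ω (f ⁻¹' {(e.symm k : ℝ)})).toReal : ℝ) : ℂ)) := by
    filter_upwards [h1] with ω hω
    rw [hω, h4]
  rw [integral_congr_ae h5, h3, ← Finset.prod_coe_sort s, ← Equiv.prod_comp e.symm]
  refine Finset.prod_congr rfl fun k _ => ?_
  exact hN.integral_exp_apply (f.measurableSet_fiber _) (hfin _ (e.symm k).2) _

end IsPoissonRandomMeasure

noncomputable section

/-! ### The compensated exponential -/

/-- The compensated exponential `e^(iu) - 1 - iu`. -/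
def expRem (u : ℝ) : ℂ := Complex.exp (Complex.I * u) - 1 - Complex.I * u

@[simp] theorem expRem_zero : expRem 0 = 0 := by simp [expRem]

theorem hasDerivAt_expRem (u : ℝ) :
    HasDerivAt expRem (Complex.I * (Complex.exp (Complex.I * u) - 1)) u := by
  have h1 : HasDerivAt (fun u : ℝ => Complex.I * (u : ℂ)) Complex.I u := by
    simpa using (Complex.ofRealCLM.hasDerivAt (x := u)).const_mul Complex.I
  have h2 := ((h1.cexp).sub_const 1).sub h1
  convert! h2 using 1
  ring

@[fun_prop] theorem continuous_expRem : Continuous expRem := by unfold expRem; fun_prop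

@[fun_prop] theorem measurable_expRem : Measurable expRem := continuous_expRem.measurable

theorem norm_exp_I_mul_sub_one_le (u : ℝ) : ‖Complex.exp (Complex.I * u) - 1‖ ≤ |u| := by
  simpa using Real.norm_exp_I_mul_ofReal_sub_one_le (x := u)

theorem norm_exp_I_mul_sub_exp_I_mul_le (u w : ℝ) :
    ‖Complex.exp (Complex.I * u) - Complex.exp (Complex.I * w)‖ ≤ |u - w| := by
  have h : Complex.exp (Complex.I * u) - Complex.exp (Complex.I * w)
      = Complex.exp (Complex.I * w) * (Complex.exp (Complex.I * (u - w : ℝ)) - 1) := by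
    rw [mul_sub, ← Complex.exp_add]; push_cast; ring_nf
  rw [h, norm_mul, mul_comm Complex.I (w : ℂ), Complex.norm_exp_ofReal_mul_I, one_mul]
  exact norm_exp_I_mul_sub_one_le _

theorem norm_expRem_sub_le_two_mul (u w : ℝ) : ‖expRem u - expRem w‖ ≤ 2 * |u - w| := by
  have h : expRem u - expRem w = (Complex.exp (Complex.I * u) - Complex.exp (Complex.I * w))
      - Complex.I * ((u - w : ℝ) : ℂ) := by
    unfold expRem; push_cast; ring
  rw [h]
  refine (norm_sub_le _ _).trans ?_
  have h1 := norm_exp_I_mul_sub_exp_I_mul_le u w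
  rw [norm_mul, Complex.norm_I, one_mul, Complex.norm_real, Real.norm_eq_abs]
  linarith

theorem norm_expRem_le_two_mul (u : ℝ) : ‖expRem u‖ ≤ 2 * |u| := by
  simpa using norm_expRem_sub_le_two_mul u 0

/-- Mean value inequality on the segment between `w` and `u`: the derivative `i(e^{ix} - 1)` has
norm at most `|x|`. -/
theorem norm_expRem_sub_le_mul_add (u w : ℝ) :
    ‖expRem u - expRem w‖ ≤ |u - w| * (|u| + |w|) := by
  have h := (convex_uIcc w u).norm_image_sub_le_of_norm_hasDerivWithin_le (C := |u| + |w|)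
    (fun x _ => (hasDerivAt_expRem x).hasDerivWithinAt) (fun x hx => ?_)
    left_mem_uIcc right_mem_uIcc
  · rw [mul_comm]; simpa using h
  · rw [norm_mul, Complex.norm_I, one_mul]
    refine (norm_exp_I_mul_sub_one_le x).trans ?_
    have h : |x| ≤ max |w| |u| := by
      rcases mem_uIcc.1 hx with ⟨h1, h2⟩ | ⟨h1, h2⟩
      · exact abs_le_max_abs_abs h1 h2
      · rw [max_comm]; exact abs_le_max_abs_abs h1 h2
    exact h.trans (max_le (by linarith [abs_nonneg u]) (by linarith [abs_nonneg w]))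

theorem norm_expRem_le_sq (u : ℝ) : ‖expRem u‖ ≤ u ^ 2 := by
  have h := norm_expRem_sub_le_mul_add u 0
  simp only [expRem_zero, sub_zero, abs_zero, add_zero, abs_mul_abs_self] at h
  rwa [sq]

/-- The derivative of the left side is `i · expRem`, of norm at most `x²`; integrate once more. -/
theorem norm_expRem_add_le_cube (u : ℝ) : ‖expRem u + (u ^ 2 / 2 : ℝ)‖ ≤ |u| ^ 3 := by
  have hd : ∀ x : ℝ, HasDerivAt (fun x : ℝ => expRem x + ((x ^ 2 / 2 : ℝ) : ℂ))
      (Complex.I * expRem x) x := fun x => by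
    have h1 : HasDerivAt (fun x : ℝ => x ^ 2 / 2) x x := by
      simpa using (hasDerivAt_pow 2 x).div_const 2
    convert! (hasDerivAt_expRem x).add h1.ofReal_comp using 1
    unfold expRem
    linear_combination -(x : ℂ) * Complex.I_sq
  have h := (convex_uIcc 0 u).norm_image_sub_le_of_norm_hasDerivWithin_le (C := u ^ 2)
    (fun x _ => (hd x).hasDerivWithinAt) (fun x hx => ?_) left_mem_uIcc right_mem_uIcc
  · have h3 : |u| ^ 3 = u ^ 2 * |u| := by rw [← sq_abs u]; ring
    rw [h3]
    simpa using h
  · rw [norm_mul, Complex.norm_I, one_mul]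
    refine (norm_expRem_le_sq x).trans ?_
    rw [sq_le_sq]
    have := abs_sub_left_of_mem_uIcc hx
    simpa using this

/-- The exponential is 1-Lipschitz on the closed left half-plane, which is convex. -/
theorem norm_one_sub_exp_le {z : ℂ} (hz : z.re ≤ 0) : ‖1 - Complex.exp z‖ ≤ ‖z‖ := by
  have h := (convex_halfSpace_re_le 0).norm_image_sub_le_of_norm_deriv_le (f := Complex.exp) (C := 1)
    (x := z) (y := 0) (fun x _ => Complex.differentiableAt_exp) (fun x hx => ?_) hz (by simp)
  · simpa using h
  · rw [Complex.deriv_exp, Complex.norm_exp]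
    exact Real.exp_le_one_iff.2 hx

theorem re_expRem_nonpos (u : ℝ) : (expRem u).re ≤ 0 := by
  unfold expRem
  rw [mul_comm Complex.I]
  simp only [Complex.sub_re, Complex.exp_ofReal_mul_I_re, Complex.one_re, Complex.mul_re,
    Complex.ofReal_re, Complex.I_re, Complex.ofReal_im, Complex.I_im]
  linarith [Real.cos_le_one u]

/-- The compensated integral `∫ f dN - ∫ f dη` of an integrable function `f`. -/
def compensated {Ω S : Type*} [MeasurableSpace S] (N : Ω → Measure S) (η : Measure S) (f : S → ℝ)
    (ω : Ω) : ℝ :=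
  (∫ z, f z ∂(N ω)) - ∫ z, f z ∂η

theorem compensated_const_mul {Ω S : Type*} [MeasurableSpace S] {N : Ω → Measure S}
    {η : Measure S} (f : S → ℝ) (c : ℝ) :
    compensated N η (fun z => c * f z) = fun ω => c * compensated N η f ω := by
  ext ω
  simp only [compensated, integral_const_mul]
  ring

theorem integrable_expRem {S : Type*} [MeasurableSpace S] {η : Measure S} {f : S → ℝ}
    (hfi : Integrable f η) : Integrable (fun z => expRem (f z)) η := by
  refine Integrable.mono' (hfi.norm.const_mul 2)
    (continuous_expRem.comp_aestronglyMeasurable hfi.aestronglyMeasurable) ?_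
  exact ae_of_all _ fun z => norm_expRem_le_two_mul _

/-- Since `u ↦ e^{iu}` is 1-Lipschitz, L¹ convergence of the variables gives L¹ convergence of the
exponentials. -/
theorem tendsto_integral_cexp {Ω : Type*} [MeasurableSpace Ω] {P : Measure Ω}
    [IsProbabilityMeasure P] {Y : ℕ → Ω → ℝ} {Z : Ω → ℝ} (hY : ∀ n, AEStronglyMeasurable (Y n) P)
    (hZ : AEStronglyMeasurable Z P)
    (h : Tendsto (fun n => ∫⁻ ω, ‖Y n ω - Z ω‖ₑ ∂P) atTop (𝓝 0)) :
    Tendsto (fun n => ∫ ω, Complex.exp (Complex.I * (Y n ω : ℂ)) ∂P) atTop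
      (𝓝 (∫ ω, Complex.exp (Complex.I * (Z ω : ℂ)) ∂P)) := by
  have hm : ∀ {W : Ω → ℝ}, AEStronglyMeasurable W P →
      Integrable (fun ω => Complex.exp (Complex.I * (W ω : ℂ))) P := fun {W} hW => by
    refine Integrable.mono' (integrable_const (1 : ℝ)) ?_ (ae_of_all _ fun ω => ?_)
    · exact (by fun_prop : Continuous fun x : ℝ =>
        Complex.exp (Complex.I * (x : ℂ))).comp_aestronglyMeasurable hW
    · rw [mul_comm, Complex.norm_exp_ofReal_mul_I]
  refine tendsto_integral_of_L1 _ (hm hZ).aestronglyMeasurable (Eventually.of_forall fun n => hm (hY n)) ?_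
  refine tendsto_of_tendsto_of_tendsto_of_le_of_le tendsto_const_nhds h (fun _ => zero_le)
    fun n => lintegral_mono fun ω => ?_
  rw [enorm_le_iff_norm_le]
  simpa using norm_exp_I_mul_sub_exp_I_mul_le (Y n ω) (Z ω)

namespace IsPoissonRandomMeasure

variable {Ω S : Type*} [MeasurableSpace Ω] [MeasurableSpace S] {N : Ω → Measure S}
  {η : Measure S} {P : Measure Ω}

variable [SigmaFinite η]

theorem compensated_add (hN : IsPoissonRandomMeasure N η P) {f g : S → ℝ}
    (hf : Measurable f) (hfi : Integrable f η) (hg : Measurable g) (hgi : Integrable g η) :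
    compensated N η (fun z => f z + g z) =ᵐ[P]
      fun ω => compensated N η f ω + compensated N η g ω := by
  filter_upwards [hN.ae_integrable hf hfi, hN.ae_integrable hg hgi] with ω h1 h2
  simp only [compensated]
  rw [integral_add h1 h2, integral_add hfi hgi]
  ring

theorem compensated_sub (hN : IsPoissonRandomMeasure N η P) {f g : S → ℝ}
    (hf : Measurable f) (hfi : Integrable f η) (hg : Measurable g) (hgi : Integrable g η) :
    compensated N η (fun z => f z - g z) =ᵐ[P]
      fun ω => compensated N η f ω - compensated N η g ω := by
  filter_upwards [hN.ae_integrable hf hfi, hN.ae_integrable hg hgi] with ω h1 h2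
  simp only [compensated]
  rw [integral_sub h1 h2, integral_sub hfi hgi]
  ring

variable [IsProbabilityMeasure P]

/-- The characteristic functional of a Poisson random measure. -/
theorem integral_exp (hN : IsPoissonRandomMeasure N η P) {f : S → ℝ} (hf : Measurable f)
    (hfi : Integrable f η) :
    ∫ ω, Complex.exp (Complex.I * ((∫ z, f z ∂(N ω) : ℝ) : ℂ)) ∂P =
      Complex.exp (∫ z, (Complex.exp (Complex.I * (f z : ℂ)) - 1) ∂η) := by
  -- Simple functions converging to `f` in `L¹(η)`. By Campbell's formula their integrals against
  -- `N` converge in `L¹(P)`, so both sides of the identity pass to the limit.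
  set g : ℕ → SimpleFunc S ℝ := fun n =>
    SimpleFunc.approxOn f hf (range f ∪ {0}) 0 (by simp) n with hg
  have hgi : ∀ n, Integrable (g n) η := SimpleFunc.integrable_approxOn_range hf hfi
  have hlim : Tendsto (fun n => ∫⁻ z, ‖g n z - f z‖ₑ ∂η) atTop (𝓝 0) :=
    SimpleFunc.tendsto_approxOn_range_L1_enorm hf hfi
  have h1 : Tendsto (fun n => ∫ ω, Complex.exp (Complex.I * ((∫ z, g n z ∂(N ω) : ℝ) : ℂ)) ∂P)
      atTop (𝓝 (∫ ω, Complex.exp (Complex.I * ((∫ z, f z ∂(N ω) : ℝ) : ℂ)) ∂P)) := by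
    refine tendsto_integral_cexp
      (fun n => hN.aestronglyMeasurable_integral (g n).measurable (hgi n))
      (hN.aestronglyMeasurable_integral hf hfi) ?_
    refine tendsto_of_tendsto_of_tendsto_of_le_of_le tendsto_const_nhds hlim (fun _ => zero_le)
      fun n => ?_
    refine le_trans (le_of_eq ?_)
      (hN.lintegral_enorm_integral_le ((g n).measurable.sub hf))
    refine lintegral_congr_ae ?_
    filter_upwards [hN.ae_integrable hf hfi, hN.ae_integrable (g n).measurable (hgi n)]
      with ω h1 h2
    rw [← integral_sub h2 h1]
  have hm : ∀ {f : S → ℝ}, Integrable f η →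
      Integrable (fun z => Complex.exp (Complex.I * (f z : ℂ)) - 1) η := fun {f} hf => by
    refine Integrable.mono' hf.norm ?_ (ae_of_all _ fun z => norm_exp_I_mul_sub_one_le _)
    exact (by fun_prop : Continuous fun x : ℝ =>
      Complex.exp (Complex.I * (x : ℂ)) - 1).comp_aestronglyMeasurable hf.aestronglyMeasurable
  have h2 : Tendsto (fun n => Complex.exp (∫ z, (Complex.exp (Complex.I * (g n z : ℂ)) - 1) ∂η))
      atTop (𝓝 (Complex.exp (∫ z, (Complex.exp (Complex.I * (f z : ℂ)) - 1) ∂η))) := by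
    refine (Complex.continuous_exp.tendsto _).comp ?_
    refine tendsto_integral_of_L1 _ (hm hfi).aestronglyMeasurable (Eventually.of_forall fun n => hm (hgi n)) ?_
    refine tendsto_of_tendsto_of_tendsto_of_le_of_le tendsto_const_nhds hlim (fun _ => zero_le)
      fun n => lintegral_mono fun z => ?_
    rw [enorm_le_iff_norm_le]
    simpa using norm_exp_I_mul_sub_exp_I_mul_le (g n z) (f z)
  refine tendsto_nhds_unique h1 (h2.congr fun n => ?_)
  rw [hN.charFun_simpleFunc (g n) (hgi n)]

theorem integral_exp_compensated (hN : IsPoissonRandomMeasure N η P) {f : S → ℝ}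
    (hf : Measurable f) (hfi : Integrable f η) :
    ∫ ω, Complex.exp (Complex.I * (compensated N η f ω : ℂ)) ∂P =
      Complex.exp (∫ z, expRem (f z) ∂η) := by
  have h : ∀ ω, Complex.exp (Complex.I * (compensated N η f ω : ℂ)) =
      Complex.exp (-(Complex.I * ((∫ z, f z ∂η : ℝ) : ℂ))) *
        Complex.exp (Complex.I * ((∫ z, f z ∂(N ω) : ℝ) : ℂ)) := fun ω => by
    rw [← Complex.exp_add, compensated]; push_cast; ring_nf
  simp_rw [h]
  rw [integral_const_mul, hN.integral_exp hf hfi, ← Complex.exp_add]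
  congr 1
  have h1 : ∀ z, Complex.exp (Complex.I * (f z : ℂ)) - 1 =
      expRem (f z) + Complex.I * (f z : ℂ) := fun z => by unfold expRem; ring
  have h2 : Integrable (fun z => Complex.I * (f z : ℂ)) η := hfi.ofReal.const_mul _
  simp_rw [h1]
  rw [integral_add (integrable_expRem hfi) h2, integral_const_mul,
    integral_complex_ofReal]
  ring

theorem integrable_compensated (hN : IsPoissonRandomMeasure N η P) {f : S → ℝ}
    (hf : Measurable f) (hfi : Integrable f η) : Integrable (compensated N η f) P :=
  (hN.integrable_integral hf hfi).sub (integrable_const _)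

/-- The second moment bound for compensated integrals. -/
theorem lintegral_compensated_sq_le (hN : IsPoissonRandomMeasure N η P) {f : S → ℝ}
    (hf : Measurable f) (hfi : Integrable f η) (hf2 : MemLp f 2 η) :
    ∫⁻ ω, ENNReal.ofReal (compensated N η f ω ^ 2) ∂P ≤
      ENNReal.ofReal (2 * ∫ z, f z ^ 2 ∂η) := by
  set Y := compensated N η f with hYdef
  have hY : Integrable Y P := hN.integrable_compensated hf hfi
  have hYm : AEMeasurable Y P := hY.aemeasurable
  -- The second moment is recovered from the characteristic function: `2 t⁻² (1 - cos (t Y)) → Y²`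
  -- as `t → 0`, the means are bounded uniformly in `t`, and Fatou's lemma concludes. The factor 2
  -- in the bound comes from using `‖expRem u‖ ≤ u²` in place of `u²/2`.
  set t : ℕ → ℝ := fun n => ((n : ℝ) + 1)⁻¹ with ht
  have htpos : ∀ n, 0 < t n := fun n => by positivity
  have htlim : Tendsto t atTop (𝓝 0) := by
    simpa [ht, one_div] using tendsto_one_div_add_atTop_nhds_zero_nat (𝕜 := ℝ)
  set F : ℕ → Ω → ℝ≥0∞ := fun n ω => ENNReal.ofReal (2 * (t n ^ 2)⁻¹ *
    (1 - Real.cos (t n * Y ω))) with hF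
  have hre : ∀ u : ℝ, (expRem u).re = Real.cos u - 1 := fun u => by
    unfold expRem
    rw [mul_comm Complex.I]
    simp
  have hlim : ∀ ω, Tendsto (fun n => F n ω) atTop (𝓝 (ENNReal.ofReal (Y ω ^ 2))) := fun ω => by
    refine ENNReal.tendsto_ofReal ?_
    rw [tendsto_iff_norm_sub_tendsto_zero]
    have h0 : Tendsto (fun n => 2 * |Y ω| ^ 3 * t n) atTop (𝓝 0) := by
      simpa using htlim.const_mul (2 * |Y ω| ^ 3)
    refine squeeze_zero (fun _ => norm_nonneg _) (fun n => ?_) h0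
    have h1 := (Complex.abs_re_le_norm _).trans (norm_expRem_add_le_cube (t n * Y ω))
    rw [Complex.add_re, hre, Complex.ofReal_re, abs_mul, abs_of_pos (htpos n), mul_pow] at h1
    have h2 : 2 * (t n ^ 2)⁻¹ * (1 - Real.cos (t n * Y ω)) - Y ω ^ 2 =
        -(2 * (t n ^ 2)⁻¹) * (Real.cos (t n * Y ω) - 1 + (t n ^ 2 * Y ω ^ 2) / 2) := by
      have := (htpos n).ne'
      field_simp
      ring
    rw [h2, norm_mul, norm_neg, Real.norm_of_nonneg (by positivity), Real.norm_eq_abs]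
    refine (mul_le_mul_of_nonneg_left h1 (by positivity)).trans (le_of_eq ?_)
    have := (htpos n).ne'
    field_simp
  have hbound : ∀ n, ∫⁻ ω, F n ω ∂P ≤ ENNReal.ofReal (2 * ∫ z, f z ^ 2 ∂η) := fun n => by
    have hfn : Integrable (fun z => t n * f z) η := hfi.const_mul _
    have hchar := hN.integral_exp_compensated (hf.const_mul (t n)) hfn
    rw [compensated_const_mul] at hchar
    set w := ∫ z, expRem (t n * f z) ∂η with hw
    have hwre : w.re ≤ 0 := by
      have : w.re = ∫ z, (expRem (t n * f z)).re ∂η :=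
        (integral_re (integrable_expRem hfn)).symm
      rw [this]
      exact integral_nonpos fun z => re_expRem_nonpos _
    have hwn : ‖w‖ ≤ t n ^ 2 * ∫ z, f z ^ 2 ∂η := by
      rw [← integral_const_mul]
      refine norm_integral_le_of_norm_le (hf2.integrable_sq.const_mul _) (ae_of_all _ fun z => ?_)
      rw [← mul_pow]
      exact norm_expRem_le_sq _
    have hcm : AEStronglyMeasurable (fun ω => Real.cos (t n * Y ω)) P :=
      (by fun_prop : Continuous fun x : ℝ =>
        Real.cos (t n * x)).comp_aestronglyMeasurable hY.aestronglyMeasurable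
    have hci : Integrable (fun ω => Real.cos (t n * Y ω)) P :=
      Integrable.mono' (integrable_const (1 : ℝ)) hcm (ae_of_all _ fun ω => Real.abs_cos_le_one _)
    have hei : Integrable (fun ω => Complex.exp (Complex.I * ((t n * Y ω : ℝ) : ℂ))) P := by
      refine Integrable.mono' (integrable_const (1 : ℝ)) ?_ (ae_of_all _ fun ω => ?_)
      · exact (by fun_prop : Continuous fun x : ℝ => Complex.exp (Complex.I *
          ((t n * x : ℝ) : ℂ))).comp_aestronglyMeasurable hY.aestronglyMeasurable
      · rw [mul_comm, Complex.norm_exp_ofReal_mul_I]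
    have hcos : ∫ ω, Real.cos (t n * Y ω) ∂P = (Complex.exp w).re := by
      rw [← hchar]
      refine Eq.trans ?_ (integral_re hei)
      refine integral_congr_ae (ae_of_all _ fun ω => ?_)
      simp only [mul_comm Complex.I, RCLike.re_eq_complex_re, Complex.exp_ofReal_mul_I_re]
    have hint : Integrable (fun ω => 2 * (t n ^ 2)⁻¹ * (1 - Real.cos (t n * Y ω))) P :=
      ((integrable_const _).sub hci).const_mul _
    rw [← ofReal_integral_eq_lintegral_ofReal hint (ae_of_all _ fun ω =>
      mul_nonneg (by have := htpos n; positivity) (by linarith [Real.cos_le_one (t n * Y ω)]))]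
    refine ENNReal.ofReal_le_ofReal ?_
    rw [integral_const_mul, integral_sub (integrable_const _) hci, hcos]
    simp only [integral_const, probReal_univ, one_smul]
    have h3 : 1 - (Complex.exp w).re ≤ t n ^ 2 * ∫ z, f z ^ 2 ∂η := by
      refine le_trans ?_ ((norm_one_sub_exp_le hwre).trans hwn)
      refine le_trans ?_ (Complex.abs_re_le_norm _)
      rw [Complex.sub_re, Complex.one_re]
      exact le_abs_self _
    refine (mul_le_mul_of_nonneg_left h3 (by have := htpos n; positivity)).trans (le_of_eq ?_)
    have := (htpos n).ne'
    field_simp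
  calc ∫⁻ ω, ENNReal.ofReal (Y ω ^ 2) ∂P
      = ∫⁻ ω, liminf (fun n => F n ω) atTop ∂P :=
        lintegral_congr fun ω => ((hlim ω).liminf_eq).symm
    _ ≤ liminf (fun n => ∫⁻ ω, F n ω ∂P) atTop :=
        lintegral_liminf_le' fun n => by fun_prop
    _ ≤ ENNReal.ofReal (2 * ∫ z, f z ^ 2 ∂η) := by
        refine liminf_le_of_frequently_le' (Frequently.of_forall hbound)

theorem memLp_compensated (hN : IsPoissonRandomMeasure N η P) {f : S → ℝ}
    (hf : Measurable f) (hfi : Integrable f η) (hf2 : MemLp f 2 η) :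
    MemLp (compensated N η f) 2 P := by
  have h := hN.lintegral_compensated_sq_le hf hfi hf2
  have hm := (hN.integrable_compensated hf hfi).aestronglyMeasurable
  rw [memLp_two_iff_integrable_sq hm]
  refine ⟨hm.pow 2, ?_⟩
  rw [hasFiniteIntegral_iff_ofReal (ae_of_all _ fun ω => sq_nonneg _)]
  exact h.trans_lt ENNReal.ofReal_lt_top

theorem eLpNorm_compensated_le (hN : IsPoissonRandomMeasure N η P) {f : S → ℝ}
    (hf : Measurable f) (hfi : Integrable f η) (hf2 : MemLp f 2 η) :
    eLpNorm (compensated N η f) 2 P ≤ 2 * eLpNorm f 2 η := by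
  have h := hN.lintegral_compensated_sq_le hf hfi hf2
  rw [eLpNorm_eq_lintegral_rpow_enorm_toReal (by norm_num) (by norm_num),
    eLpNorm_eq_lintegral_rpow_enorm_toReal (by norm_num) (by norm_num)]
  have h1 : ∀ x : ℝ, ‖x‖ₑ ^ (ENNReal.toReal 2) = ENNReal.ofReal (x ^ 2) := fun x => by
    rw [← ofReal_norm, ENNReal.ofReal_rpow_of_nonneg (norm_nonneg _) (by norm_num)]
    simp
  simp_rw [h1]
  rw [← ofReal_integral_eq_lintegral_ofReal hf2.integrable_sq (ae_of_all _ fun z => sq_nonneg _)]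
  rw [ENNReal.ofReal_mul (by norm_num)] at h
  refine (ENNReal.rpow_le_rpow h (by norm_num)).trans ?_
  rw [ENNReal.mul_rpow_of_nonneg _ _ (by norm_num)]
  gcongr
  simp only [ENNReal.ofReal_ofNat, ENNReal.toReal_ofNat]
  -- The constant is really `2^{1/2}`, here rounded up to 2.
  conv_rhs => rw [← ENNReal.rpow_one 2]
  exact ENNReal.rpow_le_rpow_of_exponent_le (by norm_num) (by norm_num)

end IsPoissonRandomMeasure

/-! ### Centred integrals of square integrable functions -/

/-- The truncation `f 1{|f| > ε}`. -/
def truncAbove {S : Type*} (ε : ℝ) (f : S → ℝ) (z : S) : ℝ := if ε < |f z| then f z else 0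

theorem measurable_truncAbove {S : Type*} [MeasurableSpace S] (ε : ℝ) {f : S → ℝ}
    (hf : Measurable f) : Measurable (truncAbove ε f) :=
  Measurable.ite (measurableSet_lt measurable_const hf.abs) hf measurable_const

theorem abs_truncAbove_le {S : Type*} (ε : ℝ) (f : S → ℝ) (z : S) : |truncAbove ε f z| ≤ |f z| := by
  unfold truncAbove; split_ifs <;> simp

theorem memLp_truncAbove {S : Type*} [MeasurableSpace S] {η : Measure S} (ε : ℝ) {f : S → ℝ}
    (hf : Measurable f) (hf2 : MemLp f 2 η) : MemLp (truncAbove ε f) 2 η :=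
  hf2.mono (measurable_truncAbove ε hf).aestronglyMeasurable
    (ae_of_all _ fun z => abs_truncAbove_le ε f z)

theorem integrable_truncAbove {S : Type*} [MeasurableSpace S] {η : Measure S} {ε : ℝ}
    (hε : 0 < ε) {f : S → ℝ} (hf : Measurable f) (hf2 : MemLp f 2 η) :
    Integrable (truncAbove ε f) η := by
  refine Integrable.mono' (hf2.integrable_sq.const_mul ε⁻¹)
    (measurable_truncAbove ε hf).aestronglyMeasurable (ae_of_all _ fun z => ?_)
  unfold truncAbove
  split_ifs with h
  · rw [Real.norm_eq_abs, ← sq_abs, ← div_eq_inv_mul, le_div_iff₀ hε, sq]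
    exact mul_le_mul_of_nonneg_left h.le (abs_nonneg _)
  · simp only [norm_zero]; positivity

/-- Dominated convergence with bound `|f|²`: at each point the truncation is eventually exact,
trivially so where `f` vanishes. -/
theorem tendsto_eLpNorm_truncAbove_sub {S : Type*} [MeasurableSpace S] {η : Measure S} {f : S → ℝ}
    (hf : Measurable f) (hf2 : MemLp f 2 η) :
    Tendsto (fun ε => eLpNorm (fun z => truncAbove ε f z - f z) 2 η) (𝓝[>] 0) (𝓝 0) := by
  have h1 : ∀ ε, eLpNorm (fun z => truncAbove ε f z - f z) 2 η =
      (∫⁻ z, ‖truncAbove ε f z - f z‖ₑ ^ (2 : ℝ) ∂η) ^ (1 / (2 : ℝ)) := fun ε => by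
    rw [eLpNorm_eq_lintegral_rpow_enorm_toReal (by norm_num) (by norm_num)]
    simp
  simp_rw [h1]
  have h2 : Tendsto (fun ε => ∫⁻ z, ‖truncAbove ε f z - f z‖ₑ ^ (2 : ℝ) ∂η) (𝓝[>] 0)
      (𝓝 (∫⁻ z, 0 ∂η)) := by
    refine tendsto_lintegral_filter_of_dominated_convergence (fun z => ‖f z‖ₑ ^ (2 : ℝ)) ?_ ?_ ?_ ?_
    · exact Eventually.of_forall fun ε =>
        ((measurable_truncAbove ε hf).sub hf).enorm.pow_const _
    · refine Eventually.of_forall fun ε => ae_of_all _ fun z => ?_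
      refine ENNReal.rpow_le_rpow ?_ (by norm_num)
      rw [enorm_le_iff_norm_le]
      unfold truncAbove
      split_ifs <;> simp
    · have h := hf2.eLpNorm_ne_top
      rw [eLpNorm_eq_lintegral_rpow_enorm_toReal (by norm_num) (by norm_num)] at h
      intro htop
      apply h
      simp only [ENNReal.toReal_ofNat]
      rw [htop]; simp
    · refine ae_of_all _ fun z => ?_
      refine tendsto_const_nhds.congr' ?_
      rcases eq_or_ne (f z) 0 with h0 | h0
      · filter_upwards with ε
        simp [truncAbove, h0]
      · have : ∀ᶠ ε in 𝓝[>] (0 : ℝ), ε < |f z| :=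
          nhdsWithin_le_nhds (eventually_lt_nhds (abs_pos.2 h0))
        filter_upwards [this] with ε hε
        simp [truncAbove, hε]
  rw [lintegral_zero] at h2
  have h3 := (ENNReal.continuous_rpow_const (y := 1 / (2 : ℝ))).tendsto 0 |>.comp h2
  simp only [ENNReal.zero_rpow_of_pos (by norm_num : (0 : ℝ) < 1 / 2)] at h3
  exact h3

/-- `Y` is the limit of compensated integrals of functions approximating `f` in `L²(η)`. -/
def IsL2Centred {Ω S : Type*} [MeasurableSpace Ω] [MeasurableSpace S] (P : Measure Ω)
    (N : Ω → Measure S) (η : Measure S) (f : S → ℝ) (Y : Ω → ℝ) : Prop :=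
  ∃ h : ℕ → S → ℝ, (∀ m, Measurable (h m) ∧ Integrable (h m) η ∧ MemLp (h m) 2 η) ∧
    Tendsto (fun m => eLpNorm (fun z => h m z - f z) 2 η) atTop (𝓝 0) ∧
    Tendsto (fun m => ∫⁻ ω, ‖compensated N η (h m) ω - Y ω‖ₑ ∂P) atTop (𝓝 0)

namespace IsPoissonRandomMeasure

variable {Ω S : Type*} [MeasurableSpace Ω] [MeasurableSpace S] {N : Ω → Measure S}
  {η : Measure S} {P : Measure Ω} [SigmaFinite η]

/-- Needed because the grain functional has its measurable form only for positive volumes, that is,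
almost everywhere. -/
theorem isCentredIntegral_congr (hN : IsPoissonRandomMeasure N η P) {f g : S → ℝ}
    (hfg : f =ᵐ[η] g) {Y : Ω → ℝ} (hY : IsCentredIntegral P N η f Y) :
    IsCentredIntegral P N η g Y := by
  refine TendstoInMeasure.congr_left (fun ε => ?_) hY
  have h0 : ∫ z, (if ε < |f z| then f z else 0) ∂η = ∫ z, (if ε < |g z| then g z else 0) ∂η :=
    integral_congr_ae (hfg.mono fun z hz => by simp only [hz])
  filter_upwards [hN.ae_ae hfg] with ω hω
  have h1 : ∫ z, (if ε < |f z| then f z else 0) ∂(N ω) =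
      ∫ z, (if ε < |g z| then g z else 0) ∂(N ω) :=
    integral_congr_ae (hω.mono fun z hz => by simp only [hz])
  rw [h0, h1]

variable [IsProbabilityMeasure P]

theorem eLpNorm_compensated_sub_le (hN : IsPoissonRandomMeasure N η P) {f g : S → ℝ}
    (hf : Measurable f) (hfi : Integrable f η) (hf2 : MemLp f 2 η)
    (hg : Measurable g) (hgi : Integrable g η) (hg2 : MemLp g 2 η) :
    eLpNorm (fun ω => compensated N η f ω - compensated N η g ω) 2 P ≤
      2 * eLpNorm (fun z => f z - g z) 2 η := by
  rw [← eLpNorm_congr_ae (hN.compensated_sub hf hfi hg hgi)]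
  exact hN.eLpNorm_compensated_le (hf.sub hg) (hfi.sub hgi) (hf2.sub hg2)

/-- Compensated integrals extend by continuity to square integrable functions. -/
theorem exists_memLp_centred (hN : IsPoissonRandomMeasure N η P) {f : S → ℝ}
    (hf : Measurable f) (hf2 : MemLp f 2 η) :
    ∃ Y : Ω → ℝ, MemLp Y 2 P ∧ ∀ g : S → ℝ, Measurable g → Integrable g η → MemLp g 2 η →
      eLpNorm (fun ω => compensated N η g ω - Y ω) 2 P ≤ 2 * eLpNorm (fun z => g z - f z) 2 η := by
  set u : ℕ → ℝ := fun n => 1 / ((n : ℝ) + 1) with hu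
  have hupos : ∀ n, 0 < u n := fun n => by positivity
  have hulim : Tendsto u atTop (𝓝[>] 0) :=
    tendsto_nhdsWithin_iff.2 ⟨tendsto_one_div_add_atTop_nhds_zero_nat,
      Eventually.of_forall hupos⟩
  set h : ℕ → S → ℝ := fun n => truncAbove (u n) f with hh
  have hm : ∀ n, Measurable (h n) := fun n => measurable_truncAbove _ hf
  have hi : ∀ n, Integrable (h n) η := fun n => integrable_truncAbove (hupos n) hf hf2
  have h2 : ∀ n, MemLp (h n) 2 η := fun n => memLp_truncAbove _ hf hf2
  have hlim : Tendsto (fun n => eLpNorm (fun z => h n z - f z) 2 η) atTop (𝓝 0) :=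
    (tendsto_eLpNorm_truncAbove_sub hf hf2).comp hulim
  set Z : ℕ → Lp ℝ 2 P := fun n => (hN.memLp_compensated (hm n) (hi n) (h2 n)).toLp with hZ
  -- The compensated integral is Lipschitz from `L²(η)` to `L²(P)` on integrable functions, so it
  -- carries the convergent truncations to a Cauchy sequence.
  have hcauchy : CauchySeq Z := by
    have hcf : CauchySeq fun n => (h2 n).toLp := by
      have : Tendsto (fun n => (h2 n).toLp) atTop (𝓝 hf2.toLp) :=
        (Lp.tendsto_Lp_iff_tendsto_eLpNorm'' _ h2 f hf2).2 hlim
      exact this.cauchySeq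
    rw [EMetric.cauchySeq_iff] at hcf ⊢
    intro ε hε
    obtain ⟨M, hM⟩ := hcf (ε / 2) (ENNReal.half_pos hε.ne')
    refine ⟨M, fun m hm' n hn' => ?_⟩
    have h3 := hM m hm' n hn'
    rw [Lp.edist_toLp_toLp] at h3 ⊢
    calc _ ≤ 2 * eLpNorm (h m - h n) 2 η :=
          hN.eLpNorm_compensated_sub_le (hm m) (hi m) (h2 m) (hm n) (hi n) (h2 n)
      _ < 2 * (ε / 2) := by
          exact (ENNReal.mul_lt_mul_iff_right (by norm_num) (by norm_num)).2 h3
      _ = ε := ENNReal.mul_div_cancel (by norm_num) (by norm_num)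
  obtain ⟨Y, hY⟩ := cauchySeq_tendsto_of_complete hcauchy
  refine ⟨Y, Lp.memLp Y, fun g hg hgi hg2 => ?_⟩
  have hYlim : Tendsto (fun n => eLpNorm (fun ω => compensated N η (h n) ω - Y ω) 2 P)
      atTop (𝓝 0) :=
    (Lp.tendsto_Lp_iff_tendsto_eLpNorm'' _ (fun n => hN.memLp_compensated (hm n) (hi n) (h2 n)) Y
      (Lp.memLp Y)).1 (by rwa [Lp.toLp_coeFn])
  -- Compare `g` with the `n`-th truncation, then let `n → ∞`: the terms involving `h n` disappear.
  have hb : ∀ n, eLpNorm (fun ω => compensated N η g ω - Y ω) 2 P ≤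
      2 * (eLpNorm (fun z => g z - f z) 2 η + eLpNorm (fun z => h n z - f z) 2 η) +
        eLpNorm (fun ω => compensated N η (h n) ω - Y ω) 2 P := fun n => by
    have e1 : (fun ω => compensated N η g ω - Y ω) =
        (fun ω => compensated N η g ω - compensated N η (h n) ω) +
          fun ω => compensated N η (h n) ω - Y ω := by ext; simp
    have e2 : (fun z => g z - h n z) = (fun z => g z - f z) - fun z => h n z - f z := by ext; simp
    have mg := (hN.memLp_compensated hg hgi hg2).aestronglyMeasurable
    have mh := (hN.memLp_compensated (hm n) (hi n) (h2 n)).aestronglyMeasurable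
    rw [e1]
    refine (eLpNorm_add_le (mg.sub mh) (mh.sub (Lp.aestronglyMeasurable Y)) (by norm_num)).trans ?_
    refine add_le_add ?_ le_rfl
    refine (hN.eLpNorm_compensated_sub_le hg hgi hg2 (hm n) (hi n) (h2 n)).trans ?_
    gcongr
    rw [e2]
    exact eLpNorm_sub_le (hg2.sub hf2).aestronglyMeasurable
      ((h2 n).sub hf2).aestronglyMeasurable (by norm_num)
  have hl := (ENNReal.Tendsto.const_mul (a := 2)
    (tendsto_const_nhds (x := eLpNorm (fun z => g z - f z) 2 η) |>.add hlim)
    (Or.inr (by norm_num))).add hYlim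
  simp only [add_zero] at hl
  exact ge_of_tendsto' hl hb

/-- One variable `Y` serves both descriptions of the centred integral: as limit in probability along
truncations, which defines it, and as limit along an L² approximation, which is convenient to
compute with. -/
theorem exists_isCentredIntegral (hN : IsPoissonRandomMeasure N η P) {f : S → ℝ}
    (hf : Measurable f) (hf2 : MemLp f 2 η) :
    ∃ Y : Ω → ℝ, MemLp Y 2 P ∧ IsCentredIntegral P N η f Y ∧ IsL2Centred P N η f Y := by
  obtain ⟨Y, hY, hb⟩ := hN.exists_memLp_centred hf hf2
  have hlim : Tendsto (fun ε => eLpNorm (fun ω => compensated N η (truncAbove ε f) ω - Y ω) 2 P)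
      (𝓝[>] 0) (𝓝 0) := by
    have h0 := ENNReal.Tendsto.const_mul (a := 2) (tendsto_eLpNorm_truncAbove_sub hf hf2)
      (Or.inr (by norm_num))
    rw [mul_zero] at h0
    refine tendsto_of_tendsto_of_tendsto_of_le_of_le' tendsto_const_nhds h0
      (Eventually.of_forall fun _ => zero_le) ?_
    filter_upwards [self_mem_nhdsWithin] with ε hε
    exact hb _ (measurable_truncAbove _ hf) (integrable_truncAbove hε hf hf2)
      (memLp_truncAbove _ hf hf2)
  refine ⟨Y, hY, ?_, ?_⟩
  -- The passage from norm convergence asks for measurability at every `ε`. For `ε ≤ 0` the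
  -- truncation is `f` itself, perhaps not integrable, so `Y` is put there; this is invisible to
  -- `𝓝[>] 0`.
  · have h1 : TendstoInMeasure P (fun ε => if 0 < ε then compensated N η (truncAbove ε f) else Y)
        (𝓝[>] 0) Y := by
      refine tendstoInMeasure_of_tendsto_eLpNorm (p := 2) (by norm_num) (fun ε => ?_)
        hY.aestronglyMeasurable (hlim.congr' ?_)
      · split_ifs with hε
        · exact (hN.integrable_compensated (measurable_truncAbove _ hf)
            (integrable_truncAbove hε hf hf2)).aestronglyMeasurable
        · exact hY.aestronglyMeasurable
      · filter_upwards [self_mem_nhdsWithin] with ε hε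
        rw [if_pos (mem_Ioi.1 hε)]
        rfl
    refine h1.congr' ?_ (ae_eq_refl _)
    filter_upwards [self_mem_nhdsWithin] with ε hε
    rw [if_pos (mem_Ioi.1 hε)]
    rfl
  · have hulim : Tendsto (fun n : ℕ => 1 / ((n : ℝ) + 1)) atTop (𝓝[>] 0) :=
      tendsto_nhdsWithin_iff.2 ⟨tendsto_one_div_add_atTop_nhds_zero_nat,
        Eventually.of_forall fun n => by simp only [mem_Ioi]; positivity⟩
    have hi := fun n : ℕ => integrable_truncAbove (by positivity : 0 < 1 / ((n : ℝ) + 1)) hf hf2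
    refine ⟨fun n => truncAbove (1 / ((n : ℝ) + 1)) f, fun n => ⟨measurable_truncAbove _ hf,
      hi n, memLp_truncAbove _ hf hf2⟩,
      (tendsto_eLpNorm_truncAbove_sub hf hf2).comp hulim, ?_⟩
    refine tendsto_of_tendsto_of_tendsto_of_le_of_le tendsto_const_nhds (hlim.comp hulim)
      (fun _ => zero_le) fun n => ?_
    rw [← eLpNorm_one_eq_lintegral_enorm]
    refine eLpNorm_le_eLpNorm_of_exponent_le (by norm_num) ?_
    exact ((hN.integrable_compensated (measurable_truncAbove _ hf)
      (hi n)).aestronglyMeasurable).sub hY.aestronglyMeasurable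

/-- The centred integral of a square integrable function exists. -/
theorem centredIntegral_spec (hN : IsPoissonRandomMeasure N η P) {f g : S → ℝ}
    (hfg : f =ᵐ[η] g) (hg : Measurable g) (hg2 : MemLp g 2 η) :
    IsCentredIntegral P N η f (centredIntegral P N η f) ∧
      AEStronglyMeasurable (centredIntegral P N η f) P ∧
      IsL2Centred P N η g (centredIntegral P N η f) := by
  obtain ⟨Y, hY2, hY, hYL⟩ := hN.exists_isCentredIntegral hg hg2
  have hYf := hN.isCentredIntegral_congr hfg.symm hY
  have hex : ∃ Y : Ω → ℝ, IsCentredIntegral P N η f Y := ⟨Y, hYf⟩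
  have hspec : IsCentredIntegral P N η f (centredIntegral P N η f) := by
    unfold centredIntegral
    rw [dif_pos hex]
    exact hex.choose_spec
  -- Limits in probability are almost surely unique, so the chosen version inherits measurability
  -- and the L² approximation from `Y`.
  have hae : centredIntegral P N η f =ᵐ[P] Y := tendstoInMeasure_ae_unique hspec hYf
  refine ⟨hspec, hY2.aestronglyMeasurable.congr hae.symm, ?_⟩
  obtain ⟨h, h1, h2, h3⟩ := hYL
  refine ⟨h, h1, h2, h3.congr fun n => ?_⟩
  exact lintegral_congr_ae (hae.mono fun ω hω => by simp only [hω])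

end IsPoissonRandomMeasure

theorem integrable_expRem_of_memLp {S : Type*} [MeasurableSpace S] {η : Measure S} {f : S → ℝ}
    (hf2 : MemLp f 2 η) : Integrable (fun z => expRem (f z)) η := by
  refine Integrable.mono' hf2.integrable_sq
    (continuous_expRem.comp_aestronglyMeasurable hf2.aestronglyMeasurable) ?_
  exact ae_of_all _ fun z => norm_expRem_le_sq _

/-- The difference of the remainders is at most `|h - f| (|h - f| + 2|f|)`; apply Cauchy–Schwarz. -/
theorem tendsto_integral_expRem {S : Type*} [MeasurableSpace S] {η : Measure S} {f : S → ℝ}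
    {h : ℕ → S → ℝ} (hf2 : MemLp f 2 η) (hh2 : ∀ m, MemLp (h m) 2 η)
    (hlim : Tendsto (fun m => eLpNorm (fun z => h m z - f z) 2 η) atTop (𝓝 0)) :
    Tendsto (fun m => ∫ z, expRem (h m z) ∂η) atTop (𝓝 (∫ z, expRem (f z) ∂η)) := by
  refine tendsto_integral_of_L1 _ (integrable_expRem_of_memLp hf2).aestronglyMeasurable
    (Eventually.of_forall fun m => integrable_expRem_of_memLp (hh2 m)) ?_
  have hb : ∀ m, ∫⁻ z, ‖expRem (h m z) - expRem (f z)‖ₑ ∂η ≤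
      eLpNorm (fun z => h m z - f z) 2 η *
        (eLpNorm (fun z => h m z - f z) 2 η + 2 * eLpNorm f 2 η) := fun m => by
    have hd : MemLp (fun z => h m z - f z) 2 η := (hh2 m).sub hf2
    have hs : MemLp (fun z => |h m z - f z| + 2 * |f z|) 2 η := hd.abs.add (hf2.abs.const_mul 2)
    calc ∫⁻ z, ‖expRem (h m z) - expRem (f z)‖ₑ ∂η
        ≤ ∫⁻ z, ‖(h m z - f z) * (|h m z - f z| + 2 * |f z|)‖ₑ ∂η := by
          refine lintegral_mono fun z => ?_
          rw [enorm_le_iff_norm_le, norm_mul, Real.norm_eq_abs (h m z - f z),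
            Real.norm_of_nonneg (by positivity)]
          refine (norm_expRem_sub_le_mul_add _ _).trans ?_
          refine mul_le_mul_of_nonneg_left ?_ (abs_nonneg _)
          have : |h m z| ≤ |h m z - f z| + |f z| := by
            simpa using abs_add_le (h m z - f z) (f z)
          linarith
      _ ≤ eLpNorm (fun z => h m z - f z) 2 η *
          eLpNorm (fun z => |h m z - f z| + 2 * |f z|) 2 η := by
          rw [eLpNorm_eq_lintegral_rpow_enorm_toReal (by norm_num) (by norm_num),
            eLpNorm_eq_lintegral_rpow_enorm_toReal (by norm_num) (by norm_num)]
          simp_rw [enorm_mul]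
          exact ENNReal.lintegral_mul_le_Lp_mul_Lq η (by simpa using Real.HolderConjugate.two_two)
            hd.aestronglyMeasurable.enorm hs.aestronglyMeasurable.enorm
      _ ≤ _ := by
          refine mul_le_mul_right ?_ _
          have e1 : eLpNorm (fun z => |h m z - f z|) 2 η = eLpNorm (fun z => h m z - f z) 2 η :=
            eLpNorm_norm (fun z => h m z - f z)
          have e2 : eLpNorm (fun z => 2 * |f z|) 2 η = 2 * eLpNorm f 2 η := by
            have e3 : (fun z => 2 * |f z|) = (2 : ℝ) • fun z => ‖f z‖ := by ext; simp
            rw [e3, eLpNorm_const_smul, eLpNorm_norm]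
            congr 1
            simp [enorm]
          rw [← e1, ← e2]
          exact eLpNorm_add_le (f := fun z => |h m z - f z|) (g := fun z => 2 * |f z|)
            hd.abs.aestronglyMeasurable (hf2.abs.const_mul 2).aestronglyMeasurable (by norm_num)
  have h0 := ENNReal.Tendsto.mul hlim (Or.inr (by
    rw [zero_add]; exact ENNReal.mul_ne_top (by norm_num) hf2.eLpNorm_ne_top))
    (hlim.add (tendsto_const_nhds (x := 2 * eLpNorm f 2 η))) (Or.inr (by norm_num))
  rw [zero_mul] at h0
  exact tendsto_of_tendsto_of_tendsto_of_le_of_le tendsto_const_nhds h0 (fun _ => zero_le) hb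

namespace IsPoissonRandomMeasure

variable {Ω S : Type*} [MeasurableSpace Ω] [MeasurableSpace S] {N : Ω → Measure S}
  {η : Measure S} {P : Measure Ω}

theorem isL2Centred_zero : IsL2Centred P N η (fun _ => 0) (fun _ => 0) :=
  ⟨fun _ _ => 0, fun _ => ⟨measurable_const, integrable_zero _ _ _, MemLp.zero'⟩, by simp,
    by simp [compensated]⟩

theorem isL2Centred_const_mul (c : ℝ) {f : S → ℝ} {Y : Ω → ℝ} (hY : IsL2Centred P N η f Y) :
    IsL2Centred P N η (fun z => c * f z) (fun ω => c * Y ω) := by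
  obtain ⟨h, h1, h2, h3⟩ := hY
  refine ⟨fun m z => c * h m z, fun m => ⟨(h1 m).1.const_mul c, (h1 m).2.1.const_mul c,
    (h1 m).2.2.const_mul c⟩, ?_, ?_⟩
  · have e : ∀ m, eLpNorm (fun z => c * h m z - c * f z) 2 η =
        ‖c‖ₑ * eLpNorm (fun z => h m z - f z) 2 η := fun m => by
      rw [← eLpNorm_const_smul]
      congr 1; ext z; simp [mul_sub]
    simp_rw [e]
    simpa using ENNReal.Tendsto.const_mul h2 (Or.inr enorm_ne_top)
  · have e : ∀ m, ∫⁻ ω, ‖compensated N η (fun z => c * h m z) ω - c * Y ω‖ₑ ∂P =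
        ‖c‖ₑ * ∫⁻ ω, ‖compensated N η (h m) ω - Y ω‖ₑ ∂P := fun m => by
      rw [← lintegral_const_mul' _ _ enorm_ne_top]
      refine lintegral_congr fun ω => ?_
      rw [compensated_const_mul, ← mul_sub, enorm_mul]
    simp_rw [e]
    simpa using ENNReal.Tendsto.const_mul h3 (Or.inr enorm_ne_top)

variable [SigmaFinite η] [IsProbabilityMeasure P]

/-- Truncation at level `ε` is not linear in the integrand, but approximation in L² is. Linearity of
the centred integral is therefore obtained through `IsL2Centred`. -/
theorem isL2Centred_add (hN : IsPoissonRandomMeasure N η P) {f g : S → ℝ} {Y Z : Ω → ℝ}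
    (hf : AEStronglyMeasurable f η) (hg : AEStronglyMeasurable g η)
    (hYm : AEStronglyMeasurable Y P)
    (hY : IsL2Centred P N η f Y) (hZ : IsL2Centred P N η g Z) :
    IsL2Centred P N η (fun z => f z + g z) (fun ω => Y ω + Z ω) := by
  obtain ⟨h, h1, h2, h3⟩ := hY
  obtain ⟨k, k1, k2, k3⟩ := hZ
  refine ⟨fun m z => h m z + k m z, fun m => ⟨(h1 m).1.add (k1 m).1, (h1 m).2.1.add (k1 m).2.1,
    (h1 m).2.2.add (k1 m).2.2⟩, ?_, ?_⟩
  · have h0 := h2.add k2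
    rw [add_zero] at h0
    refine tendsto_of_tendsto_of_tendsto_of_le_of_le tendsto_const_nhds h0 (fun _ => zero_le)
      fun m => ?_
    have e : (fun z => h m z + k m z - (f z + g z)) =
      (fun z => h m z - f z) + fun z => k m z - g z := by ext z; simp only [Pi.add_apply]; ring
    simp only [e]
    exact eLpNorm_add_le ((h1 m).1.aestronglyMeasurable.sub hf)
      ((k1 m).1.aestronglyMeasurable.sub hg) (by norm_num)
  · have h0 := h3.add k3
    rw [add_zero] at h0
    refine tendsto_of_tendsto_of_tendsto_of_le_of_le tendsto_const_nhds h0 (fun _ => zero_le)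
      fun m => ?_
    have hm : AEMeasurable (fun ω => ‖compensated N η (h m) ω - Y ω‖ₑ) P :=
      ((hN.integrable_compensated (h1 m).1 (h1 m).2.1).aestronglyMeasurable.sub hYm).enorm
    rw [← lintegral_add_left' hm]
    refine lintegral_mono_ae ?_
    filter_upwards [hN.compensated_add (h1 m).1 (h1 m).2.1 (k1 m).1 (k1 m).2.1] with ω hω
    rw [hω]
    refine le_trans (le_of_eq ?_) (enorm_add_le _ _)
    congr 1; ring

theorem isL2Centred_sum (hN : IsPoissonRandomMeasure N η P) {ι : Type*} (s : Finset ι)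
    {f : ι → S → ℝ} {Y : ι → Ω → ℝ} (hf : ∀ k, AEStronglyMeasurable (f k) η)
    (hYm : ∀ k, AEStronglyMeasurable (Y k) P) (hY : ∀ k, IsL2Centred P N η (f k) (Y k)) :
    IsL2Centred P N η (fun z => ∑ k ∈ s, f k z) (fun ω => ∑ k ∈ s, Y k ω) := by
  classical
  induction s using Finset.induction_on with
  | empty => simpa using isL2Centred_zero
  | insert a s ha ih =>
    simp_rw [Finset.sum_insert ha]
    exact hN.isL2Centred_add (hf a) (Finset.aestronglyMeasurable_fun_sum s fun k _ => hf k)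
      (hYm a) (hY a) ih

/-- The formula holds for the approximating functions; L¹ convergence controls the left side and L²
convergence the exponent on the right. -/
theorem integral_exp_of_isL2Centred (hN : IsPoissonRandomMeasure N η P) {f : S → ℝ} {Y : Ω → ℝ}
    (hf2 : MemLp f 2 η) (hYm : AEStronglyMeasurable Y P) (hY : IsL2Centred P N η f Y) :
    ∫ ω, Complex.exp (Complex.I * (Y ω : ℂ)) ∂P = Complex.exp (∫ z, expRem (f z) ∂η) := by
  obtain ⟨h, h1, h2, h3⟩ := hY
  have hl := tendsto_integral_cexp
    (fun m => (hN.integrable_compensated (h1 m).1 (h1 m).2.1).aestronglyMeasurable) hYm h3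
  have hr := (Complex.continuous_exp.tendsto _).comp
    (tendsto_integral_expRem hf2 (fun m => (h1 m).2.2) h2)
  refine tendsto_nhds_unique hl (hr.congr fun m => ?_)
  exact (hN.integral_exp_compensated (h1 m).1 (h1 m).2.1).symm

end IsPoissonRandomMeasure

/-! ### Convergence in distribution from characteristic functions -/

theorem charFun_map_toLp {Ω : Type*} [MeasurableSpace Ω] {P : Measure Ω} {n : ℕ}
    {X : Ω → Fin n → ℝ} (hX : AEMeasurable X P) (t : EuclideanSpace ℝ (Fin n)) :
    charFun (P.map (fun ω => WithLp.toLp 2 (X ω))) t =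
      ∫ ω, Complex.exp (Complex.I * ((∑ k, t k * X ω k : ℝ) : ℂ)) ∂P := by
  have hLm : Measurable (WithLp.toLp 2 : (Fin n → ℝ) → EuclideanSpace ℝ (Fin n)) := by fun_prop
  rw [charFun_apply, integral_map (φ := fun ω => WithLp.toLp 2 (X ω)) (hLm.comp_aemeasurable hX)
    (Continuous.aestronglyMeasurable (by fun_prop))]
  refine integral_congr_ae (ae_of_all _ fun ω => ?_)
  simp [PiLp.inner_apply, mul_comm]

/-- Lévy's continuity theorem. It is a statement about sequences in an inner product space, so the
countably generated filter is reduced to sequences and `Fin n → ℝ` is moved to Euclidean space and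
back. -/
theorem tendstoInDistribution_of_tendsto_integral_exp {ι Ω' : Type*} {Ω : ι → Type*}
    [∀ i, MeasurableSpace (Ω i)] [MeasurableSpace Ω'] {l : Filter ι} [l.IsCountablyGenerated]
    {n : ℕ} {X : (i : ι) → Ω i → Fin n → ℝ} {Z : Ω' → Fin n → ℝ} {P : (i : ι) → Measure (Ω i)}
    [∀ i, IsProbabilityMeasure (P i)] {P' : Measure Ω'} [IsProbabilityMeasure P']
    (hX : ∀ i k, AEMeasurable (fun ω => X i ω k) (P i))
    (hZ : ∀ k, AEMeasurable (fun ω => Z ω k) P')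
    (h : ∀ t : Fin n → ℝ,
      Tendsto (fun i => ∫ ω, Complex.exp (Complex.I * ((∑ k, t k * X i ω k : ℝ) : ℂ)) ∂(P i)) l
        (𝓝 (∫ ω, Complex.exp (Complex.I * ((∑ k, t k * Z ω k : ℝ) : ℂ)) ∂P'))) :
    TendstoInDistribution X l Z P P' := by
  have hX' : ∀ i, AEMeasurable (X i) (P i) := fun i => aemeasurable_pi_iff.2 (hX i)
  have hZ' : AEMeasurable Z P' := aemeasurable_pi_iff.2 hZ
  set L : (Fin n → ℝ) → EuclideanSpace ℝ (Fin n) := WithLp.toLp 2 with hL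
  have hLm : Measurable L := by fun_prop
  have hmain : TendstoInDistribution (fun i ω => L (X i ω)) l (fun ω => L (Z ω)) P P' := by
    refine ⟨fun i => hLm.comp_aemeasurable (hX' i), hLm.comp_aemeasurable hZ', ?_⟩
    refine tendsto_of_seq_tendsto fun u hu => ?_
    refine ProbabilityMeasure.tendsto_of_tendsto_charFun fun t => ?_
    have := (h t).comp hu
    rw [← charFun_map_toLp hZ'] at this
    refine this.congr fun m => ?_
    exact (charFun_map_toLp (hX' (u m)) t).symm
  have := hmain.continuous_comp (g := WithLp.ofLp) (by fun_prop)
  exact this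

/-! ### Regularly varying tails -/

section Tail

variable {F : Measure ℝ}

theorem tail_nonneg (v : ℝ) : 0 ≤ tail F v := measureReal_nonneg

/-- The generalised inverse of the tail, `inf {v ≥ 0 : 1 - F(v) ≤ u}`. -/
def tailInv (F : Measure ℝ) (u : ℝ) : ℝ := sInf {v : ℝ | 0 ≤ v ∧ tail F v ≤ u}

theorem tailInv_nonneg (u : ℝ) : 0 ≤ tailInv F u := Real.sInf_nonneg fun _ h => h.1

theorem bddBelow_tailInv (u : ℝ) : BddBelow {v : ℝ | 0 ≤ v ∧ tail F v ≤ u} :=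
  ⟨0, fun _ h => h.1⟩

variable [IsProbabilityMeasure F]

theorem tail_antitone : Antitone (tail F) := fun _ _ h =>
  measureReal_mono (Ioi_subset_Ioi h)

theorem tail_le_one (v : ℝ) : tail F v ≤ 1 := measureReal_le_one

theorem tail_eq_one_sub_cdf (v : ℝ) : tail F v = 1 - cdf F v := by
  rw [tail, cdf_eq_real, ← compl_Iic, probReal_compl_eq_one_sub measurableSet_Iic]

theorem tendsto_tail_atTop : Tendsto (tail F) atTop (𝓝 0) := by
  have h := (tendsto_cdf_atTop F).const_sub 1
  rw [sub_self] at h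
  exact h.congr fun v => (tail_eq_one_sub_cdf v).symm

theorem continuousWithinAt_tail (v : ℝ) : ContinuousWithinAt (tail F) (Ioi v) v := by
  have h : tail F = fun v => 1 - cdf F v := funext tail_eq_one_sub_cdf
  rw [h]
  exact continuousWithinAt_const.sub (((cdf F).right_continuous v).mono Ioi_subset_Ici_self)

/-- Right-continuity of the tail means that the infimum is attained; the tail and its inverse then
form a Galois connection, the only property of quantiles used in the limit theorems. -/
theorem tailInv_le_iff {u v : ℝ} (hu : 0 < u) (hv : 0 ≤ v) : tailInv F u ≤ v ↔ tail F v ≤ u := by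
  refine ⟨fun h => ?_, fun h => csInf_le (bddBelow_tailInv u) ⟨hv, h⟩⟩
  have hne : {v : ℝ | 0 ≤ v ∧ tail F v ≤ u}.Nonempty := by
    obtain ⟨w, hw1, hw2⟩ := ((tendsto_tail_atTop (F := F)).eventually_le_const hu |>.and
      (eventually_ge_atTop 0)).exists
    exact ⟨w, hw2, hw1⟩
  refine le_of_tendsto (continuousWithinAt_tail v) ?_
  filter_upwards [self_mem_nhdsWithin] with w hw
  obtain ⟨x, hx, hxw⟩ := exists_lt_of_csInf_lt hne (h.trans_lt hw)
  exact (tail_antitone hxw.le).trans hx.2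

theorem lt_tailInv_iff {u v : ℝ} (hu : 0 < u) (hv : 0 ≤ v) : v < tailInv F u ↔ u < tail F v := by
  rw [← not_le, tailInv_le_iff hu hv, not_le]

theorem tailInv_antitoneOn : AntitoneOn (tailInv F) (Ioi 0) := fun u hu w hw huw => by
  rw [tailInv_le_iff hw (tailInv_nonneg u)]
  exact ((tailInv_le_iff hu (tailInv_nonneg u)).1 le_rfl).trans huw

theorem aemeasurable_tailInv : AEMeasurable (tailInv F) (volume.restrict (Ioo 0 1)) :=
  aemeasurable_restrict_of_antitoneOn measurableSet_Ioo
    (tailInv_antitoneOn.mono Ioo_subset_Ioi_self)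

/-- The quantile transform. -/
theorem map_tailInv (hF : F (Iic 0) = 0) : (volume.restrict (Ioo 0 1)).map (tailInv F) = F := by
  have : IsProbabilityMeasure (volume.restrict (Ioo (0 : ℝ) 1)) := ⟨by simp⟩
  have := Measure.isProbabilityMeasure_map (aemeasurable_tailInv (F := F))
  have h1 : tail F 0 = 1 := by
    rw [tail, ← compl_Iic, probReal_compl_eq_one_sub measurableSet_Iic, measureReal_def, hF]
    simp
  have key : ∀ v, (volume.restrict (Ioo 0 1)).map (tailInv F) (Ioi v) = F (Ioi v) := fun v => by
    rw [Measure.map_apply_of_aemeasurable aemeasurable_tailInv measurableSet_Ioi]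
    rw [Measure.restrict_apply' measurableSet_Ioo]
    rcases le_or_gt 0 v with hv | hv
    · have e : tailInv F ⁻¹' Ioi v ∩ Ioo 0 1 = Ioo 0 (tail F v) := by
        ext u
        simp only [mem_inter_iff, mem_preimage, mem_Ioi, mem_Ioo]
        constructor
        · rintro ⟨h, h0, -⟩
          exact ⟨h0, (lt_tailInv_iff h0 hv).1 h⟩
        · rintro ⟨h0, h⟩
          exact ⟨(lt_tailInv_iff h0 hv).2 h, h0, h.trans_le (tail_le_one v)⟩
      rw [e, Real.volume_Ioo, sub_zero, tail, ofReal_measureReal]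
    · have e : tailInv F ⁻¹' Ioi v ∩ Ioo 0 1 = Ioo 0 1 := by
        rw [inter_eq_right]
        exact fun u _ => hv.trans_le (tailInv_nonneg u)
      rw [e, Real.volume_Ioo, ← compl_Iic,
        (prob_compl_eq_one_iff measurableSet_Iic).2 (measure_mono_null (Iic_subset_Iic.2 hv.le) hF)]
      simp
  refine Measure.ext_of_Iic _ _ fun v => ?_
  rw [← compl_Ioi, prob_compl_eq_one_sub measurableSet_Ioi, prob_compl_eq_one_sub measurableSet_Ioi,
    key]

variable {γ : ℝ}

/-- A tail vanishing at `v` vanishes beyond it, and with `0 / 0 = 0` the ratio for `a = 1` would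
tend to 0 rather than 1. -/
theorem HasRegularlyVaryingTail.tail_pos (hF : HasRegularlyVaryingTail F γ) (v : ℝ) :
    0 < tail F v := by
  refine (tail_nonneg v).lt_of_ne fun h => ?_
  have h1 := hF 1 one_pos
  rw [Real.one_rpow] at h1
  have h2 : Tendsto (fun w => tail F (1 * w) / tail F w) atTop (𝓝 0) := by
    refine tendsto_const_nhds.congr' ?_
    filter_upwards [eventually_ge_atTop v] with w hw
    have : tail F w = 0 := le_antisymm (h ▸ tail_antitone hw) (tail_nonneg w)
    rw [this, div_zero]
  exact one_ne_zero (tendsto_nhds_unique h1 h2)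

/-- Potter bounds. -/
theorem HasRegularlyVaryingTail.exists_potter (hF : HasRegularlyVaryingTail F γ) {γ₁ γ₂ : ℝ}
    (h₀ : 0 < γ₁) (h₁ : γ₁ < γ) (h₂ : γ < γ₂) :
    ∃ A : ℝ, 0 < A ∧ ∀ᶠ y in atTop,
      (∀ v, 1 ≤ v → tail F (v * y) ≤ A * tail F y * v ^ (-γ₁)) ∧
      (∀ v, 0 < v → v ≤ 1 → tail F (v * y) ≤ A * tail F y * v ^ (-γ₂)) := by
  -- Beyond some `x₀` each doubling of the argument multiplies the tail by a factor between
  -- `2^(-γ₂)` and `2^(-γ₁)`. Iterating along powers of 2 gives both bounds, up to rounding.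
  have hlim := hF 2 two_pos
  have e1 : ∀ᶠ x in atTop, tail F (2 * x) / tail F x < 2 ^ (-γ₁) :=
    hlim.eventually_lt_const (Real.rpow_lt_rpow_of_exponent_lt one_lt_two (by linarith))
  have e2 : ∀ᶠ x in atTop, 2 ^ (-γ₂) < tail F (2 * x) / tail F x :=
    hlim.eventually_const_lt (Real.rpow_lt_rpow_of_exponent_lt one_lt_two (by linarith))
  obtain ⟨x₀, hx₀⟩ := ((e1.and e2).and (eventually_ge_atTop 1)).exists_forall_of_atTop
  have hx₀1 : 1 ≤ x₀ := (hx₀ x₀ le_rfl).2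
  have up : ∀ x, x₀ ≤ x → tail F (2 * x) ≤ 2 ^ (-γ₁) * tail F x := fun x hx =>
    ((div_lt_iff₀ (hF.tail_pos x)).1 (hx₀ x hx).1.1).le
  have lo : ∀ x, x₀ ≤ x → tail F x ≤ 2 ^ γ₂ * tail F (2 * x) := fun x hx => by
    have h := ((lt_div_iff₀ (hF.tail_pos x)).1 (hx₀ x hx).1.2).le
    have h3 : (2 : ℝ) ^ γ₂ * 2 ^ (-γ₂) = 1 := by rw [← Real.rpow_add two_pos]; simp
    calc tail F x = 2 ^ γ₂ * (2 ^ (-γ₂) * tail F x) := by rw [← mul_assoc, h3, one_mul]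
      _ ≤ _ := by gcongr
  have up' : ∀ n : ℕ, ∀ x, x₀ ≤ x → tail F (2 ^ n * x) ≤ ((2 : ℝ) ^ n) ^ (-γ₁) * tail F x := by
    intro n
    induction n with
    | zero => intro x _; simp
    | succ n ih =>
      intro x hx
      have hx0 : (0 : ℝ) ≤ x := by linarith
      have h2 : x₀ ≤ 2 ^ n * x :=
        hx.trans (le_mul_of_one_le_left hx0 (one_le_pow₀ one_le_two))
      have := up _ h2
      rw [pow_succ', mul_assoc, Real.mul_rpow (by norm_num) (by positivity), mul_assoc]
      exact this.trans (mul_le_mul_of_nonneg_left (ih x hx) (by positivity))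
  have lo' : ∀ n : ℕ, ∀ x, x₀ ≤ x → tail F x ≤ ((2 : ℝ) ^ n) ^ γ₂ * tail F (2 ^ n * x) := by
    intro n
    induction n with
    | zero => intro x _; simp
    | succ n ih =>
      intro x hx
      have hx0 : (0 : ℝ) ≤ x := by linarith
      have h2 : x₀ ≤ 2 ^ n * x :=
        hx.trans (le_mul_of_one_le_left hx0 (one_le_pow₀ one_le_two))
      refine (ih x hx).trans ?_
      have := mul_le_mul_of_nonneg_left (lo _ h2) (by positivity : 0 ≤ ((2 : ℝ) ^ n) ^ γ₂)
      rw [pow_succ, Real.mul_rpow (by positivity) (by norm_num), mul_comm ((2 : ℝ) ^ n) 2,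
        mul_assoc 2, mul_assoc]
      exact this
  have dyadic : ∀ v : ℝ, 1 ≤ v → ∃ n : ℕ, (2 : ℝ) ^ n ≤ v ∧ v < 2 ^ (n + 1) := fun v hv =>
    exists_nat_pow_near hv one_lt_two
  have loA : ∀ y v, 0 < v → v ≤ 1 → x₀ ≤ v * y →
      tail F (v * y) ≤ 2 ^ γ₂ * v ^ (-γ₂) * tail F y := by
    intro y v hv hv1 hvy
    obtain ⟨n, hn1, hn2⟩ := dyadic v⁻¹ ((one_le_inv₀ hv).2 hv1)
    have hy : 0 < y := by
      by_contra hy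
      have := mul_nonpos_of_nonneg_of_nonpos hv.le (not_lt.1 hy)
      linarith
    have h4 : y ≤ 2 ^ (n + 1) * (v * y) := by
      rw [← mul_assoc]
      refine le_mul_of_one_le_left hy.le ?_
      rw [← inv_mul_cancel₀ hv.ne']
      exact mul_le_mul_of_nonneg_right hn2.le hv.le
    have h5 : ((2 : ℝ) ^ (n + 1)) ^ γ₂ ≤ 2 ^ γ₂ * v ^ (-γ₂) := by
      rw [pow_succ', Real.mul_rpow (by norm_num) (by positivity)]
      refine mul_le_mul_of_nonneg_left ?_ (by positivity)
      rw [Real.rpow_neg hv.le, ← Real.inv_rpow hv.le]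
      exact Real.rpow_le_rpow (by positivity) hn1 (by linarith)
    exact (lo' (n + 1) _ hvy).trans (mul_le_mul h5 (tail_antitone h4) (tail_nonneg _)
      (by positivity))
  have hx₀pos := hF.tail_pos x₀
  have hA1 : (2 : ℝ) ^ γ₂ ≤ 2 ^ γ₂ / tail F x₀ :=
    (le_div_iff₀ hx₀pos).2 (mul_le_of_le_one_right (by positivity) (tail_le_one _))
  -- The numerator pays for rounding `v` to a power of 2; the division by `tail F x₀` covers `v * y
  -- < x₀`, where the tail is bounded only by 1.
  refine ⟨2 ^ γ₂ / tail F x₀, by positivity, ?_⟩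
  filter_upwards [eventually_ge_atTop x₀] with y hy
  have hy0 : 0 < y := by linarith
  constructor
  · intro v hv
    have hv0 : 0 < v := by linarith
    obtain ⟨n, hn1, hn2⟩ := dyadic v hv
    calc tail F (v * y) ≤ tail F (2 ^ n * y) := tail_antitone (by gcongr)
      _ ≤ ((2 : ℝ) ^ n) ^ (-γ₁) * tail F y := up' n y hy
      _ ≤ (2 ^ γ₁ * v ^ (-γ₁)) * tail F y := by
          refine mul_le_mul_of_nonneg_right ?_ (tail_nonneg _)
          have h3 : (2 : ℝ) ^ γ₁ = (2⁻¹ : ℝ) ^ (-γ₁) := by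
            rw [Real.inv_rpow (by norm_num), Real.rpow_neg (by norm_num), inv_inv]
          rw [h3, ← Real.mul_rpow (by norm_num) hv0.le]
          refine Real.rpow_le_rpow_of_nonpos (by positivity) ?_ (by linarith)
          rw [pow_succ] at hn2
          linarith
      _ ≤ (2 ^ γ₂ / tail F x₀ * v ^ (-γ₁)) * tail F y := by
          refine mul_le_mul_of_nonneg_right (mul_le_mul_of_nonneg_right ?_ (by positivity))
            (tail_nonneg _)
          exact (Real.rpow_le_rpow_of_exponent_le one_le_two (by linarith)).trans hA1
      _ = _ := by ring
  · intro v hv hv1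
    rcases le_or_gt x₀ (v * y) with h | h
    · calc tail F (v * y) ≤ 2 ^ γ₂ * v ^ (-γ₂) * tail F y := loA y v hv hv1 h
        _ ≤ (2 ^ γ₂ / tail F x₀) * v ^ (-γ₂) * tail F y :=
          mul_le_mul_of_nonneg_right (mul_le_mul_of_nonneg_right hA1 (by positivity))
            (tail_nonneg _)
        _ = _ := by ring
    -- Below the threshold, apply the bound at `x₀ / y`, which exceeds `v`: it shows that the
    -- claimed right side is at least 1.
    · have hw : x₀ / y * y = x₀ := by field_simp
      have h6 := loA y (x₀ / y) (by positivity) ((div_le_one hy0).2 hy) hw.ge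
      rw [hw] at h6
      have h7 : (x₀ / y) ^ (-γ₂) ≤ v ^ (-γ₂) :=
        Real.rpow_le_rpow_of_nonpos hv ((le_div_iff₀ hy0).2 h.le) (by linarith)
      have h8 : tail F x₀ ≤ 2 ^ γ₂ * v ^ (-γ₂) * tail F y :=
        h6.trans (mul_le_mul_of_nonneg_right (mul_le_mul_of_nonneg_left h7 (by positivity))
          (tail_nonneg _))
      refine (tail_le_one _).trans ?_
      rw [show 2 ^ γ₂ / tail F x₀ * tail F y * v ^ (-γ₂) =
        (2 ^ γ₂ * v ^ (-γ₂) * tail F y) / tail F x₀ by ring]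
      exact (one_le_div hx₀pos).2 h8

end Tail

/-! ### Quantiles and integrals under regular variation -/

section RegularVariation

variable {F : Measure ℝ} [IsProbabilityMeasure F] {γ : ℝ} {ι : Type*} {l : Filter ι}

/-- Regular variation inverts: comparing the quantile with `b y` is comparing `tail F (b y) / tail F
y → b^(-γ)` with `w`, so the critical `b` is `w^(-1/γ)`. -/
theorem HasRegularlyVaryingTail.tendsto_tailInv (hF : HasRegularlyVaryingTail F γ) (hγ : 0 < γ)
    {y : ι → ℝ} (hy : Tendsto y l atTop) {w : ℝ} (hw : 0 < w) :
    Tendsto (fun i => tailInv F (tail F (y i) * w) / y i) l (𝓝 (w ^ (-γ⁻¹))) := by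
  have hpos : 0 < w ^ (-γ⁻¹) := by positivity
  have hinv : (w ^ (-γ⁻¹)) ^ (-γ) = w := by
    rw [← Real.rpow_mul hw.le]; simp [hγ.ne']
  rw [tendsto_order]
  constructor
  · intro a ha
    obtain ⟨b, hab, hb⟩ := exists_between (max_lt ha hpos)
    have hb0 : 0 < b := (le_max_right _ _).trans_lt hab
    have h1 : w < b ^ (-γ) := by
      rw [← hinv]; exact Real.rpow_lt_rpow_of_neg hb0 hb (by linarith)
    filter_upwards [((hF b hb0).comp hy).eventually_const_lt h1, hy.eventually_gt_atTop 0]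
      with i hi hyi
    rw [Function.comp_apply, lt_div_iff₀ (hF.tail_pos _), mul_comm] at hi
    have := (lt_tailInv_iff (mul_pos (hF.tail_pos _) hw) (by positivity : 0 ≤ b * y i)).2 hi
    exact ((le_max_left _ _).trans_lt hab).trans ((lt_div_iff₀ hyi).2 this)
  · intro a ha
    obtain ⟨b, hb, hba⟩ := exists_between ha
    have hb0 : 0 < b := hpos.trans hb
    have h1 : b ^ (-γ) < w := by
      rw [← hinv]; exact Real.rpow_lt_rpow_of_neg hpos hb (by linarith)
    filter_upwards [((hF b hb0).comp hy).eventually_lt_const h1, hy.eventually_gt_atTop 0]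
      with i hi hyi
    rw [Function.comp_apply, div_lt_iff₀ (hF.tail_pos _), mul_comm w] at hi
    have := (tailInv_le_iff (mul_pos (hF.tail_pos _) hw) (by positivity : 0 ≤ b * y i)).2 hi.le
    exact ((div_le_iff₀ hyi).2 this).trans_lt hba

theorem HasRegularlyVaryingTail.tendsto_tailInv_atTop (hF : HasRegularlyVaryingTail F γ) :
    Tendsto (tailInv F) (𝓝[>] 0) atTop := by
  refine tendsto_atTop.2 fun M => ?_
  have h : ∀ᶠ u in 𝓝[>] (0 : ℝ), u < tail F (max M 0) :=
    nhdsWithin_le_nhds (eventually_lt_nhds (hF.tail_pos _))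
  filter_upwards [h, self_mem_nhdsWithin] with u hu hu0
  exact (le_max_left M 0).trans ((lt_tailInv_iff hu0 (le_max_right M 0)).2 hu).le

/-- The tail may jump below `u` at its quantile `q`, so the ratio is only at most 1. But for `c < 1`
the tail at `c q` still exceeds `u`, and it is about `c^(-γ)` times the tail at `q`; let `c ↑ 1`. -/
theorem HasRegularlyVaryingTail.tendsto_tail_tailInv_div (hF : HasRegularlyVaryingTail F γ) :
    Tendsto (fun u => tail F (tailInv F u) / u) (𝓝[>] 0) (𝓝 1) := by
  have hq := hF.tendsto_tailInv_atTop
  rw [tendsto_order]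
  constructor
  · intro a ha
    have hc : Tendsto (fun c : ℝ => c ^ (-γ)) (𝓝[<] 1) (𝓝 1) := by
      have : ContinuousAt (fun c : ℝ => c ^ (-γ)) 1 :=
        Real.continuousAt_rpow_const _ _ (Or.inl one_ne_zero)
      have h := this.tendsto
      rw [Real.one_rpow] at h
      exact h.mono_left nhdsWithin_le_nhds
    have hev : ∀ᶠ c in 𝓝[<] (1 : ℝ), max a 0 * c ^ (-γ) < 1 := by
      have h := hc.const_mul (max a 0)
      rw [mul_one] at h
      exact h.eventually_lt_const (max_lt ha one_pos)
    have hev2 : ∀ᶠ c in 𝓝[<] (1 : ℝ), 0 < c := nhdsWithin_le_nhds (eventually_gt_nhds one_pos)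
    obtain ⟨c, ⟨hc1, hc2⟩, hc3⟩ := ((hev.and hev2).and self_mem_nhdsWithin).exists
    have h1 : ∀ᶠ u in 𝓝[>] (0 : ℝ),
        max a 0 * (tail F (c * tailInv F u) / tail F (tailInv F u)) < 1 :=
      (((hF c hc2).comp hq).const_mul (max a 0)).eventually_lt_const hc1
    filter_upwards [h1, self_mem_nhdsWithin, hq.eventually_gt_atTop 0] with u hu hu0 hqu
    rw [← mul_div_assoc, div_lt_one (hF.tail_pos _)] at hu
    have hu' : u < tail F (c * tailInv F u) := by
      rw [← lt_tailInv_iff hu0 (by positivity)]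
      exact mul_lt_of_lt_one_left hqu hc3
    rw [lt_div_iff₀ hu0]
    calc a * u ≤ max a 0 * u := mul_le_mul_of_nonneg_right (le_max_left _ _) (le_of_lt hu0)
      _ ≤ max a 0 * tail F (c * tailInv F u) :=
        mul_le_mul_of_nonneg_left hu'.le (le_max_right _ _)
      _ < _ := hu
  · intro a ha
    filter_upwards [self_mem_nhdsWithin] with u hu0
    refine lt_of_le_of_lt ?_ ha
    rw [div_le_one hu0]
    exact (tailInv_le_iff hu0 (tailInv_nonneg u)).1 le_rfl

/-- Integrals of continuously convergent functions against a rescaled distribution with a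
regularly varying tail. -/
theorem HasRegularlyVaryingTail.tendsto_integral [l.IsCountablyGenerated]
    (hF : HasRegularlyVaryingTail F γ) (hF0 : F (Iic 0) = 0) (hγ : 1 < γ) {p K : ℝ} (hp : γ < p)
    {y : ι → ℝ} (hy : Tendsto y l atTop) {g : ι → ℝ → ℂ} {g₀ : ℝ → ℂ}
    (hgm : ∀ i, Measurable (g i))
    (hb : ∀ᶠ i in l, ∀ v, 0 < v → ‖g i v‖ ≤ K * v ^ p ∧ ‖g i v‖ ≤ K * v)
    (hcont : ∀ v, 0 < v → ∀ u : ι → ℝ, Tendsto u l (𝓝 v) →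
      Tendsto (fun i => g i (u i)) l (𝓝 (g₀ v))) :
    Tendsto (fun i => (tail F (y i))⁻¹ • ∫ v, g i (v / y i) ∂F) l
      (𝓝 (∫ v in Ioi 0, (γ * v ^ (-γ - 1)) • g₀ v)) := by
  rcases l.eq_or_neBot with rfl | hl
  · exact tendsto_bot
  have hγ0 : 0 < γ := by linarith
  have hK : 0 ≤ K := by
    obtain ⟨i, hi⟩ := hb.exists
    have := (norm_nonneg _).trans (hi 1 one_pos).2
    linarith
  obtain ⟨γ₁, h1γ₁, hγ₁⟩ := exists_between hγ
  obtain ⟨γ₂, hγ₂, hγ₂p⟩ := exists_between hp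
  obtain ⟨A, hA, hpot⟩ := hF.exists_potter (by linarith) hγ₁ hγ₂
  -- Quantile transform followed by `u = tail F (y i) * w`: the normalising factor disappears and
  -- the argument `tailInv F u / y i` tends to `w^(-1/γ)`. It moves with `i`, which is why
  -- convergence of `g` is required along convergent families.
  set G : ι → ℝ → ℂ := fun i w =>
    (Ioo (0 : ℝ) 1).indicator (fun u => g i (tailInv F u / y i)) (tail F (y i) * w) with hG
  have hint : ∀ i, (tail F (y i))⁻¹ • ∫ v, g i (v / y i) ∂F = ∫ w in Ioi 0, G i w := fun i => by
    have e1 : ∫ v, g i (v / y i) ∂F = ∫ u in Ioo 0 1, g i (tailInv F u / y i) := by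
      conv_lhs => rw [← map_tailInv hF0]
      exact integral_map aemeasurable_tailInv
        ((hgm i).comp (measurable_id.div_const _)).aestronglyMeasurable
    have e2 : ∫ u in Ioo 0 1, g i (tailInv F u / y i) =
        ∫ u in Ioi 0, (Ioo (0 : ℝ) 1).indicator (fun u => g i (tailInv F u / y i)) u := by
      rw [setIntegral_indicator measurableSet_Ioo, inter_eq_right.2 Ioo_subset_Ioi_self]
    rw [e1, e2, hG, integral_comp_mul_left_Ioi _ _ (hF.tail_pos _), mul_zero]
  simp_rw [hint]
  -- Substitute `w = v^(-γ)`, the limiting tail.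
  have hlimint : ∫ v in Ioi 0, (γ * v ^ (-γ - 1)) • g₀ v = ∫ w in Ioi 0, g₀ (w ^ (-γ⁻¹)) := by
    rw [← integral_comp_rpow_Ioi (fun w => g₀ (w ^ (-γ⁻¹))) (neg_ne_zero.2 hγ0.ne')]
    refine setIntegral_congr_fun measurableSet_Ioi fun v hv => ?_
    have hv0 : (0 : ℝ) < v := hv
    simp only [abs_neg, abs_of_pos hγ0]
    rw [← Real.rpow_mul hv0.le, neg_mul_neg, mul_inv_cancel₀ hγ0.ne', Real.rpow_one]
  rw [hlimint]
  -- By the Potter bounds the rescaled quantile is at most `(A/w)^(1/γ₁)` for `w ≤ A` and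
  -- `(A/w)^(1/γ₂)` for `w > A`. The linear bound on `g` is integrable near 0 because `γ₁ > 1`, the
  -- `p`-th power bound at infinity because `p > γ₂`.
  set b : ℝ → ℝ := fun w => (Ioc 0 A).indicator (fun w => K * (A / w) ^ γ₁⁻¹) w +
    (Ioi A).indicator (fun w => K * ((A / w) ^ γ₂⁻¹) ^ p) w with hbdef
  have hdiv : ∀ w, 0 < w → ∀ s : ℝ, (A / w) ^ s = A ^ s * w ^ (-s) := fun w hw s => by
    rw [Real.div_rpow hA.le hw.le, Real.rpow_neg hw.le, div_eq_mul_inv]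
  have hbint : IntegrableOn b (Ioi 0) := by
    refine Integrable.add ?_ ?_
    · refine (IntegrableOn.integrable_indicator ?_ measurableSet_Ioc).integrableOn
      have h := (intervalIntegral.intervalIntegrable_rpow' (a := 0) (b := A) (r := -γ₁⁻¹)
        (neg_lt_neg (inv_lt_one_of_one_lt₀ h1γ₁))).1
      refine IntegrableOn.congr_fun (h.const_mul (K * A ^ γ₁⁻¹)) (fun w hw => ?_) measurableSet_Ioc
      simp only [hdiv w hw.1]; ring
    · refine (IntegrableOn.integrable_indicator ?_ measurableSet_Ioi).integrableOn
      have hγ₂0 : 0 < γ₂ := by linarith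
      have h := integrableOn_Ioi_rpow_of_lt (a := -(γ₂⁻¹ * p)) (by
        rw [neg_lt_neg_iff, ← div_eq_inv_mul, one_lt_div hγ₂0]; exact hγ₂p) hA
      refine IntegrableOn.congr_fun (h.const_mul (K * A ^ (γ₂⁻¹ * p))) (fun w hw => ?_) measurableSet_Ioi
      have hw0 : 0 < w := hA.trans hw
      have e : ((A / w) ^ γ₂⁻¹) ^ p = A ^ (γ₂⁻¹ * p) * w ^ (-(γ₂⁻¹ * p)) := by
        rw [← Real.rpow_mul (by positivity), hdiv w hw0]
      simp only [e]; ring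
  refine tendsto_integral_filter_of_dominated_convergence b ?_ ?_ hbint ?_
  · refine Eventually.of_forall fun i => ?_
    have hm : AEStronglyMeasurable
        ((Ioo (0 : ℝ) 1).indicator (fun u => g i (tailInv F u / y i))) volume := by
      rw [aestronglyMeasurable_indicator_iff measurableSet_Ioo]
      exact ((hgm i).comp_aemeasurable
        (aemeasurable_tailInv.div_const _)).aestronglyMeasurable
    refine AEStronglyMeasurable.restrict ?_
    refine hm.comp_quasiMeasurePreserving ⟨measurable_const_mul _, ?_⟩
    rw [Real.map_volume_mul_left (hF.tail_pos (y i)).ne']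
    exact Measure.smul_absolutelyContinuous
  · filter_upwards [hb, hy.eventually hpot, hy.eventually_gt_atTop 0] with i hi hpi hyi
    refine (ae_restrict_iff' measurableSet_Ioi).2 (ae_of_all _ fun w hw => ?_)
    have hw0 : (0 : ℝ) < w := hw
    have hκ := hF.tail_pos (y i)
    have hbn : 0 ≤ b w := by
      refine add_nonneg (indicator_nonneg (fun w hw => ?_) _) (indicator_nonneg (fun w hw => ?_) _)
      · have := hw.1; positivity
      · have : 0 < w := hA.trans hw
        positivity
    simp only [hG]
    by_cases hmem : tail F (y i) * w ∈ Ioo (0 : ℝ) 1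
    swap
    · rw [indicator_of_notMem hmem, norm_zero]; exact hbn
    rw [indicator_of_mem hmem]
    set Q := tailInv F (tail F (y i) * w) / y i with hQ
    have hQpos : 0 < Q := by
      refine div_pos ?_ hyi
      rw [lt_tailInv_iff hmem.1 le_rfl]
      refine hmem.2.trans_le ?_
      rw [tail, ← compl_Iic, probReal_compl_eq_one_sub measurableSet_Iic, measureReal_def, hF0]
      simp
    have hQle : ∀ v, 0 < v → tail F (v * y i) ≤ tail F (y i) * w → Q ≤ v := fun v hv h => by
      rw [hQ, div_le_iff₀ hyi]
      exact (tailInv_le_iff hmem.1 (by positivity)).2 h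
    have hcancel : ∀ s : ℝ, s ≠ 0 → A * tail F (y i) * ((A / w) ^ s⁻¹) ^ (-s) =
        tail F (y i) * w := fun s hs => by
      rw [← Real.rpow_mul (by positivity)]
      have : s⁻¹ * -s = -1 := by field_simp
      rw [this, Real.rpow_neg_one]
      field_simp
    rcases le_or_gt w A with hwA | hwA
    · have hbw : b w = K * (A / w) ^ γ₁⁻¹ := by
        simp only [hbdef]
        rw [indicator_of_mem (by exact ⟨hw0, hwA⟩), indicator_of_notMem (by simpa using hwA),
          add_zero]
      rw [hbw]
      refine (hi Q hQpos).2.trans (mul_le_mul_of_nonneg_left ?_ hK)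
      refine hQle _ (by positivity) ?_
      rw [← hcancel γ₁ (by linarith)]
      exact hpi.1 _ (Real.one_le_rpow ((one_le_div hw0).2 hwA) (by
        have : 0 < γ₁ := by linarith
        positivity))
    · have hbw : b w = K * ((A / w) ^ γ₂⁻¹) ^ p := by
        simp only [hbdef]
        rw [indicator_of_notMem (by simp [hwA]), indicator_of_mem (by exact hwA), zero_add]
      rw [hbw]
      refine (hi Q hQpos).1.trans (mul_le_mul_of_nonneg_left ?_ hK)
      refine Real.rpow_le_rpow hQpos.le ?_ (by linarith)
      refine hQle _ (by positivity) ?_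
      rw [← hcancel γ₂ (by linarith)]
      have : 0 < γ₂ := by linarith
      exact hpi.2 _ (by positivity) (Real.rpow_le_one (by positivity)
        ((div_le_one hw0).2 hwA.le) (by positivity))
  · refine (ae_restrict_iff' measurableSet_Ioi).2 (ae_of_all _ fun w hw => ?_)
    have hw0 : (0 : ℝ) < w := hw
    have h1 := hcont (w ^ (-γ⁻¹)) (by positivity) _ (hF.tendsto_tailInv hγ0 hy hw0)
    refine h1.congr' ?_
    have h2 : Tendsto (fun i => tail F (y i) * w) l (𝓝 0) := by
      simpa using (tendsto_tail_atTop.comp hy).mul_const w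
    filter_upwards [h2.eventually_lt_const one_pos] with i hi
    simp only [hG]
    have hmem : tail F (y i) * w ∈ Ioo (0 : ℝ) 1 := ⟨mul_pos (hF.tail_pos _) hw0, hi⟩
    rw [indicator_of_mem hmem]

end RegularVariation

/-! ### Rotations -/

instance SO.instSecondCountableTopology (d : ℕ) : SecondCountableTopology (SO d) := by
  have : SecondCountableTopology (Matrix (Fin d) (Fin d) ℝ) :=
    inferInstanceAs (SecondCountableTopology (Fin d → Fin d → ℝ))
  exact TopologicalSpace.Subtype.secondCountableTopology _

section Rotation

variable {d : ℕ}

local notation "𝔼" => EuclideanSpace ℝ (Fin d)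

theorem rotate_mul (θ θ' : SO d) (x : 𝔼) : rotate (θ * θ') x = rotate θ (rotate θ' x) := by
  simp [rotate, Matrix.mulVec_mulVec]

theorem rotate_one (x : 𝔼) : rotate (1 : SO d) x = x := by
  simp [rotate]

theorem rotate_inv_rotate (θ : SO d) (x : 𝔼) : rotate θ⁻¹ (rotate θ x) = x := by
  rw [← rotate_mul, inv_mul_cancel, rotate_one]

theorem rotate_rotate_inv (θ : SO d) (x : 𝔼) : rotate θ (rotate θ⁻¹ x) = x := by
  rw [← rotate_mul, mul_inv_cancel, rotate_one]

theorem rotate_add (θ : SO d) (x y : 𝔼) : rotate θ (x + y) = rotate θ x + rotate θ y := by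
  simp [rotate, Matrix.mulVec_add]

theorem rotate_smul (θ : SO d) (c : ℝ) (x : 𝔼) : rotate θ (c • x) = c • rotate θ x := by
  simp [rotate, Matrix.mulVec_smul]

theorem rotate_neg (θ : SO d) (x : 𝔼) : rotate θ (-x) = -rotate θ x := by
  simp [rotate, Matrix.mulVec_neg]

theorem norm_rotate (θ : SO d) (x : 𝔼) : ‖rotate θ x‖ = ‖x‖ := by
  have h : (θ : Matrix (Fin d) (Fin d) ℝ).transpose * θ = 1 :=
    (Matrix.mem_orthogonalGroup_iff' _ _).1 (Matrix.mem_specialOrthogonalGroup_iff.1 θ.2).1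
  have h2 : ‖rotate θ x‖ ^ 2 = ‖x‖ ^ 2 := by
    rw [← real_inner_self_eq_norm_sq, ← real_inner_self_eq_norm_sq,
      EuclideanSpace.inner_eq_star_dotProduct, EuclideanSpace.inner_eq_star_dotProduct]
    simp only [rotate, star_trivial]
    rw [Matrix.dotProduct_mulVec, ← Matrix.mulVec_transpose, Matrix.mulVec_mulVec, h,
      Matrix.one_mulVec]
  exact (sq_eq_sq₀ (norm_nonneg _) (norm_nonneg _)).1 h2

/-- A rotation as a linear isometry. -/
def rotateIso (θ : SO d) : 𝔼 ≃ₗᵢ[ℝ] 𝔼 where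
  toFun := rotate θ
  invFun := rotate θ⁻¹
  left_inv := rotate_inv_rotate θ
  right_inv := rotate_rotate_inv θ
  map_add' := rotate_add θ
  map_smul' := rotate_smul θ
  norm_map' := norm_rotate θ

theorem continuous_rotate : Continuous fun p : SO d × 𝔼 => rotate p.1 p.2 := by
  refine (PiLp.continuous_toLp 2 _).comp ?_
  exact (continuous_subtype_val.comp continuous_fst).matrix_mulVec
    ((PiLp.continuous_ofLp 2 _).comp continuous_snd)

theorem measurable_rotate : Measurable fun p : SO d × 𝔼 => rotate p.1 p.2 :=
  continuous_rotate.measurable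

theorem measurePreserving_rotate (θ : SO d) :
    MeasurePreserving (rotate θ) (volume : Measure 𝔼) volume :=
  (rotateIso θ).measurePreserving

theorem exists_rotate_eq_of_linearIsometryEquiv (L : 𝔼 ≃ₗᵢ[ℝ] 𝔼)
    (hL : LinearMap.det (L.toLinearEquiv : 𝔼 →ₗ[ℝ] 𝔼) = 1) : ∃ θ : SO d, ∀ x, rotate θ x = L x := by
  set b := (EuclideanSpace.basisFun (Fin d) ℝ) with hb
  set A := LinearMap.toMatrix b.toBasis b.toBasis (L.toLinearEquiv : 𝔼 →ₗ[ℝ] 𝔼) with hA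
  have hAx : ∀ x : 𝔼, A.mulVec x.ofLp = (L x).ofLp := fun x =>
    LinearMap.toMatrix_mulVec_repr b.toBasis b.toBasis _ x
  have hcol : ∀ i j, A i j = L (b j) i := fun i j => by
    rw [hA, LinearMap.toMatrix_apply]
    simp [hb]
  have horth : A.transpose * A = 1 := by
    ext i j
    rw [Matrix.mul_apply]
    simp only [Matrix.transpose_apply, hcol]
    have h1 : inner ℝ (L (b j)) (L (b i)) = inner ℝ (b j) (b i) := L.inner_map_map _ _
    rw [PiLp.inner_apply] at h1
    simp only [RCLike.inner_apply, conj_trivial] at h1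
    rw [h1, orthonormal_iff_ite.1 b.orthonormal, Matrix.one_apply]
    simp [eq_comm]
  have hdet : A.det = 1 := by rw [hA, LinearMap.det_toMatrix, hL]
  refine ⟨⟨A, Matrix.mem_specialOrthogonalGroup_iff.2
    ⟨(Matrix.mem_orthogonalGroup_iff' _ _).2 horth, hdet⟩⟩, fun x => ?_⟩
  change WithLp.toLp 2 (A.mulVec x.ofLp) = L x
  rw [hAx]

/-- The rotations act transitively on the directions. -/
theorem exists_rotate_eq_or_eq_neg [NeZero d] {e f : 𝔼} (he : ‖e‖ = 1) (hf : ‖f‖ = 1) :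
    ∃ θ : SO d, rotate θ e = f ∨ rotate θ e = -f := by
  rcases eq_or_ne e f with rfl | hef
  · exact ⟨1, Or.inl (rotate_one e)⟩
  have he0 : e ≠ 0 := fun h => by simp [h] at he
  have hfin : Module.finrank ℝ 𝔼 = d := finrank_euclideanSpace_fin
  -- In dimension one the rotation group is trivial, whence the alternative `-f` in the conclusion.
  by_cases hd : d = 1
  · subst hd
    refine ⟨1, ?_⟩
    rw [rotate_one]
    rw [EuclideanSpace.norm_eq] at he hf
    simp only [Fin.sum_univ_one, Real.norm_eq_abs, sq_abs, Real.sqrt_sq_eq_abs] at he hf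
    have h0 : e 0 = f 0 ∨ e 0 = -f 0 := abs_eq_abs.1 (he.trans hf.symm)
    refine h0.imp (fun h => ?_) (fun h => ?_) <;>
    · ext i
      rw [Subsingleton.elim i 0]
      simpa using h
  · have hd2 : 2 ≤ d := by
      have := NeZero.ne d
      omega
    -- The reflection exchanging `e` and `f` has determinant -1; composing it with the reflection
    -- along some `g ⊥ e`, which fixes `e`, gives a rotation.
    obtain ⟨g, hg⟩ : ∃ g : (ℝ ∙ e)ᗮ, g ≠ 0 := by
      have hfr : Module.finrank ℝ (ℝ ∙ e)ᗮ = d - 1 := by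
        have := Submodule.finrank_add_finrank_orthogonal (ℝ ∙ e)
        rw [finrank_span_singleton he0, hfin] at this
        omega
      have : Nontrivial (ℝ ∙ e)ᗮ := Module.nontrivial_of_finrank_pos (R := ℝ) (by omega)
      exact exists_ne 0
    have hg0 : (g : 𝔼) ≠ 0 := fun h => hg (Subtype.ext h)
    have hdet : ∀ w : 𝔼, w ≠ 0 →
        LinearMap.det ((ℝ ∙ w)ᗮ.reflection.toLinearEquiv : 𝔼 →ₗ[ℝ] 𝔼) = -1 := fun w hw => by
      have := Submodule.det_reflection (ℝ ∙ w)ᗮ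
      rw [Submodule.orthogonal_orthogonal, finrank_span_singleton hw, pow_one] at this
      exact this
    have hge : (ℝ ∙ (g : 𝔼))ᗮ.reflection e = e := by
      rw [Submodule.reflection_eq_self_iff, Submodule.mem_orthogonal_singleton_iff_inner_right]
      have := Submodule.mem_orthogonal_singleton_iff_inner_right.1 g.2
      rwa [real_inner_comm] at this
    obtain ⟨θ, hθ⟩ := exists_rotate_eq_of_linearIsometryEquiv
      ((ℝ ∙ (g : 𝔼))ᗮ.reflection.trans (ℝ ∙ (e - f))ᗮ.reflection) (by
        have h1 : (((ℝ ∙ (g : 𝔼))ᗮ.reflection.trans (ℝ ∙ (e - f))ᗮ.reflection).toLinearEquiv :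
            𝔼 →ₗ[ℝ] 𝔼) = ((ℝ ∙ (e - f))ᗮ.reflection.toLinearEquiv : 𝔼 →ₗ[ℝ] 𝔼) ∘ₗ
              ((ℝ ∙ (g : 𝔼))ᗮ.reflection.toLinearEquiv : 𝔼 →ₗ[ℝ] 𝔼) := rfl
        rw [h1, LinearMap.det_comp, hdet _ hg0, hdet _ (sub_ne_zero.2 hef)]
        norm_num)
    refine ⟨θ, Or.inl ?_⟩
    rw [hθ, LinearIsometryEquiv.trans_apply, hge,
      Submodule.reflection_sub (he.trans hf.symm)]

/-! ### Invariance of the Haar measure of the rotation group -/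

instance haarSO.instIsHaarMeasure (d : ℕ) : Measure.IsHaarMeasure (haarSO d) := by
  unfold haarSO; infer_instance

/-- Uniqueness of Haar measure. Applied to the images of `haarSO` under right translations and
inversion, it gives right and inversion invariance. -/
theorem eq_haarSO (μ : Measure (SO d)) [IsProbabilityMeasure μ] [μ.IsMulLeftInvariant] :
    μ = haarSO d := by
  have h := Measure.isMulInvariant_eq_smul_of_compactSpace μ (haarSO d)
  have h1 : μ univ = Measure.haarScalarFactor μ (haarSO d) • haarSO d univ := by
    conv_lhs => rw [h]
    rfl
  rw [measure_univ, measure_univ, ENNReal.smul_def, smul_eq_mul, mul_one] at h1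
  have h2 : Measure.haarScalarFactor μ (haarSO d) = 1 := by exact_mod_cast h1.symm
  rw [h, h2, one_smul]

instance haarSO.instIsMulRightInvariant (d : ℕ) : Measure.IsMulRightInvariant (haarSO d) := by
  refine ⟨fun g => ?_⟩
  have hp : IsProbabilityMeasure ((haarSO d).map (· * g)) :=
    Measure.isProbabilityMeasure_map (measurable_mul_const g).aemeasurable
  exact eq_haarSO _

instance haarSO.instIsInvInvariant (d : ℕ) : Measure.IsInvInvariant (haarSO d) := by
  refine ⟨?_⟩
  have hp : IsProbabilityMeasure (haarSO d).inv :=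
    Measure.isProbabilityMeasure_map measurable_inv.aemeasurable
  exact eq_haarSO _

/-- Transitivity on unit vectors and right invariance make the mean over rotations independent of
the direction. Evenness of `g` absorbs the sign ambiguity of dimension one. -/
theorem lintegral_haarSO_rotate_eq [NeZero d] {g : 𝔼 → ℝ≥0∞} (hg : ∀ x, g (-x) = g x) {e f : 𝔼}
    (he : ‖e‖ = 1) (hf : ‖f‖ = 1) :
    ∫⁻ θ, g (rotate θ⁻¹ f) ∂(haarSO d) = ∫⁻ θ, g (rotate θ e) ∂(haarSO d) := by
  obtain ⟨θ₀, h⟩ := exists_rotate_eq_or_eq_neg he hf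
  have h1 : ∀ θ : SO d, g (rotate θ f) = g (rotate (θ * θ₀) e) := fun θ => by
    rw [rotate_mul]
    rcases h with h | h
    · rw [h]
    · rw [h, rotate_neg, hg]
  rw [lintegral_inv_eq_self (μ := haarSO d) (fun θ => g (rotate θ f))]
  simp_rw [h1]
  exact lintegral_mul_right_eq_self (fun θ => g (rotate θ e)) θ₀

end Rotation

/-! ### Grains -/

/-- Fubini: for each fixed `y` the locations `x` with `y - x ∈ A` have measure `m A`. -/
theorem lintegral_measure_translate {G : Type*} [AddCommGroup G] [MeasurableSpace G]
    [MeasurableAdd₂ G] [MeasurableNeg G] {m μ : Measure G} [SFinite m] [SFinite μ]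
    [m.IsAddLeftInvariant] [m.IsNegInvariant] {A : Set G} (hA : MeasurableSet A) :
    ∫⁻ x, μ {y | y - x ∈ A} ∂m = μ univ * m A := by
  have hm : MeasurableSet {p : G × G | p.2 - p.1 ∈ A} :=
    (measurable_snd.sub measurable_fst) hA
  have h1 : ∫⁻ x, μ {y | y - x ∈ A} ∂m = (m.prod μ) {p : G × G | p.2 - p.1 ∈ A} :=
    (Measure.prod_apply hm).symm
  rw [h1, Measure.prod_apply_symm hm]
  have h2 : ∀ y, m ((fun x => (x, y)) ⁻¹' {p : G × G | p.2 - p.1 ∈ A}) = m A := fun y =>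
    (Measure.measurePreserving_sub_left m y).measure_preimage hA.nullMeasurableSet
  simp_rw [h2]
  rw [lintegral_const, mul_comm]

/-- Fubini: for a fixed pair `y`, `y'` the substitution `u = y - x` turns the locations whose
translate of `A` contains both points into the overlap of `A` with a translate of itself. Grain
moments thereby become energies of the overlap kernel. -/
theorem lintegral_measure_translate_mul {G : Type*} [AddCommGroup G] [MeasurableSpace G]
    [MeasurableAdd₂ G] [MeasurableNeg G] {m μ ν : Measure G} [SFinite m] [SFinite μ] [SFinite ν]
    [m.IsAddLeftInvariant] [m.IsNegInvariant] {A : Set G} (hA : MeasurableSet A) :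
    ∫⁻ x, μ {y | y - x ∈ A} * ν {y | y - x ∈ A} ∂m =
      ∫⁻ y, ∫⁻ y', m (A ∩ {u | u + (y' - y) ∈ A}) ∂ν ∂μ := by
  set χ : G → G → ℝ≥0∞ := fun x y => A.indicator 1 (y - x) with hχ
  have hχm : Measurable fun p : G × G => χ p.1 p.2 :=
    (measurable_one.indicator hA).comp (measurable_snd.sub measurable_fst)
  have hχi : ∀ (μ : Measure G) x, μ {y | y - x ∈ A} = ∫⁻ y, χ x y ∂μ := fun μ x => by
    have hm : MeasurableSet {y | y - x ∈ A} := (measurable_id.sub_const x) hA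
    rw [← lintegral_indicator_one hm]
    rfl
  have hχ1 : ∀ x, Measurable (χ x) := fun x => hχm.comp (measurable_const.prodMk measurable_id)
  have hχ2 : ∀ y, Measurable fun x => χ x y := fun y =>
    hχm.comp (measurable_id.prodMk measurable_const)
  calc ∫⁻ x, μ {y | y - x ∈ A} * ν {y | y - x ∈ A} ∂m
      = ∫⁻ x, ∫⁻ y, χ x y * ∫⁻ y', χ x y' ∂ν ∂μ ∂m := by
        refine lintegral_congr fun x => ?_
        rw [hχi, hχi, lintegral_mul_const _ (hχ1 x)]
    _ = ∫⁻ y, ∫⁻ x, χ x y * ∫⁻ y', χ x y' ∂ν ∂m ∂μ := by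
        refine lintegral_lintegral_swap (Measurable.aemeasurable ?_)
        exact hχm.mul (Measurable.lintegral_prod_right' hχm |>.comp measurable_fst)
    _ = ∫⁻ y, ∫⁻ x, ∫⁻ y', χ x y * χ x y' ∂ν ∂m ∂μ := by
        refine lintegral_congr fun y => lintegral_congr fun x => ?_
        rw [lintegral_const_mul _ (hχ1 x)]
    _ = ∫⁻ y, ∫⁻ y', ∫⁻ x, χ x y * χ x y' ∂m ∂ν ∂μ := by
        refine lintegral_congr fun y => lintegral_lintegral_swap (Measurable.aemeasurable ?_)
        exact ((hχ2 y).comp measurable_fst).mul hχm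
    _ = ∫⁻ y, ∫⁻ y', m (A ∩ {u | u + (y' - y) ∈ A}) ∂ν ∂μ := by
        refine lintegral_congr fun y => lintegral_congr fun y' => ?_
        have hB : MeasurableSet (A ∩ {u | u + (y' - y) ∈ A}) :=
          hA.inter ((measurable_id.add_const _) hA)
        rw [← (Measure.measurePreserving_sub_left m y).measure_preimage hB.nullMeasurableSet,
          ← lintegral_indicator_one ((Measure.measurePreserving_sub_left m y).measurable hB)]
        refine lintegral_congr fun x => ?_
        by_cases h1 : y - x ∈ A <;> by_cases h2 : y' - x ∈ A <;> simp [hχ, indicator, h1, h2]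

section Grain

variable {d : ℕ}

local notation "𝔼" => EuclideanSpace ℝ (Fin d)

/-- The rotated and dilated grain `v^(1/d) θ C`, for `v > 0`. -/
def shape (C : Set 𝔼) (v : ℝ) (θ : SO d) : Set 𝔼 :=
  {u | rotate θ⁻¹ ((v ^ (1 / (d : ℝ)))⁻¹ • u) ∈ C}

/-- The grain is given as an image; written as a preimage it is visibly measurable jointly in all
variables. -/
theorem grain_eq (C : Set 𝔼) {z : 𝔼 × ℝ × SO d} (hv : 0 < z.2.1) :
    grain C z = {y | y - z.1 ∈ shape C z.2.1 z.2.2} := by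
  have hr : 0 < z.2.1 ^ (1 / (d : ℝ)) := by positivity
  ext y
  simp only [grain, shape, mem_image, mem_ofPred_eq]
  constructor
  · rintro ⟨c, hc, rfl⟩
    rw [add_sub_cancel_left, smul_smul, inv_mul_cancel₀ hr.ne', one_smul, rotate_inv_rotate]
    exact hc
  · intro h
    refine ⟨_, h, ?_⟩
    rw [rotate_rotate_inv, smul_smul, mul_inv_cancel₀ hr.ne', one_smul, add_sub_cancel]

theorem measurableSet_shape_prod {C : Set 𝔼} (hC : MeasurableSet C) :
    MeasurableSet {p : (𝔼 × ℝ × SO d) × 𝔼 | p.2 - p.1.1 ∈ shape C p.1.2.1 p.1.2.2} := by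
  have h : Measurable fun p : (𝔼 × ℝ × SO d) × 𝔼 =>
      rotate p.1.2.2⁻¹ ((p.1.2.1 ^ (1 / (d : ℝ)))⁻¹ • (p.2 - p.1.1)) := by
    refine measurable_rotate.comp (Measurable.prodMk ?_ ?_)
    · exact (measurable_snd.comp (measurable_snd.comp measurable_fst)).inv
    · have h1 : Measurable fun p : (𝔼 × ℝ × SO d) × 𝔼 => p.2 - p.1.1 :=
        measurable_snd.sub (measurable_fst.comp measurable_fst)
      have h2 : Measurable fun p : (𝔼 × ℝ × SO d) × 𝔼 => (p.1.2.1 ^ (1 / (d : ℝ)))⁻¹ :=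
        ((measurable_fst.comp (measurable_snd.comp measurable_fst)).pow_const _).inv
      exact h2.smul h1
  exact h hC

theorem measurableSet_shape {C : Set 𝔼} (hC : MeasurableSet C) (v : ℝ) (θ : SO d) :
    MeasurableSet (shape C v θ) := by
  have h : Measurable fun u : 𝔼 => rotate θ⁻¹ ((v ^ (1 / (d : ℝ)))⁻¹ • u) :=
    (measurePreserving_rotate θ⁻¹).measurable.comp (measurable_const_smul _)
  exact h hC

theorem rpow_one_div_natCast_pow [NeZero d] {v : ℝ} (hv : 0 ≤ v) :
    (v ^ (1 / (d : ℝ))) ^ d = v := by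
  rw [one_div]; exact Real.rpow_inv_natCast_pow hv (NeZero.ne d)

theorem volume_shape [NeZero d] {C : Set 𝔼} (hC : MeasurableSet C) {v : ℝ} (hv : 0 < v)
    (θ : SO d) : volume (shape C v θ) = ENNReal.ofReal v * volume C := by
  have hr : 0 < v ^ (1 / (d : ℝ)) := by positivity
  have h1 : shape C v θ = (fun u => (v ^ (1 / (d : ℝ)))⁻¹ • u) ⁻¹' (rotate θ⁻¹ ⁻¹' C) := rfl
  rw [h1, Measure.addHaar_preimage_smul _ (inv_ne_zero hr.ne'),
    (measurePreserving_rotate θ⁻¹).measure_preimage hC.nullMeasurableSet, finrank_euclideanSpace_fin,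
    inv_pow, inv_inv, rpow_one_div_natCast_pow hv.le, abs_of_pos hv]

theorem shape_inter_translate (C : Set 𝔼) (v : ℝ) (θ : SO d) (w : 𝔼) :
    shape C v θ ∩ {u | u + w ∈ shape C v θ} =
      shape (C ∩ {u | u + (v ^ (1 / (d : ℝ)))⁻¹ • rotate θ⁻¹ w ∈ C}) v θ := by
  ext u
  simp only [shape, mem_inter_iff, mem_ofPred_eq, smul_add, rotate_add, rotate_smul]

theorem volume_shape_inter_translate [NeZero d] {C : Set 𝔼} (hC : MeasurableSet C) {v : ℝ}
    (hv : 0 < v) (θ : SO d) (w : 𝔼) :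
    volume (shape C v θ ∩ {u | u + w ∈ shape C v θ}) =
      ENNReal.ofReal v * volume (C ∩ {u | u + (v ^ (1 / (d : ℝ)))⁻¹ • rotate θ⁻¹ w ∈ C}) := by
  have hm : MeasurableSet {u | u + (v ^ (1 / (d : ℝ)))⁻¹ • rotate θ⁻¹ w ∈ C} :=
    (measurable_id.add_const _) hC
  rw [shape_inter_translate, volume_shape (hC.inter hm) hv]

theorem norm_le_of_mem_shape {C : Set 𝔼} {R : ℝ} (hR : ∀ x ∈ C, ‖x‖ ≤ R) {v : ℝ} (hv : 0 < v)
    {θ : SO d} {u : 𝔼} (hu : u ∈ shape C v θ) : ‖u‖ ≤ R * v ^ (1 / (d : ℝ)) := by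
  have hr : 0 < v ^ (1 / (d : ℝ)) := by positivity
  have h := hR _ hu
  rw [norm_rotate, norm_smul, norm_inv, Real.norm_of_nonneg hr.le, inv_mul_le_iff₀ hr] at h
  linarith

/-- Shapes with orientation `θ` are rotated copies of those with the identity, so the orientation
drops out of volumes. -/
theorem volume_symmDiff_shape (C : Set 𝔼) (hC : MeasurableSet C) (v w : ℝ) (θ : SO d) :
    volume (symmDiff (shape C w θ) (shape C v θ)) =
      volume (symmDiff (shape C w 1) (shape C v 1)) := by
  have h : ∀ v, shape C v θ = rotate θ⁻¹ ⁻¹' shape C v 1 := fun v => by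
    ext u
    simp [shape, rotate_one, rotate_smul]
  rw [h, h, ← preimage_symmDiff]
  exact (measurePreserving_rotate θ⁻¹).measure_preimage
    ((measurableSet_shape hC _ _).symmDiff (measurableSet_shape hC _ _)).nullMeasurableSet

/-- Outside the null set of points rescaled into the boundary of `C`, membership in the shape is
locally constant in the volume; a ball dominates. This is where `|∂C| = 0` enters. -/
theorem tendsto_volume_symmDiff_shape {C : Set 𝔼} (hC : MeasurableSet C)
    (hb : Bornology.IsBounded C) (hfr : volume (frontier C) = 0) {v : ℝ} (hv : 0 < v) :
    Tendsto (fun w => volume (symmDiff (shape C w 1) (shape C v 1))) (𝓝 v) (𝓝 0) := by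
  obtain ⟨R, hR0, hR⟩ : ∃ R, 0 ≤ R ∧ ∀ x ∈ C, ‖x‖ ≤ R := by
    obtain ⟨R, hR⟩ := hb.exists_norm_le
    exact ⟨max R 0, le_max_right _ _, fun x hx => (hR x hx).trans (le_max_left _ _)⟩
  set B := Metric.closedBall (0 : 𝔼) (R * (2 * v) ^ (1 / (d : ℝ))) with hB
  have hsub : ∀ w, 0 < w → w ≤ 2 * v → shape C w 1 ⊆ B := fun w hw hwv u hu => by
    rw [hB, mem_closedBall_zero_iff]
    refine (norm_le_of_mem_shape hR hw hu).trans (mul_le_mul_of_nonneg_left ?_ hR0)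
    exact Real.rpow_le_rpow hw.le hwv (by positivity)
  have hm : ∀ w, MeasurableSet (symmDiff (shape C w 1) (shape C v 1)) := fun w =>
    (measurableSet_shape hC _ _).symmDiff (measurableSet_shape hC _ _)
  have hr : 0 < v ^ (1 / (d : ℝ)) := by positivity
  have h0 : (0 : ℝ≥0∞) = ∫⁻ _ : 𝔼, 0 := by simp
  rw [h0]
  simp_rw [← lintegral_indicator_one (hm _)]
  refine tendsto_lintegral_filter_of_dominated_convergence (B.indicator 1)
    (Eventually.of_forall fun w => measurable_one.indicator (hm w)) ?_ ?_ ?_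
  · filter_upwards [eventually_gt_nhds hv, eventually_lt_nhds (by linarith : v < 2 * v)]
      with w hw hwv
    refine ae_of_all _ fun u => ?_
    refine indicator_le_indicator_of_subset ?_ (fun _ => zero_le) u
    exact (symmDiff_subset_union).trans (union_subset (hsub w hw hwv.le) (hsub v hv (by linarith)))
  · rw [lintegral_indicator_one Metric.isClosed_closedBall.measurableSet]
    exact measure_closedBall_lt_top.ne
  · have hnull : ∀ᵐ u : 𝔼, (v ^ (1 / (d : ℝ)))⁻¹ • u ∉ frontier C := by
      rw [ae_iff]
      simp only [not_not]
      have := Measure.addHaar_preimage_smul (volume : Measure 𝔼) (inv_ne_zero hr.ne') (frontier C)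
      rw [hfr, mul_zero] at this
      exact this
    filter_upwards [hnull] with u hu
    have hcont : Tendsto (fun w : ℝ => (w ^ (1 / (d : ℝ)))⁻¹ • u) (𝓝 v)
        (𝓝 ((v ^ (1 / (d : ℝ)))⁻¹ • u)) := by
      refine Tendsto.smul_const (Tendsto.inv₀ ?_ hr.ne') u
      exact (Real.continuousAt_rpow_const _ _ (Or.inl hv.ne')).tendsto
    have hmem : ∀ w, u ∈ shape C w 1 ↔ (w ^ (1 / (d : ℝ)))⁻¹ • u ∈ C := fun w => by
      simp [shape, rotate_one]
    have hev : ∀ᶠ w in 𝓝 v, (u ∈ shape C w 1 ↔ u ∈ shape C v 1) := by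
      simp_rw [hmem]
      by_cases hint : (v ^ (1 / (d : ℝ)))⁻¹ • u ∈ C
      · have hi : (v ^ (1 / (d : ℝ)))⁻¹ • u ∈ interior C := by
          by_contra h
          exact hu ⟨subset_closure hint, h⟩
        filter_upwards [hcont (isOpen_interior.mem_nhds hi)] with w hw
        exact iff_of_true (interior_subset hw) hint
      · have hi : (v ^ (1 / (d : ℝ)))⁻¹ • u ∈ (closure C)ᶜ := fun h =>
          hu ⟨h, fun h' => hint (interior_subset h')⟩
        filter_upwards [hcont (isClosed_closure.isOpen_compl.mem_nhds hi)] with w hw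
        exact iff_of_false (fun h => hw (subset_closure h)) hint
    refine tendsto_const_nhds.congr' ?_
    filter_upwards [hev] with w hw
    rw [indicator_of_notMem]
    rw [mem_symmDiff, hw]
    tauto

end Grain

/-! ### Signed measures of grains -/

theorem MeasureTheory.SignedMeasure.eq_toReal_sub_toReal {X : Type*} [MeasurableSpace X]
    (φ : SignedMeasure X) {A : Set X} (hA : MeasurableSet A) :
    φ A = (φ.toJordanDecomposition.posPart A).toReal -
      (φ.toJordanDecomposition.negPart A).toReal := by
  conv_lhs => rw [← φ.toSignedMeasure_toJordanDecomposition]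
  simp [JordanDecomposition.toSignedMeasure, Measure.toSignedMeasure_apply_measurable hA,
    Measure.real]

theorem MeasureTheory.SignedMeasure.enorm_apply_le {X : Type*} [MeasurableSpace X]
    (φ : SignedMeasure X) {A : Set X} (hA : MeasurableSet A) :
    ‖φ A‖ₑ ≤ φ.totalVariation A := by
  rw [φ.eq_toReal_sub_toReal hA, SignedMeasure.totalVariation, Measure.add_apply]
  refine enorm_sub_le.trans (add_le_add ?_ ?_) <;>
  · rw [Real.enorm_eq_ofReal ENNReal.toReal_nonneg, ENNReal.ofReal_toReal (measure_ne_top _ _)]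

theorem MeasureTheory.SignedMeasure.enorm_sub_apply_le {X : Type*} [MeasurableSpace X]
    (φ : SignedMeasure X) {A B : Set X} (hA : MeasurableSet A) (hB : MeasurableSet B) :
    ‖φ A - φ B‖ₑ ≤ φ.totalVariation (symmDiff A B) := by
  have h1 : φ A = φ (A ∩ B) + φ (A \ B) := by
    rw [← VectorMeasure.of_union (disjoint_sdiff_inter.symm) (hA.inter hB) (hA.diff hB),
      inter_union_sdiff]
  have h2 : φ B = φ (A ∩ B) + φ (B \ A) := by
    rw [inter_comm, ← VectorMeasure.of_union (disjoint_sdiff_inter.symm) (hB.inter hA) (hB.diff hA),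
      inter_union_sdiff]
  have h3 : φ A - φ B = φ (A \ B) - φ (B \ A) := by rw [h1, h2]; ring
  rw [h3, Set.symmDiff_def, measure_union disjoint_sdiff_sdiff (hB.diff hA)]
  exact enorm_sub_le.trans (add_le_add (φ.enorm_apply_le (hA.diff hB))
    (φ.enorm_apply_le (hB.diff hA)))

section Field

variable {d : ℕ}

local notation "𝔼" => EuclideanSpace ℝ (Fin d)

/-- The `φ`-measure of the grain with location `z.1`, volume `z.2.1` and orientation `z.2.2`. -/
def field (C : Set 𝔼) (φ : SignedMeasure 𝔼) (z : 𝔼 × ℝ × SO d) : ℝ :=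
  φ {y | y - z.1 ∈ shape C z.2.1 z.2.2}

theorem field_eq (C : Set 𝔼) (φ : SignedMeasure 𝔼) {z : 𝔼 × ℝ × SO d} (hv : 0 < z.2.1) :
    φ (grain C z) = field C φ z := by
  rw [grain_eq C hv, field]

/-- The product of Lebesgue measure and Haar measure, for the location and the orientation. -/
def placeMeasure (d : ℕ) : Measure (EuclideanSpace ℝ (Fin d) × SO d) :=
  (volume : Measure (EuclideanSpace ℝ (Fin d))).prod (haarSO d)

instance (d : ℕ) : SigmaFinite (placeMeasure d) := by unfold placeMeasure; infer_instance

theorem measurableSet_grain {C : Set 𝔼} (hC : MeasurableSet C) (z : 𝔼 × ℝ × SO d) :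
    MeasurableSet {y | y - z.1 ∈ shape C z.2.1 z.2.2} :=
  (measurable_id.sub_const _) (measurableSet_shape hC _ _)

theorem measurable_measure_grain {C : Set 𝔼} (hC : MeasurableSet C) (μ : Measure 𝔼) [SFinite μ] :
    Measurable fun z : 𝔼 × ℝ × SO d => μ {y | y - z.1 ∈ shape C z.2.1 z.2.2} :=
  measurable_measure_prodMk_left (measurableSet_shape_prod hC)

theorem measurable_slice (v : ℝ) :
    Measurable fun q : 𝔼 × SO d => (q.1, v, q.2) :=
  measurable_fst.prodMk (measurable_const.prodMk measurable_snd)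

theorem field_eq_sub {C : Set 𝔼} (hC : MeasurableSet C) (φ : SignedMeasure 𝔼)
    (z : 𝔼 × ℝ × SO d) :
    field C φ z =
      (φ.toJordanDecomposition.posPart {y | y - z.1 ∈ shape C z.2.1 z.2.2}).toReal -
      (φ.toJordanDecomposition.negPart {y | y - z.1 ∈ shape C z.2.1 z.2.2}).toReal :=
  φ.eq_toReal_sub_toReal (measurableSet_grain hC z)

theorem measurable_field {C : Set 𝔼} (hC : MeasurableSet C) (φ : SignedMeasure 𝔼) :
    Measurable (field C φ) := by
  have h : field C φ = fun z => _ := funext (field_eq_sub hC φ)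
  rw [h]
  exact (measurable_measure_grain hC _).ennreal_toReal.sub
    (measurable_measure_grain hC _).ennreal_toReal

theorem enorm_field_le {C : Set 𝔼} (hC : MeasurableSet C) (φ : SignedMeasure 𝔼)
    (z : 𝔼 × ℝ × SO d) :
    ‖field C φ z‖ₑ ≤ φ.totalVariation {y | y - z.1 ∈ shape C z.2.1 z.2.2} :=
  φ.enorm_apply_le (measurableSet_grain hC z)

instance {X : Type*} [MeasurableSpace X] (φ : SignedMeasure X) :
    IsFiniteMeasure φ.totalVariation := by
  unfold SignedMeasure.totalVariation; infer_instance

theorem abs_field_le {C : Set 𝔼} (hC : MeasurableSet C) (φ : SignedMeasure 𝔼)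
    (z : 𝔼 × ℝ × SO d) : |field C φ z| ≤ (φ.totalVariation univ).toReal := by
  have h := (enorm_field_le hC φ z).trans (measure_mono (subset_univ _))
  rw [Real.enorm_eq_ofReal_abs] at h
  exact (ENNReal.ofReal_le_iff_le_toReal (measure_ne_top _ _)).mp h

theorem field_sum (C : Set 𝔼) {ι : Type*} (s : Finset ι) (t : ι → ℝ) (φ : ι → SignedMeasure 𝔼)
    (z : 𝔼 × ℝ × SO d) :
    field C (∑ k ∈ s, t k • φ k) z = ∑ k ∈ s, t k * field C (φ k) z := by
  classical
  induction s using Finset.induction_on with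
  | empty => simp [field]
  | insert a s ha ih =>
    rw [Finset.sum_insert ha, Finset.sum_insert ha, ← ih]
    simp [field]

/-- The linear bound in `v`: each point is covered by grains whose locations fill a set of measure
`v`. -/
theorem lintegral_enorm_field_le [NeZero d] {C : Set 𝔼} (hC : MeasurableSet C)
    (hC1 : volume C = 1) (φ : SignedMeasure 𝔼) {v : ℝ} (hv : 0 < v) :
    ∫⁻ q, ‖field C φ (q.1, v, q.2)‖ₑ ∂(placeMeasure d) ≤
      φ.totalVariation univ * ENNReal.ofReal v := by
  have hm := (measurable_measure_grain hC φ.totalVariation).comp (measurable_slice (d := d) v)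
  calc ∫⁻ q, ‖field C φ (q.1, v, q.2)‖ₑ ∂(placeMeasure d)
      ≤ ∫⁻ q, φ.totalVariation {y | y - q.1 ∈ shape C v q.2} ∂(placeMeasure d) :=
        lintegral_mono fun q => enorm_field_le hC φ (q.1, v, q.2)
    _ = ∫⁻ θ, ∫⁻ x, φ.totalVariation {y | y - x ∈ shape C v θ} ∂volume ∂(haarSO d) :=
        lintegral_prod_symm _ hm.aemeasurable
    _ = φ.totalVariation univ * ENNReal.ofReal v := by
        simp_rw [lintegral_measure_translate (measurableSet_shape hC v _), volume_shape hC hv, hC1]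
        simp

/-- Changing the volume changes the measure of the grain by at most the total variation on a
symmetric difference, whose mean over locations is computed by Fubini. -/
theorem tendsto_lintegral_enorm_field_sub [NeZero d] {C : Set 𝔼} (hC : MeasurableSet C)
    (hb : Bornology.IsBounded C) (hfr : volume (frontier C) = 0) (φ : SignedMeasure 𝔼)
    {v : ℝ} (hv : 0 < v) :
    Tendsto (fun w => ∫⁻ q, ‖field C φ (q.1, w, q.2) - field C φ (q.1, v, q.2)‖ₑ
      ∂(placeMeasure d)) (𝓝 v) (𝓝 0) := by
  have h := ENNReal.Tendsto.const_mul (a := φ.totalVariation univ)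
    (tendsto_volume_symmDiff_shape hC hb hfr hv) (Or.inr (measure_ne_top _ _))
  rw [mul_zero] at h
  refine tendsto_of_tendsto_of_tendsto_of_le_of_le tendsto_const_nhds h (fun _ => zero_le)
    fun w => ?_
  have hS := (measurableSet_shape_prod hC).preimage
    ((measurable_slice (d := d) w).prodMap (measurable_id (α := 𝔼)))
  have hS' := (measurableSet_shape_prod hC).preimage
    ((measurable_slice (d := d) v).prodMap (measurable_id (α := 𝔼)))
  have hm : Measurable fun q : 𝔼 × SO d => φ.totalVariation
      {y | y - q.1 ∈ symmDiff (shape C w q.2) (shape C v q.2)} :=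
    measurable_measure_prodMk_left (hS.symmDiff hS')
  calc ∫⁻ q, ‖field C φ (q.1, w, q.2) - field C φ (q.1, v, q.2)‖ₑ ∂(placeMeasure d)
      ≤ ∫⁻ q, φ.totalVariation {y | y - q.1 ∈ symmDiff (shape C w q.2) (shape C v q.2)}
          ∂(placeMeasure d) :=
        lintegral_mono fun q => φ.enorm_sub_apply_le (measurableSet_grain hC (q.1, w, q.2))
          (measurableSet_grain hC (q.1, v, q.2))
    _ = ∫⁻ θ, ∫⁻ x, φ.totalVariation {y | y - x ∈ symmDiff (shape C w θ) (shape C v θ)}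
          ∂volume ∂(haarSO d) := lintegral_prod_symm _ hm.aemeasurable
    _ = φ.totalVariation univ * volume (symmDiff (shape C w 1) (shape C v 1)) := by
        simp_rw [lintegral_measure_translate
          ((measurableSet_shape hC w _).symmDiff (measurableSet_shape hC v _)),
          volume_symmDiff_shape C hC]
        simp

/-- The second moment is at most the double integral of overlap volumes. If `C` lies in the ball of
radius `R`, an overlap is at most `v` and vanishes for `|y - y'| > 2 R v^{1/d}`, so it is at most `v
(2 R v^{1/d} / |y - y'|)^{(1-α)d}`, a multiple of `v^{2-α}` times the Riesz kernel. -/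
theorem lintegral_enorm_field_sq_le [NeZero d] {C : Set 𝔼} (hC : MeasurableSet C)
    (hC1 : volume C = 1) (hb : Bornology.IsBounded C) {α : ℝ} (hα : α < 1)
    {φ : SignedMeasure 𝔼} (hφ : φ ∈ rieszSpace d α) :
    ∃ K : ℝ≥0, ∀ v > 0, ∫⁻ q, ‖field C φ (q.1, v, q.2)‖ₑ ^ 2 ∂(placeMeasure d) ≤
      K * ENNReal.ofReal (v ^ (2 - α)) := by
  obtain ⟨R, hR0, hR⟩ : ∃ R, 0 < R ∧ ∀ x ∈ C, ‖x‖ ≤ R := by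
    obtain ⟨R, hR⟩ := hb.exists_norm_le
    exact ⟨max R 1, by positivity, fun x hx => (hR x hx).trans (le_max_left _ _)⟩
  have hd : (0 : ℝ) < d := by exact_mod_cast Nat.pos_of_ne_zero (NeZero.ne d)
  set s : ℝ := (1 - α) * d with hs
  have hs0 : 0 < s := mul_pos (by linarith) hd
  set T := φ.totalVariation with hT
  set E := ∫⁻ x, ∫⁻ y, edist x y ^ (-s) ∂T ∂T with hE
  have hEfin : E < ∞ := hφ
  refine ⟨((2 * R) ^ s).toNNReal * E.toNNReal, fun v hv => ?_⟩
  have hpt : ∀ θ : SO d, ∀ y y' : 𝔼,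
      volume (shape C v θ ∩ {u | u + (y' - y) ∈ shape C v θ}) ≤
        ENNReal.ofReal ((2 * R) ^ s * v ^ (2 - α)) * edist y y' ^ (-s) := by
    intro θ y y'
    rcases (shape C v θ ∩ {u | u + (y' - y) ∈ shape C v θ}).eq_empty_or_nonempty with h | h
    · rw [h]; simp
    · obtain ⟨u, hu, hu'⟩ := h
      set r := 2 * R * v ^ (1 / (d : ℝ)) with hr
      have hr0 : 0 < r := by positivity
      have h1 := norm_le_of_mem_shape hR hv hu
      have h2 := norm_le_of_mem_shape hR hv (show u + (y' - y) ∈ shape C v θ from hu')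
      have h3 : edist y y' ≤ ENNReal.ofReal r := by
        rw [edist_dist]
        refine ENNReal.ofReal_le_ofReal ?_
        rw [dist_comm, dist_eq_norm]
        calc ‖y' - y‖ = ‖(u + (y' - y)) - u‖ := by congr 1; abel
          _ ≤ _ := (norm_sub_le _ _).trans (by rw [hr]; linarith)
      have h4 : (1 : ℝ≥0∞) ≤ ENNReal.ofReal (r ^ s) * edist y y' ^ (-s) := by
        rw [ENNReal.rpow_neg, ← div_eq_mul_inv, ← ENNReal.ofReal_rpow_of_pos hr0]
        have h5 := ENNReal.rpow_le_rpow h3 hs0.le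
        rw [ENNReal.le_div_iff_mul_le (Or.inr ?_) (Or.inr ?_), one_mul]
        · exact h5
        · exact (ENNReal.rpow_pos (by simpa using hr0) (by simp)).ne'
        · exact ENNReal.rpow_ne_top_of_nonneg hs0.le (by simp)
      have h6 : (2 * R) ^ s * v ^ (2 - α) = v * r ^ s := by
        rw [hr, Real.mul_rpow (x := 2 * R) (by positivity) (by positivity), ← Real.rpow_mul hv.le]
        have : 1 / (d : ℝ) * s = 1 - α := by rw [hs]; field_simp
        rw [this, show (2 - α : ℝ) = 1 + (1 - α) by ring, Real.rpow_add hv, Real.rpow_one]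
        ring
      calc _ ≤ volume (shape C v θ) := measure_mono inter_subset_left
        _ = ENNReal.ofReal v * 1 := by rw [volume_shape hC hv, hC1]
        _ ≤ ENNReal.ofReal v * (ENNReal.ofReal (r ^ s) * edist y y' ^ (-s)) := by gcongr
        _ = _ := by rw [h6, ENNReal.ofReal_mul hv.le, mul_assoc]
  have hm := (measurable_measure_grain hC T).comp (measurable_slice (d := d) v)
  calc ∫⁻ q, ‖field C φ (q.1, v, q.2)‖ₑ ^ 2 ∂(placeMeasure d)
      ≤ ∫⁻ q, T {y | y - q.1 ∈ shape C v q.2} * T {y | y - q.1 ∈ shape C v q.2}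
          ∂(placeMeasure d) := lintegral_mono fun q => by
        rw [sq]
        exact mul_le_mul' (enorm_field_le hC φ (q.1, v, q.2)) (enorm_field_le hC φ (q.1, v, q.2))
    _ = ∫⁻ θ, ∫⁻ x, T {y | y - x ∈ shape C v θ} * T {y | y - x ∈ shape C v θ}
          ∂volume ∂(haarSO d) := lintegral_prod_symm _ (hm.mul hm).aemeasurable
    _ ≤ ∫⁻ _ : SO d, ENNReal.ofReal ((2 * R) ^ s * v ^ (2 - α)) * E ∂(haarSO d) := by
        refine lintegral_mono fun θ => ?_
        rw [lintegral_measure_translate_mul (measurableSet_shape hC v θ), hE,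
          ← lintegral_const_mul' _ _ ENNReal.ofReal_ne_top]
        refine lintegral_mono fun y => ?_
        rw [← lintegral_const_mul' _ _ ENNReal.ofReal_ne_top]
        exact lintegral_mono fun y' => hpt θ y y'
    _ = _ := by
        rw [lintegral_const, measure_univ, mul_one, ENNReal.ofReal_mul (by positivity),
          ENNReal.coe_mul, ENNReal.coe_toNNReal hEfin.ne]
        change ENNReal.ofReal _ * _ * _ = ENNReal.ofReal _ * _ * _
        ring

theorem enorm_sq_eq_ofReal (x : ℝ) : ‖x‖ₑ ^ 2 = ENNReal.ofReal (x ^ 2) := by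
  rw [Real.enorm_eq_ofReal_abs, ← ENNReal.ofReal_pow (abs_nonneg x), sq_abs]

theorem enorm_add_sq_le (x y : ℝ) : ‖x + y‖ₑ ^ 2 ≤ 2 * (‖x‖ₑ ^ 2 + ‖y‖ₑ ^ 2) := by
  have h2 : (2 : ℝ≥0∞) = ENNReal.ofReal 2 := by simp
  rw [enorm_sq_eq_ofReal, enorm_sq_eq_ofReal, enorm_sq_eq_ofReal, h2,
    ← ENNReal.ofReal_add (sq_nonneg _) (sq_nonneg _), ← ENNReal.ofReal_mul zero_le_two]
  exact ENNReal.ofReal_le_ofReal add_sq_le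

/-- Carries second moment bounds to linear combinations, so that membership of these in the Riesz
space need not be shown. -/
theorem lintegral_enorm_sum_sq_le {X ι : Type*} [MeasurableSpace X] {μ : ℝ → Measure X}
    {f : ι → ℝ → X → ℝ} (hf : ∀ k v, Measurable (f k v)) {b : ℝ → ℝ≥0∞} (s : Finset ι)
    (t : ι → ℝ)
    (h : ∀ k ∈ s, ∃ K : ℝ≥0, ∀ v > 0, ∫⁻ q, ‖f k v q‖ₑ ^ 2 ∂(μ v) ≤ K * b v) :
    ∃ K : ℝ≥0, ∀ v > 0, ∫⁻ q, ‖∑ k ∈ s, t k * f k v q‖ₑ ^ 2 ∂(μ v) ≤ K * b v := by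
  classical
  induction s using Finset.induction_on with
  | empty => exact ⟨0, fun v _ => by simp⟩
  | insert a s ha ih =>
    obtain ⟨K₁, hK₁⟩ := ih fun k hk => h k (Finset.mem_insert_of_mem hk)
    obtain ⟨K₂, hK₂⟩ := h a (Finset.mem_insert_self a s)
    refine ⟨2 * (‖t a‖₊ ^ 2 * K₂) + 2 * K₁, fun v hv => ?_⟩
    calc ∫⁻ q, ‖∑ k ∈ insert a s, t k * f k v q‖ₑ ^ 2 ∂(μ v)
        ≤ ∫⁻ q, 2 * (‖t a‖ₑ ^ 2 * ‖f a v q‖ₑ ^ 2) + 2 * ‖∑ k ∈ s, t k * f k v q‖ₑ ^ 2 ∂(μ v) := by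
          refine lintegral_mono fun q => ?_
          rw [Finset.sum_insert ha, ← mul_pow, ← enorm_mul, ← mul_add]
          exact enorm_add_sq_le _ _
      _ = 2 * (‖t a‖ₑ ^ 2 * ∫⁻ q, ‖f a v q‖ₑ ^ 2 ∂(μ v)) +
            2 * ∫⁻ q, ‖∑ k ∈ s, t k * f k v q‖ₑ ^ 2 ∂(μ v) := by
          rw [lintegral_add_left (by fun_prop (disch := exact hf a v)),
            lintegral_const_mul' _ _ (by simp), lintegral_const_mul' _ _ (by simp),
            lintegral_const_mul' _ _ (by simp)]
      _ ≤ 2 * (‖t a‖ₑ ^ 2 * (K₂ * b v)) + 2 * (K₁ * b v) := by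
          gcongr
          · exact hK₂ v hv
          · exact hK₁ v hv
      _ = _ := by
          push_cast
          rw [← enorm_eq_nnnorm]
          ring

end Field

/-! ### Integration against the intensity measures -/

section Intensity

variable {d : ℕ}

local notation "𝔼" => EuclideanSpace ℝ (Fin d)

/-- Allows location and orientation to be integrated out first, leaving a function of the volume. -/
theorem measurePreserving_rearrange (τ : Measure ℝ) [SigmaFinite τ] :
    MeasurePreserving (fun p : ℝ × (𝔼 × SO d) => (p.2.1, p.1, p.2.2))
      (τ.prod (placeMeasure d)) ((volume : Measure 𝔼).prod (τ.prod (haarSO d))) := by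
  have h1 := (measurePreserving_prodAssoc τ (volume : Measure 𝔼) (haarSO d)).symm
  have h2 : MeasurePreserving (Prod.map Prod.swap (id : SO d → SO d))
      ((τ.prod (volume : Measure 𝔼)).prod (haarSO d))
      (((volume : Measure 𝔼).prod τ).prod (haarSO d)) :=
    Measure.measurePreserving_swap.prod (MeasurePreserving.id _)
  have h3 := measurePreserving_prodAssoc (volume : Measure 𝔼) τ (haarSO d)
  exact h3.comp (h2.comp h1)

theorem lintegral_rearrange (τ : Measure ℝ) [SigmaFinite τ] {g : 𝔼 × ℝ × SO d → ℝ≥0∞}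
    (hg : Measurable g) :
    ∫⁻ z, g z ∂((volume : Measure 𝔼).prod (τ.prod (haarSO d))) =
      ∫⁻ v, ∫⁻ q, g (q.1, v, q.2) ∂(placeMeasure d) ∂τ := by
  have hmp := measurePreserving_rearrange (d := d) τ
  rw [← hmp.lintegral_comp hg]
  exact lintegral_prod _ (hg.comp hmp.measurable).aemeasurable

theorem integral_rearrange (τ : Measure ℝ) [SigmaFinite τ] {g : 𝔼 × ℝ × SO d → ℂ}
    (hg : Integrable g ((volume : Measure 𝔼).prod (τ.prod (haarSO d)))) :
    ∫ z, g z ∂((volume : Measure 𝔼).prod (τ.prod (haarSO d))) =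
      ∫ v, ∫ q, g (q.1, v, q.2) ∂(placeMeasure d) ∂τ := by
  have hmp := measurePreserving_rearrange (d := d) τ
  have hi : Integrable (fun p : ℝ × (𝔼 × SO d) => g (p.2.1, p.1, p.2.2))
      (τ.prod (placeMeasure d)) := by
    rw [← hmp.map_eq] at hg
    exact hg.comp_measurable hmp.measurable
  rw [← integral_prod _ hi, ← hmp.map_eq,
    integral_map hmp.measurable.aemeasurable (by rw [hmp.map_eq]; exact hg.1)]

/-- The measure `v^(-γ-1) dv` on `(0, ∞)`. -/
def powerLaw (γ : ℝ) : Measure ℝ :=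
  (volume.restrict (Ioi (0 : ℝ))).withDensity (fun v => ENNReal.ofReal (v ^ (-γ - 1)))

instance (γ : ℝ) : SigmaFinite (powerLaw γ) := by
  unfold powerLaw
  exact SigmaFinite.withDensity_ofReal _

theorem ae_powerLaw_pos (γ : ℝ) : ∀ᵐ v ∂(powerLaw γ), 0 < v :=
  (withDensity_absolutelyContinuous _ _) (ae_restrict_mem measurableSet_Ioi)

theorem integral_powerLaw {γ : ℝ} (g : ℝ → ℂ) :
    ∫ v, g v ∂(powerLaw γ) = ∫ v in Ioi 0, v ^ (-γ - 1) • g v := by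
  have hm : Measurable fun v : ℝ => v ^ (-γ - 1) := measurable_id.pow_const _
  have h := integral_withDensity_eq_integral_smul (μ := volume.restrict (Ioi (0 : ℝ)))
    (f := fun v : ℝ => (v ^ (-γ - 1)).toNNReal) hm.real_toNNReal g
  refine h.trans (setIntegral_congr_fun measurableSet_Ioi fun v hv => ?_)
  change ((v ^ (-γ - 1)).toNNReal : ℝ) • g v = _
  rw [Real.coe_toNNReal _ (Real.rpow_nonneg (le_of_lt hv) _)]

theorem lintegral_powerLaw {γ : ℝ} {g : ℝ → ℝ≥0∞} (hg : Measurable g) :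
    ∫⁻ v, g v ∂(powerLaw γ) = ∫⁻ v in Ioi 0, ENNReal.ofReal (v ^ (-γ - 1)) * g v :=
  lintegral_withDensity_eq_lintegral_mul _ (by fun_prop) hg

/-- Against `v^{-γ-1} dv`, the power `v^p` is integrable on `(0, 1]` because `p > γ`, and `v` on
`(1, ∞)` because `γ > 1`. -/
theorem lintegral_powerLaw_lt_top {γ p : ℝ} (hγ : 1 < γ) (hp : γ < p) {g : ℝ → ℝ≥0∞}
    (hg : Measurable g) {K₁ K₂ : ℝ≥0} (h1 : ∀ v > 0, g v ≤ K₁ * ENNReal.ofReal (v ^ p))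
    (h2 : ∀ v > 0, g v ≤ K₂ * ENNReal.ofReal v) : ∫⁻ v, g v ∂(powerLaw γ) < ∞ := by
  rw [lintegral_powerLaw hg, ← Ioc_union_Ioi_eq_Ioi zero_le_one,
    lintegral_union measurableSet_Ioi (Ioc_disjoint_Ioi le_rfl)]
  have key : ∀ (K : ℝ≥0) (r : ℝ) (s : Set ℝ), MeasurableSet s → s ⊆ Ioi 0 →
      IntegrableOn (fun v : ℝ => v ^ (-γ - 1 + r)) s →
      (∀ v > 0, g v ≤ K * ENNReal.ofReal (v ^ r)) →
      ∫⁻ v in s, ENNReal.ofReal (v ^ (-γ - 1)) * g v < ∞ := by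
    intro K r s hs hs0 hi hb
    calc ∫⁻ v in s, ENNReal.ofReal (v ^ (-γ - 1)) * g v
        ≤ ∫⁻ v in s, K * ENNReal.ofReal (v ^ (-γ - 1 + r)) := by
          refine setLIntegral_mono' hs fun v hv => ?_
          have hv0 : 0 < v := hs0 hv
          calc _ ≤ ENNReal.ofReal (v ^ (-γ - 1)) * (K * ENNReal.ofReal (v ^ r)) :=
                mul_le_mul_right (hb v hv0) _
            _ = _ := by
                rw [Real.rpow_add hv0, ENNReal.ofReal_mul (by positivity)]
                ring
      _ < ∞ := by
          rw [lintegral_const_mul' _ _ ENNReal.coe_ne_top]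
          refine ENNReal.mul_lt_top ENNReal.coe_lt_top ?_
          refine lt_of_le_of_lt (lintegral_mono fun v => ?_) hi.2
          exact Real.ofReal_le_enorm _
  refine ENNReal.add_lt_top.2 ⟨key K₁ p _ measurableSet_Ioc (fun v hv => hv.1) ?_ h1,
    key K₂ 1 _ measurableSet_Ioi (Ioi_subset_Ioi zero_le_one) ?_ (by simpa using h2)⟩
  · rw [← intervalIntegrable_iff_integrableOn_Ioc_of_le zero_le_one]
    exact intervalIntegral.intervalIntegrable_rpow' (by linarith)
  · exact integrableOn_Ioi_rpow_of_lt (by linarith) zero_lt_one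

theorem limitIntensity_eq (γ : ℝ) : limitIntensity d γ =
    (volume : Measure 𝔼).prod ((powerLaw γ).prod (haarSO d)) := rfl

instance (γ : ℝ) : SigmaFinite (limitIntensity d γ) := by
  rw [limitIntensity_eq]; infer_instance

instance (F : Measure ℝ) [IsProbabilityMeasure F] (ρ : ℝ) :
    IsProbabilityMeasure (scaledLaw F ρ) :=
  Measure.isProbabilityMeasure_map (measurable_const_mul ρ).aemeasurable

instance (lam ρ : ℝ) (F : Measure ℝ) [IsProbabilityMeasure F] :
    SigmaFinite (grainIntensity d lam ρ F) := by
  have h : SigmaFinite (lam.toNNReal •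
      (volume : Measure 𝔼).prod ((scaledLaw F ρ).prod (haarSO d))) := inferInstance
  exact h

theorem ae_pos_of_ae {τ : Measure ℝ} [SigmaFinite τ] (h : ∀ᵐ v ∂τ, 0 < v) :
    ∀ᵐ z ∂((volume : Measure 𝔼).prod (τ.prod (haarSO d))), 0 < z.2.1 := by
  have h2 : ∀ᵐ y ∂(τ.prod (haarSO d)), 0 < y.1 := Measure.quasiMeasurePreserving_fst.ae h
  exact Measure.quasiMeasurePreserving_snd.ae h2

theorem ae_limitIntensity_pos (γ : ℝ) : ∀ᵐ z ∂(limitIntensity d γ), 0 < z.2.1 :=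
  ae_pos_of_ae (ae_powerLaw_pos γ)

theorem ae_scaledLaw_pos {F : Measure ℝ} (hF : F (Iic 0) = 0) {ρ : ℝ} (hρ : 0 < ρ) :
    ∀ᵐ v ∂(scaledLaw F ρ), 0 < v := by
  rw [scaledLaw, ae_map_iff (measurable_const_mul ρ).aemeasurable measurableSet_Ioi]
  have h : ∀ᵐ v ∂F, v ∉ Iic (0 : ℝ) := measure_eq_zero_iff_ae_notMem.1 hF
  filter_upwards [h] with v hv
  exact mul_pos hρ (not_le.1 hv)

theorem ae_grainIntensity_pos {F : Measure ℝ} [IsProbabilityMeasure F] (hF : F (Iic 0) = 0)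
    (lam : ℝ) {ρ : ℝ} (hρ : 0 < ρ) : ∀ᵐ z ∂(grainIntensity d lam ρ F), 0 < z.2.1 :=
  Measure.ae_smul_measure (ae_pos_of_ae (ae_scaledLaw_pos hF hρ)) _

theorem tail_scaledLaw_one (F : Measure ℝ) {ρ : ℝ} (hρ : 0 < ρ) :
    tail (scaledLaw F ρ) 1 = tail F (1 / ρ) := by
  rw [tail, tail, scaledLaw, measureReal_def, measureReal_def,
    Measure.map_apply (measurable_const_mul ρ) measurableSet_Ioi]
  congr 2
  ext v
  simp only [mem_preimage, mem_Ioi]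
  rw [div_lt_iff₀ hρ, mul_comm]

theorem lintegral_grainIntensity {F : Measure ℝ} [IsProbabilityMeasure F] (lam ρ : ℝ)
    {g : 𝔼 × ℝ × SO d → ℝ≥0∞} (hg : Measurable g) :
    ∫⁻ z, g z ∂(grainIntensity d lam ρ F) =
      ENNReal.ofReal lam * ∫⁻ v, ∫⁻ q, g (q.1, ρ * v, q.2) ∂(placeMeasure d) ∂F := by
  have hm : Measurable fun p : ℝ × (𝔼 × SO d) => g (p.2.1, p.1, p.2.2) := hg.comp (by fun_prop)
  rw [grainIntensity, lintegral_smul_measure, lintegral_rearrange _ hg, scaledLaw,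
    lintegral_map hm.lintegral_prod_right' (measurable_const_mul ρ), smul_eq_mul]

theorem integral_grainIntensity {F : Measure ℝ} [IsProbabilityMeasure F] {lam : ℝ}
    (hlam : 0 < lam) (ρ : ℝ) {g : 𝔼 × ℝ × SO d → ℂ} (hg : Measurable g)
    (hgi : Integrable g (grainIntensity d lam ρ F)) :
    ∫ z, g z ∂(grainIntensity d lam ρ F) =
      lam • ∫ v, ∫ q, g (q.1, ρ * v, q.2) ∂(placeMeasure d) ∂F := by
  have hm : StronglyMeasurable fun p : ℝ × (𝔼 × SO d) => g (p.2.1, p.1, p.2.2) :=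
    (hg.comp (by fun_prop)).stronglyMeasurable
  have hgi' : Integrable g
      ((volume : Measure 𝔼).prod ((scaledLaw F ρ).prod (haarSO d))) :=
    (integrable_smul_measure (by simpa using hlam) ENNReal.ofReal_ne_top).1 hgi
  rw [grainIntensity, integral_smul_measure, integral_rearrange _ hgi', scaledLaw,
    integral_map (measurable_const_mul ρ).aemeasurable
      hm.integral_prod_right'.aestronglyMeasurable, ENNReal.toReal_ofReal hlam.le]

theorem integral_limitIntensity {γ : ℝ} {g : 𝔼 × ℝ × SO d → ℂ}
    (hgi : Integrable g (limitIntensity d γ)) :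
    ∫ z, g z ∂(limitIntensity d γ) =
      ∫ v in Ioi 0, v ^ (-γ - 1) • ∫ q, g (q.1, v, q.2) ∂(placeMeasure d) := by
  rw [limitIntensity_eq] at hgi ⊢
  rw [integral_rearrange _ hgi, integral_powerLaw]

theorem integrable_field [NeZero d] {C : Set 𝔼} (hC : MeasurableSet C) (hC1 : volume C = 1)
    {F : Measure ℝ} [IsProbabilityMeasure F] (hF : F (Iic 0) = 0) (hF1 : ∫ v, v ∂F = 1)
    (lam : ℝ) {ρ : ℝ} (hρ : 0 < ρ) (φ : SignedMeasure 𝔼) :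
    Integrable (field C φ) (grainIntensity d lam ρ F) := by
  have hi : Integrable (fun v : ℝ => v) F := by
    -- The integral of a non-integrable function has the default value 0, so mean 1 already forces
    -- integrability.
    by_contra h
    rw [integral_undef h] at hF1
    exact zero_ne_one hF1
  have hpos : ∀ᵐ v ∂F, v ∉ Iic (0 : ℝ) := measure_eq_zero_iff_ae_notMem.1 hF
  refine ⟨(measurable_field hC φ).aestronglyMeasurable, ?_⟩
  rw [HasFiniteIntegral, lintegral_grainIntensity _ _ (measurable_field hC φ).enorm]
  refine ENNReal.mul_lt_top ENNReal.ofReal_lt_top ?_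
  calc ∫⁻ v, ∫⁻ q, ‖field C φ (q.1, ρ * v, q.2)‖ₑ ∂(placeMeasure d) ∂F
      ≤ ∫⁻ v, φ.totalVariation univ * ‖ρ * v‖ₑ ∂F := by
        refine lintegral_mono_ae ?_
        filter_upwards [hpos] with v hv
        refine (lintegral_enorm_field_le hC hC1 φ (mul_pos hρ (not_le.1 hv))).trans ?_
        gcongr
        exact Real.ofReal_le_enorm _
    _ = φ.totalVariation univ * ∫⁻ v, ‖ρ * v‖ₑ ∂F :=
        lintegral_const_mul' _ _ (measure_ne_top _ _)
    _ < ∞ := ENNReal.mul_lt_top (measure_lt_top _ _) (hi.const_mul ρ).2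

/-- With `|f| ≤ B` one has `f² ≤ B |f|`, so a linear bound on the first moment gives one on the
second. This is the bound used for large volumes. -/
theorem lintegral_enorm_sq_le_of_abs_le {f : 𝔼 × ℝ × SO d → ℝ} {B K : ℝ≥0}
    (hB : ∀ z, ‖f z‖ₑ ≤ B) {v : ℝ}
    (h : ∫⁻ q, ‖f (q.1, v, q.2)‖ₑ ∂(placeMeasure d) ≤ K * ENNReal.ofReal v) :
    ∫⁻ q, ‖f (q.1, v, q.2)‖ₑ ^ 2 ∂(placeMeasure d) ≤ (B * K : ℝ≥0) * ENNReal.ofReal v := by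
  calc ∫⁻ q, ‖f (q.1, v, q.2)‖ₑ ^ 2 ∂(placeMeasure d)
      ≤ ∫⁻ q, B * ‖f (q.1, v, q.2)‖ₑ ∂(placeMeasure d) :=
        lintegral_mono fun q => by rw [sq]; exact mul_le_mul_left (hB _) _
    _ = B * ∫⁻ q, ‖f (q.1, v, q.2)‖ₑ ∂(placeMeasure d) :=
        lintegral_const_mul' _ _ ENNReal.coe_ne_top
    _ ≤ B * (K * ENNReal.ofReal v) := by gcongr
    _ = _ := by rw [ENNReal.coe_mul, mul_assoc]

theorem lintegral_enorm_field_sq_le_linear [NeZero d] {C : Set 𝔼} (hC : MeasurableSet C)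
    (hC1 : volume C = 1) (φ : SignedMeasure 𝔼) {v : ℝ} (hv : 0 < v) :
    ∫⁻ q, ‖field C φ (q.1, v, q.2)‖ₑ ^ 2 ∂(placeMeasure d) ≤
      ((φ.totalVariation univ).toNNReal * (φ.totalVariation univ).toNNReal : ℝ≥0) *
        ENNReal.ofReal v := by
  refine lintegral_enorm_sq_le_of_abs_le (fun z => ?_) ?_
  · rw [ENNReal.coe_toNNReal (measure_ne_top _ _)]
    exact (enorm_field_le hC φ z).trans (measure_mono (subset_univ _))
  · rw [ENNReal.coe_toNNReal (measure_ne_top _ _)]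
    exact lintegral_enorm_field_le hC hC1 φ hv

theorem memLp_field_limitIntensity [NeZero d] {C : Set 𝔼} (hC : MeasurableSet C)
    (hC1 : volume C = 1) {γ p : ℝ} (hγ : 1 < γ) (hp : γ < p) {φ : SignedMeasure 𝔼} {K : ℝ≥0}
    (h2 : ∀ v > 0, ∫⁻ q, ‖field C φ (q.1, v, q.2)‖ₑ ^ 2 ∂(placeMeasure d) ≤
      K * ENNReal.ofReal (v ^ p)) :
    MemLp (field C φ) 2 (limitIntensity d γ) := by
  refine ⟨(measurable_field hC φ).aestronglyMeasurable, ?_⟩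
  have hm := measurable_field hC φ
  have hm2 : Measurable fun p : ℝ × (𝔼 × SO d) => ‖field C φ (p.2.1, p.1, p.2.2)‖ₑ ^ 2 :=
    (hm.comp (by fun_prop)).enorm.pow_const 2
  rw [eLpNorm_lt_top_iff_lintegral_rpow_enorm_lt_top two_ne_zero ENNReal.ofNat_ne_top]
  simp only [ENNReal.toReal_ofNat, ENNReal.rpow_ofNat]
  rw [limitIntensity_eq, lintegral_rearrange _ (hm.enorm.pow_const 2)]
  exact lintegral_powerLaw_lt_top hγ hp hm2.lintegral_prod_right' h2
    fun v hv => lintegral_enorm_field_sq_le_linear hC hC1 φ hv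

/-! ### The characteristic functional of the grain field -/

theorem ae_integrable_grain [NeZero d] {C : Set 𝔼} {F : Measure ℝ} [IsProbabilityMeasure F]
    {lam ρ : ℝ} {Ω : Type*} [MeasurableSpace Ω] {P : Measure Ω}
    {N : Ω → Measure (𝔼 × ℝ × SO d)}
    (hC : MeasurableSet C) (hC1 : volume C = 1) (hF : F (Iic 0) = 0) (hF1 : ∫ v, v ∂F = 1)
    (hρ : 0 < ρ) (hN : IsPoissonRandomMeasure N (grainIntensity d lam ρ F) P)
    (φ : SignedMeasure 𝔼) :
    ∀ᵐ ω ∂P, Integrable (fun z => φ (grain C z)) (N ω) := by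
  have h0 := hN.ae_integrable (measurable_field hC φ) (integrable_field hC hC1 hF hF1 lam hρ φ)
  have h0' := hN.ae_ae (ae_grainIntensity_pos (d := d) hF lam hρ)
  filter_upwards [h0, h0'] with ω h1 h2
  refine h1.congr ?_
  filter_upwards [h2] with z hz
  exact (field_eq C φ hz).symm

theorem grainField_ae_eq [NeZero d] {C : Set 𝔼} {F : Measure ℝ} [IsProbabilityMeasure F]
    {lam ρ : ℝ} {Ω : Type*} [MeasurableSpace Ω] {P : Measure Ω}
    {N : Ω → Measure (𝔼 × ℝ × SO d)}
    (hF : F (Iic 0) = 0) (hρ : 0 < ρ) (hN : IsPoissonRandomMeasure N (grainIntensity d lam ρ F) P)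
    (φ : SignedMeasure 𝔼) :
    grainField C N φ =ᵐ[P] fun ω => ∫ z, field C φ z ∂(N ω) := by
  have h0 := hN.ae_ae (ae_grainIntensity_pos (d := d) hF lam hρ)
  filter_upwards [h0] with ω h
  refine integral_congr_ae ?_
  filter_upwards [h] with z hz
  exact field_eq C φ hz

theorem integrable_grainField [NeZero d] {C : Set 𝔼} {F : Measure ℝ} [IsProbabilityMeasure F]
    {lam ρ : ℝ} {Ω : Type*} [MeasurableSpace Ω] {P : Measure Ω}
    {N : Ω → Measure (𝔼 × ℝ × SO d)}
    (hC : MeasurableSet C) (hC1 : volume C = 1) (hF : F (Iic 0) = 0) (hF1 : ∫ v, v ∂F = 1)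
    (hρ : 0 < ρ) (hN : IsPoissonRandomMeasure N (grainIntensity d lam ρ F) P)
    (φ : SignedMeasure 𝔼) : Integrable (grainField C N φ) P :=
  (hN.integrable_integral (measurable_field hC φ)
    (integrable_field hC hC1 hF hF1 lam hρ φ)).congr
    (grainField_ae_eq (C := C) hF hρ hN φ).symm

theorem centredField_ae_eq [NeZero d] {C : Set 𝔼} {F : Measure ℝ} [IsProbabilityMeasure F]
    {lam ρ : ℝ} {Ω : Type*} [MeasurableSpace Ω] {P : Measure Ω}
    {N : Ω → Measure (𝔼 × ℝ × SO d)}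
    (hC : MeasurableSet C) (hC1 : volume C = 1) (hF : F (Iic 0) = 0) (hF1 : ∫ v, v ∂F = 1)
    (hρ : 0 < ρ) (hN : IsPoissonRandomMeasure N (grainIntensity d lam ρ F) P)
    (φ : SignedMeasure 𝔼) :
    centredField C N P φ =ᵐ[P] compensated N (grainIntensity d lam ρ F) (field C φ) := by
  have h := grainField_ae_eq (C := C) hF hρ hN φ
  filter_upwards [h] with ω hω
  rw [centredField, hω, integral_congr_ae h,
    hN.integral_integral (measurable_field hC φ) (integrable_field hC hC1 hF hF1 lam hρ φ),
    compensated]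

theorem aemeasurable_centredField [NeZero d] {C : Set 𝔼} {F : Measure ℝ} [IsProbabilityMeasure F]
    {lam ρ : ℝ} {Ω : Type*} [MeasurableSpace Ω] {P : Measure Ω}
    {N : Ω → Measure (𝔼 × ℝ × SO d)}
    (hC : MeasurableSet C) (hC1 : volume C = 1) (hF : F (Iic 0) = 0) (hF1 : ∫ v, v ∂F = 1)
    (hρ : 0 < ρ) (hN : IsPoissonRandomMeasure N (grainIntensity d lam ρ F) P)
    (φ : SignedMeasure 𝔼) :
    AEMeasurable (centredField C N P φ) P := by
  have h := (integrable_grainField hC hC1 hF hF1 hρ hN φ).1.aemeasurable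
  exact h.sub_const _

/-- The field is linear in the signed measure, so a joint characteristic function is that of the
single measure `∑ k, t k • φ k`. -/
theorem integral_exp_sum_centredField [NeZero d] {C : Set 𝔼} {F : Measure ℝ} [IsProbabilityMeasure F]
    {lam ρ : ℝ} {Ω : Type*} [MeasurableSpace Ω] {P : Measure Ω}
    {N : Ω → Measure (𝔼 × ℝ × SO d)} [IsProbabilityMeasure P]
    (hC : MeasurableSet C) (hC1 : volume C = 1) (hF : F (Iic 0) = 0) (hF1 : ∫ v, v ∂F = 1)
    (hρ : 0 < ρ) (hN : IsPoissonRandomMeasure N (grainIntensity d lam ρ F) P)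
    {n : ℕ}
    (φ : Fin n → SignedMeasure 𝔼) (t : Fin n → ℝ) (s : ℝ) :
    ∫ ω, Complex.exp (Complex.I * ((∑ k, t k * (centredField C N P (φ k) ω / s) : ℝ) : ℂ)) ∂P =
      Complex.exp (∫ z, expRem (field C (∑ k, t k • φ k) z / s) ∂(grainIntensity d lam ρ F)) := by
  have hm : Measurable fun z => field C (∑ k, t k • φ k) z / s :=
    (measurable_field hC _).div_const s
  have hi := (integrable_field hC hC1 hF hF1 lam hρ (∑ k, t k • φ k)).div_const s
  rw [← hN.integral_exp_compensated hm hi]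
  refine integral_congr_ae ?_
  have h1 : ∀ᵐ ω ∂P, ∀ k, centredField C N P (φ k) ω =
      compensated N (grainIntensity d lam ρ F) (field C (φ k)) ω :=
    ae_all_iff.2 fun k => centredField_ae_eq hC hC1 hF hF1 hρ hN (φ k)
  have h2 : ∀ᵐ ω ∂P, ∀ k, Integrable (field C (φ k)) (N ω) :=
    ae_all_iff.2 fun k => hN.ae_integrable (measurable_field hC (φ k))
      (integrable_field hC hC1 hF hF1 lam hρ (φ k))
  filter_upwards [h1, h2] with ω h1 h2
  congr 3
  simp_rw [h1, compensated, field_sum, Finset.sum_div, mul_div_assoc]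
  rw [integral_finsetSum _ fun k _ => ((h2 k).div_const s).const_mul (t k),
    integral_finsetSum _ fun k _ =>
      ((integrable_field hC hC1 hF hF1 lam hρ (φ k)).div_const s).const_mul (t k),
    ← Finset.sum_sub_distrib]
  refine Finset.sum_congr rfl fun k _ => ?_
  rw [integral_const_mul, integral_const_mul, integral_div, integral_div]
  ring

end Intensity

/-! ### Convergence of the characteristic functionals -/

section RemMean

variable {d : ℕ}

local notation "𝔼" => EuclideanSpace ℝ (Fin d)

/-- The contribution `s² ∫∫ (exp(i f / s) - 1 - i f / s) dx dθ` of the grains of volume `v`. -/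
def remMean (f : 𝔼 × ℝ × SO d → ℝ) (s v : ℝ) : ℂ :=
  (s ^ 2) • ∫ q, expRem (f (q.1, v, q.2) / s) ∂(placeMeasure d)

theorem measurable_remMean {f : 𝔼 × ℝ × SO d → ℝ} (hf : Measurable f) (s : ℝ) :
    Measurable (remMean f s) := by
  have h : StronglyMeasurable fun p : ℝ × (𝔼 × SO d) => expRem (f (p.2.1, p.1, p.2.2) / s) :=
    (measurable_expRem.comp ((hf.comp (by fun_prop)).div_const s)).stronglyMeasurable
  exact (h.integral_prod_right'.measurable).const_smul (s ^ 2)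

/-- The factor `s²` cancels against `‖expRem (f / s)‖ ≤ (f / s)²`, so the bound is uniform in `s`.
-/
theorem norm_remMean_le {f : 𝔼 × ℝ × SO d → ℝ} {s v : ℝ} (hs : 0 < s) {b : ℝ≥0∞} (hb : b ≠ ∞)
    (h : ∫⁻ q, ‖f (q.1, v, q.2)‖ₑ ^ 2 ∂(placeMeasure d) ≤ b) :
    ‖remMean f s v‖ ≤ b.toReal := by
  refine (ENNReal.ofReal_le_iff_le_toReal hb).1 ?_
  rw [ofReal_norm]
  refine le_trans ?_ h
  rw [remMean, enorm_smul]
  calc ‖s ^ 2‖ₑ * ‖∫ q, expRem (f (q.1, v, q.2) / s) ∂(placeMeasure d)‖ₑ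
      ≤ ‖s ^ 2‖ₑ * ∫⁻ q, ‖expRem (f (q.1, v, q.2) / s)‖ₑ ∂(placeMeasure d) := by
        gcongr; exact enorm_integral_le_lintegral_enorm _
    _ = ∫⁻ q, ‖s ^ 2‖ₑ * ‖expRem (f (q.1, v, q.2) / s)‖ₑ ∂(placeMeasure d) :=
        (lintegral_const_mul' _ _ enorm_ne_top).symm
    _ ≤ _ := by
        refine lintegral_mono fun q => ?_
        rw [enorm_sq_eq_ofReal, ← enorm_smul, ← ofReal_norm]
        refine ENNReal.ofReal_le_ofReal ?_
        rw [norm_smul, Real.norm_of_nonneg (sq_nonneg s)]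
        calc s ^ 2 * _ ≤ s ^ 2 * (f (q.1, v, q.2) / s) ^ 2 := by
              gcongr; exact norm_expRem_le_sq _
          _ = f (q.1, v, q.2) ^ 2 := by field_simp

variable [NeZero d] {C : Set (EuclideanSpace ℝ (Fin d))}

theorem integrable_slice_field (hC : MeasurableSet C) (hC1 : volume C = 1) (φ : SignedMeasure 𝔼)
    {v : ℝ} (hv : 0 < v) : Integrable (fun q : 𝔼 × SO d => field C φ (q.1, v, q.2))
      (placeMeasure d) :=
  ⟨((measurable_field hC φ).comp (measurable_slice v)).aestronglyMeasurable,
    (lintegral_enorm_field_le hC hC1 φ hv).trans_lt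
      (ENNReal.mul_lt_top (measure_lt_top _ _) ENNReal.ofReal_lt_top)⟩

/-- Continuity in the volume with a modulus independent of `s`, so that `s` and the volume may vary
together. -/
theorem norm_remMean_sub_le (hC : MeasurableSet C) (hC1 : volume C = 1) (φ : SignedMeasure 𝔼)
    {s u v : ℝ} (hs : 0 < s) (hu : 0 < u) (hv : 0 < v) :
    ‖remMean (field C φ) s u - remMean (field C φ) s v‖ ≤
      2 * (φ.totalVariation univ).toReal *
        ∫ q, |field C φ (q.1, u, q.2) - field C φ (q.1, v, q.2)| ∂(placeMeasure d) := by
  set B := (φ.totalVariation univ).toReal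
  have hB : ∀ z, |field C φ z| ≤ B := abs_field_le hC φ
  have hiu := integrable_slice_field hC hC1 φ hu
  have hiv := integrable_slice_field hC hC1 φ hv
  rw [remMean, remMean, ← smul_sub, ← integral_sub (integrable_expRem (hiu.div_const s))
    (integrable_expRem (hiv.div_const s)), norm_smul, Real.norm_of_nonneg (sq_nonneg s),
    ← integral_const_mul]
  calc _ ≤ s ^ 2 * ∫ q, ((s ^ 2)⁻¹ * (2 * B *
        |field C φ (q.1, u, q.2) - field C φ (q.1, v, q.2)|)) ∂(placeMeasure d) := by
        refine mul_le_mul_of_nonneg_left ?_ (sq_nonneg s)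
        refine norm_integral_le_of_norm_le (((hiu.sub hiv).abs.const_mul _).const_mul _)
          (ae_of_all _ fun q => ?_)
        refine (norm_expRem_sub_le_mul_add _ _).trans ?_
        rw [← sub_div, abs_div, abs_div, abs_div, abs_of_pos hs, ← add_div]
        have h1 := hB (q.1, u, q.2)
        have h2 := hB (q.1, v, q.2)
        set a := field C φ (q.1, u, q.2)
        set b := field C φ (q.1, v, q.2)
        have h3 : |a - b| / s * ((|a| + |b|) / s) = (s ^ 2)⁻¹ * ((|a| + |b|) * |a - b|) := by
          field_simp
        rw [h3]
        gcongr
        linarith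
    _ = _ := by
        rw [integral_const_mul, ← mul_assoc, mul_inv_cancel₀ (by positivity), one_mul]

theorem tendsto_remMean_sub (hC : MeasurableSet C) (hC1 : volume C = 1)
    (hb : Bornology.IsBounded C) (hfr : volume (frontier C) = 0) (φ : SignedMeasure 𝔼)
    {ι : Type*} {l : Filter ι} {s u : ι → ℝ} {v : ℝ} (hs : ∀ᶠ i in l, 0 < s i) (hv : 0 < v)
    (hu : Tendsto u l (𝓝 v)) :
    Tendsto (fun i => remMean (field C φ) (s i) (u i) - remMean (field C φ) (s i) v) l (𝓝 0) := by
  have h0 := (ENNReal.tendsto_toReal ENNReal.zero_ne_top).comp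
    ((tendsto_lintegral_enorm_field_sub hC hb hfr φ hv).comp hu)
  have h1 := h0.const_mul (2 * (φ.totalVariation univ).toReal)
  rw [ENNReal.toReal_zero, mul_zero] at h1
  refine squeeze_zero_norm' ?_ h1
  filter_upwards [hs, hu.eventually (eventually_gt_nhds hv)] with i hi hui
  refine (norm_remMean_sub_le hC hC1 φ hi hui hv).trans (le_of_eq ?_)
  congr 1
  exact integral_norm_eq_lintegral_enorm ((integrable_slice_field hC hC1 φ hui).sub
    (integrable_slice_field hC hC1 φ hv)).1

theorem integrable_slice_field_sq (hC : MeasurableSet C) (hC1 : volume C = 1)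
    (φ : SignedMeasure 𝔼) {v : ℝ} (hv : 0 < v) :
    Integrable (fun q : 𝔼 × SO d => field C φ (q.1, v, q.2) ^ 2) (placeMeasure d) := by
  refine ((integrable_slice_field hC hC1 φ hv).norm.const_mul
    (φ.totalVariation univ).toReal).mono'
    (((measurable_field hC φ).comp (measurable_slice v)).pow_const 2).aestronglyMeasurable
    (ae_of_all _ fun q => ?_)
  rw [Real.norm_of_nonneg (sq_nonneg _), Real.norm_eq_abs, ← sq_abs, sq]
  exact mul_le_mul_of_nonneg_right (abs_field_le hC φ _) (abs_nonneg _)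

/-- Beyond the quadratic term the error is at most `s² |f / s|³ ≤ B f² / s`, where `B` is the total
mass bounding `|f|`. -/
theorem tendsto_remMean_atTop (hC : MeasurableSet C) (hC1 : volume C = 1) (φ : SignedMeasure 𝔼)
    {ι : Type*} {l : Filter ι} {s : ι → ℝ} (hs : Tendsto s l atTop) {v : ℝ} (hv : 0 < v) :
    Tendsto (fun i => remMean (field C φ) (s i) v) l
      (𝓝 (-((∫ q, field C φ (q.1, v, q.2) ^ 2 ∂(placeMeasure d)) / 2 : ℝ))) := by
  have hi := integrable_slice_field hC hC1 φ hv
  have hi2 := integrable_slice_field_sq hC hC1 φ hv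
  set B := (φ.totalVariation univ).toReal
  set J := ∫ q, B * field C φ (q.1, v, q.2) ^ 2 ∂(placeMeasure d)
  rw [tendsto_iff_norm_sub_tendsto_zero]
  have h1 : Tendsto (fun i => (s i)⁻¹ * J) l (𝓝 0) := by
    simpa using (tendsto_inv_atTop_zero.comp hs).mul_const J
  refine squeeze_zero' (Eventually.of_forall fun _ => norm_nonneg _) ?_ h1
  filter_upwards [hs.eventually_gt_atTop 0] with i hi0
  have hi2' : Integrable (fun q : 𝔼 × SO d =>
      (((field C φ (q.1, v, q.2) / s i) ^ 2 / 2 : ℝ) : ℂ)) (placeMeasure d) := by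
    refine Integrable.ofReal ?_
    simp_rw [div_pow]
    exact (hi2.div_const _).div_const _
  have h2 : -(((∫ q, field C φ (q.1, v, q.2) ^ 2 ∂(placeMeasure d)) / 2 : ℝ) : ℂ) =
      -((s i ^ 2) • ∫ q, (((field C φ (q.1, v, q.2) / s i) ^ 2 / 2 : ℝ) : ℂ)
        ∂(placeMeasure d)) := by
    rw [integral_complex_ofReal, Complex.real_smul, ← Complex.ofReal_mul]
    congr 2
    simp_rw [div_pow]
    rw [integral_div, integral_div]
    field_simp
  rw [h2, remMean, sub_neg_eq_add, ← smul_add,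
    ← integral_add (integrable_expRem (hi.div_const _)) hi2', norm_smul,
    Real.norm_of_nonneg (sq_nonneg _)]
  calc _ ≤ s i ^ 2 * ∫ q, (s i ^ 3)⁻¹ * (B * field C φ (q.1, v, q.2) ^ 2) ∂(placeMeasure d) := by
        refine mul_le_mul_of_nonneg_left ?_ (sq_nonneg _)
        refine norm_integral_le_of_norm_le ((hi2.const_mul _).const_mul _)
          (ae_of_all _ fun q => ?_)
        refine (norm_expRem_add_le_cube _).trans ?_
        rw [abs_div, abs_of_pos hi0, div_pow, div_eq_inv_mul]
        gcongr
        rw [pow_succ', sq_abs]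
        gcongr
        exact abs_field_le hC φ _
    _ = _ := by
        have e : s i ^ 2 * (s i ^ 3)⁻¹ = (s i)⁻¹ := by field_simp
        rw [integral_const_mul (s i ^ 3)⁻¹, ← mul_assoc, e]

/-- The common core of the large-grain and intermediate regimes: regular variation with `y = 1 / ρ`,
applied to the mean remainder per volume. The regimes differ only in the normalisation `s` and the
pointwise limit `g₀`. -/
theorem tendsto_integral_expRem_grainIntensity (hC : MeasurableSet C) (hC1 : volume C = 1)
    (hb : Bornology.IsBounded C) (hfr : volume (frontier C) = 0)
    {F : Measure ℝ} [IsProbabilityMeasure F] (hF0 : F (Iic 0) = 0) (hF1 : ∫ v, v ∂F = 1)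
    {γ p : ℝ} (hγ : 1 < γ) (hF : HasRegularlyVaryingTail F γ) (hp : γ < p)
    {φ : SignedMeasure 𝔼} {K : ℝ≥0}
    (h2 : ∀ v > 0, ∫⁻ q, ‖field C φ (q.1, v, q.2)‖ₑ ^ 2 ∂(placeMeasure d) ≤
      K * ENNReal.ofReal (v ^ p))
    {ι : Type*} {l : Filter ι} [l.IsCountablyGenerated] {lam ρ s : ι → ℝ}
    (hlam : ∀ i, 0 < lam i) (hρ : ∀ i, 0 < ρ i) (hρ0 : Tendsto ρ l (𝓝 0))
    (hs : ∀ᶠ i in l, 0 < s i) {c : ℝ}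
    (hc : Tendsto (fun i => lam i * tail (scaledLaw F (ρ i)) 1 / s i ^ 2) l (𝓝 c))
    {g₀ : ℝ → ℂ}
    (hg : ∀ v > 0, Tendsto (fun i => remMean (field C φ) (s i) v) l (𝓝 (g₀ v))) :
    Tendsto (fun i => ∫ z, expRem (field C φ z / s i) ∂(grainIntensity d (lam i) (ρ i) F)) l
      (𝓝 (c • ∫ v in Ioi 0, (γ * v ^ (-γ - 1)) • g₀ v)) := by
  set B := (φ.totalVariation univ).toNNReal
  have hy : Tendsto (fun i => 1 / ρ i) l atTop := by
    simp_rw [one_div]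
    exact tendsto_inv_nhdsGT_zero.comp
      (tendsto_nhdsWithin_iff.2 ⟨hρ0, Eventually.of_forall hρ⟩)
  have hm := measurable_field hC φ
  have main := hF.tendsto_integral hF0 hγ (p := p) (K := max (K : ℝ) (B * B : ℝ≥0)) hp hy
    (g := fun i => remMean (field C φ) (s i)) (g₀ := g₀) (fun i => measurable_remMean hm _) ?_ ?_
  · refine (hc.smul main).congr' ?_
    filter_upwards [hs] with i hi
    have hfi := (integrable_field hC hC1 hF0 hF1 (lam i) (hρ i) φ).div_const (s i)
    have hme : Measurable fun z => expRem (field C φ z / s i) :=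
      measurable_expRem.comp (hm.div_const _)
    rw [integral_grainIntensity (hlam i) _ hme (integrable_expRem hfi), tail_scaledLaw_one F (hρ i), smul_smul]
    have htp : 0 < tail F (1 / ρ i) := hF.tail_pos _
    have e1 : lam i * tail F (1 / ρ i) / s i ^ 2 * (tail F (1 / ρ i))⁻¹ =
        lam i * (s i ^ 2)⁻¹ := by field_simp
    rw [e1, mul_smul, ← integral_smul]
    congr 2
    ext v
    rw [remMean, smul_smul, inv_mul_cancel₀ (by positivity), one_smul,
      show v / (1 / ρ i) = ρ i * v by rw [div_div_eq_mul_div, div_one, mul_comm]]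
  · filter_upwards [hs] with i hi v hv
    constructor
    · refine (norm_remMean_le hi ?_ (h2 v hv)).trans ?_
      · exact ENNReal.mul_ne_top ENNReal.coe_ne_top ENNReal.ofReal_ne_top
      · rw [ENNReal.toReal_mul, ENNReal.coe_toReal,
          ENNReal.toReal_ofReal (Real.rpow_nonneg hv.le _)]
        gcongr
        exact le_max_left _ _
    · refine (norm_remMean_le hi ?_ (lintegral_enorm_field_sq_le_linear hC hC1 φ hv)).trans ?_
      · exact ENNReal.mul_ne_top ENNReal.coe_ne_top ENNReal.ofReal_ne_top
      · rw [ENNReal.toReal_mul, ENNReal.coe_toReal, ENNReal.toReal_ofReal hv.le]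
        gcongr
        exact le_max_right _ _
  · intro v hv u hu
    have h := (tendsto_remMean_sub hC hC1 hb hfr φ hs hv hu).add (hg v hv)
    simpa using h

end RemMean

/-! ### The intermediate limit -/

theorem lintegral_Ioi_comp_mul_left {r : ℝ} (hr : 0 < r) {g : ℝ → ℝ≥0∞} (hg : Measurable g) :
    ∫⁻ v in Ioi 0, g (r * v) = ENNReal.ofReal r⁻¹ * ∫⁻ v in Ioi 0, g v := by
  have hm := hg.indicator (measurableSet_Ioi (a := (0 : ℝ)))
  have h1 : ENNReal.ofReal r⁻¹ • (volume : Measure ℝ) = Measure.map (fun v => r * v) volume := by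
    rw [Real.map_volume_mul_left hr.ne', abs_of_pos (inv_pos.2 hr)]
  rw [← lintegral_indicator measurableSet_Ioi, ← lintegral_indicator measurableSet_Ioi,
    ← smul_eq_mul, ← lintegral_smul_measure, h1, lintegral_map hm (measurable_const_mul r)]
  refine lintegral_congr fun v => ?_
  simp only [indicator, mem_Ioi, mul_pos_iff_of_pos_left hr]

/-- Homogeneity: the density contributes `r^{γ+1}` and the change of variables `r^{-1}`. -/
theorem map_mul_left_powerLaw (γ : ℝ) {r : ℝ} (hr : 0 < r) :
    (powerLaw γ).map (fun v => r * v) = ENNReal.ofReal (r ^ γ) • powerLaw γ := by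
  refine Measure.ext_of_lintegral _ fun f hf => ?_
  have hp : Measurable fun v : ℝ => ENNReal.ofReal (v ^ (-γ - 1)) := by fun_prop
  have hfr : Measurable fun v => f (r * v) := hf.comp (measurable_const_mul r)
  rw [lintegral_map hf (measurable_const_mul r), lintegral_smul_measure, lintegral_powerLaw hf,
    lintegral_powerLaw hfr, smul_eq_mul]
  have h := lintegral_Ioi_comp_mul_left hr (hp.mul hf)
  have h2 : ∫⁻ v in Ioi 0, ENNReal.ofReal (v ^ (-γ - 1)) * f (r * v) =
      ENNReal.ofReal (r ^ (γ + 1)) * ∫⁻ v in Ioi 0, ENNReal.ofReal ((r * v) ^ (-γ - 1)) *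
        f (r * v) := by
    rw [← lintegral_const_mul' _ _ ENNReal.ofReal_ne_top]
    refine setLIntegral_congr_fun measurableSet_Ioi fun v hv => ?_
    have hv' : (0 : ℝ) < v := hv
    rw [← mul_assoc, ← ENNReal.ofReal_mul (by positivity), Real.mul_rpow hr.le hv'.le, ← mul_assoc,
      ← Real.rpow_add hr]
    norm_num
  refine h2.trans ?_
  refine (congrArg _ h).trans ?_
  rw [← mul_assoc, ← ENNReal.ofReal_mul (by positivity), ← Real.rpow_neg_one, ← Real.rpow_add hr]
  norm_num

section Intermediate

variable {d : ℕ}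

local notation "𝔼" => EuclideanSpace ℝ (Fin d)

/-- The dilation of locations by `s` and, accordingly, of volumes by `s^d`. -/
def dilation (s : ℝ) (z : 𝔼 × ℝ × SO d) : 𝔼 × ℝ × SO d := (s • z.1, s ^ d * z.2.1, z.2.2)

theorem measurable_dilation (s : ℝ) : Measurable (dilation (d := d) s) :=
  (measurable_fst.const_smul s).prodMk
    (((measurable_fst.comp measurable_snd).const_mul _).prodMk (measurable_snd.comp measurable_snd))

/-- Scaling volumes by `s^d` contributes `s^{dγ}` and scaling locations by `s` contributes `s^{-d}`.
-/
theorem map_dilation_limitIntensity {s : ℝ} (hs : 0 < s) (γ : ℝ) :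
    (limitIntensity d γ).map (dilation s) =
      ENNReal.ofReal (s ^ (((γ - 1) * d : ℝ))) • limitIntensity d γ := by
  have h1 : dilation (d := d) s = Prod.map (fun x => s • x) (Prod.map (fun v => s ^ d * v) id) :=
    rfl
  have hsd : 0 < s ^ d := by positivity
  rw [h1, limitIntensity_eq, ← Measure.map_prod_map _ _ (measurable_const_smul s)
    ((measurable_const_mul (s ^ d)).prodMap measurable_id),
    ← Measure.map_prod_map _ _ (measurable_const_mul (s ^ d)) measurable_id,
    map_mul_left_powerLaw γ hsd, Measure.map_id, Measure.map_addHaar_smul _ hs.ne']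
  simp only [Measure.prod_smul_left, Measure.prod_smul_right, smul_smul]
  congr 1
  rw [finrank_euclideanSpace_fin, abs_of_pos (inv_pos.2 hsd), ← ENNReal.ofReal_mul (by positivity)]
  congr 1
  rw [← Real.rpow_natCast, ← Real.rpow_mul hs.le, ← Real.rpow_neg hs.le, ← Real.rpow_add hs]
  congr 1
  ring

variable {C : Set (EuclideanSpace ℝ (Fin d))}

theorem dilate_grain [NeZero d] (hC : MeasurableSet C) {s : ℝ} (hs : 0 < s) (φ : SignedMeasure 𝔼)
    {z : 𝔼 × ℝ × SO d} (hz : 0 < z.2.1) :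
    dilate s φ (grain C z) = field C φ (dilation s z) := by
  have hm : Measurable fun x : 𝔼 => s⁻¹ • x := measurable_const_smul _
  rw [grain_eq C hz, dilate, VectorMeasure.map_apply _ hm (measurableSet_grain hC z), field]
  congr 1
  ext y
  have h1 : (s ^ d * z.2.1) ^ (1 / (d : ℝ)) = s * z.2.1 ^ (1 / (d : ℝ)) := by
    rw [Real.mul_rpow (by positivity) hz.le, one_div, Real.pow_rpow_inv_natCast hs.le (NeZero.ne d)]
  have h2 : s⁻¹ • y - z.1 = s⁻¹ • (y - s • z.1) := by
    rw [smul_sub, smul_smul, inv_mul_cancel₀ hs.ne', one_smul]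
  simp only [mem_preimage, mem_ofPred_eq, shape, dilation, h1, h2, smul_smul, mul_inv_rev]

theorem exists_lintegral_sum_sq_le [NeZero d] (hC : MeasurableSet C)
    (hC1 : volume C = 1)
    (hb : Bornology.IsBounded C) {α : ℝ} (hα : α < 1) {n : ℕ} {φ : Fin n → SignedMeasure 𝔼}
    (hφ : ∀ k, φ k ∈ rieszSpace d α) (t : Fin n → ℝ) :
    ∃ K : ℝ≥0, ∀ v > 0, ∫⁻ q, ‖field C (∑ k, t k • φ k) (q.1, v, q.2)‖ₑ ^ 2 ∂(placeMeasure d) ≤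
      K * ENNReal.ofReal (v ^ (2 - α)) := by
  simp_rw [field_sum]
  exact lintegral_enorm_sum_sq_le (μ := fun _ => placeMeasure d)
    (f := fun k v q => field C (φ k) (q.1, v, q.2)) (b := fun v => ENNReal.ofReal (v ^ (2 - α)))
    (fun k v => (measurable_field hC (φ k)).comp (measurable_slice v)) Finset.univ t
    fun k _ => lintegral_enorm_field_sq_le hC hC1 hb hα (hφ k)

theorem memLp_field_of_mem_rieszSpace [NeZero d] (hC : MeasurableSet C)
    (hC1 : volume C = 1)
    (hb : Bornology.IsBounded C) {γ α : ℝ} (hγ : 1 < γ) (hα : α < 2 - γ) {φ : SignedMeasure 𝔼}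
    (hφ : φ ∈ rieszSpace d α) : MemLp (field C φ) 2 (limitIntensity d γ) := by
  obtain ⟨K, hK⟩ := lintegral_enorm_field_sq_le hC hC1 hb (by linarith) hφ
  exact memLp_field_limitIntensity hC hC1 hγ (by linarith) hK

theorem memLp_field_dilation {γ : ℝ} {φ : SignedMeasure 𝔼} {s : ℝ}
    (hs : 0 < s) (h : MemLp (field C φ) 2 (limitIntensity d γ)) :
    MemLp (fun z => field C φ (dilation s z)) 2 (limitIntensity d γ) := by
  have h1 := h.smul_measure (c := ENNReal.ofReal (s ^ (((γ - 1) * d : ℝ)))) ENNReal.ofReal_ne_top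
  rw [← map_dilation_limitIntensity hs γ] at h1
  exact h1.comp_of_map (measurable_dilation s).aemeasurable

theorem centredIntegral_dilate_spec [NeZero d] (hC : MeasurableSet C)
    (hC1 : volume C = 1)
    (hb : Bornology.IsBounded C) {γ α : ℝ} (hγ : 1 < γ) (hα : α < 2 - γ)
    {Ω : Type*} [MeasurableSpace Ω] {P : Measure Ω} [IsProbabilityMeasure P]
    {N : Ω → Measure (𝔼 × ℝ × SO d)} (hN : IsPoissonRandomMeasure N (limitIntensity d γ) P)
    {s : ℝ} (hs : 0 < s) {φ : SignedMeasure 𝔼} (hφ : φ ∈ rieszSpace d α) :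
    IsCentredIntegral P N (limitIntensity d γ) (fun z => dilate s φ (grain C z))
        (centredIntegral P N (limitIntensity d γ) (fun z => dilate s φ (grain C z))) ∧
      AEStronglyMeasurable
        (centredIntegral P N (limitIntensity d γ) (fun z => dilate s φ (grain C z))) P ∧
      IsL2Centred P N (limitIntensity d γ) (fun z => field C φ (dilation s z))
        (centredIntegral P N (limitIntensity d γ) (fun z => dilate s φ (grain C z))) := by
  refine hN.centredIntegral_spec ?_ ((measurable_field hC φ).comp (measurable_dilation s))
    (memLp_field_dilation hs (memLp_field_of_mem_rieszSpace hC hC1 hb hγ hα hφ))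
  filter_upwards [ae_limitIntensity_pos (d := d) γ] with z hz
  exact dilate_grain hC hs φ hz

theorem integral_expRem_field_dilation (hC : MeasurableSet C) {γ : ℝ} {φ : SignedMeasure 𝔼}
    {s : ℝ} (hs : 0 < s) :
    ∫ z, expRem (field C φ (dilation s z)) ∂(limitIntensity d γ) =
      s ^ (((γ - 1) * d : ℝ)) • ∫ z, expRem (field C φ z) ∂(limitIntensity d γ) := by
  have hm : Measurable fun z => expRem (field C φ z) := measurable_expRem.comp (measurable_field hC φ)
  have h := integral_map (μ := limitIntensity d γ) (measurable_dilation s).aemeasurable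
    (f := fun z => expRem (field C φ z)) hm.aestronglyMeasurable
  rw [← h, map_dilation_limitIntensity hs, integral_smul_measure,
    ENNReal.toReal_ofReal (by positivity)]

theorem integral_exp_sum_centredIntegral [NeZero d] (hC : MeasurableSet C)
    (hC1 : volume C = 1)
    (hb : Bornology.IsBounded C) {γ α : ℝ} (hγ : 1 < γ) (hα : α < 2 - γ)
    {Ω : Type*} [MeasurableSpace Ω] {P : Measure Ω} [IsProbabilityMeasure P]
    {N : Ω → Measure (𝔼 × ℝ × SO d)} (hN : IsPoissonRandomMeasure N (limitIntensity d γ) P)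
    {s : ℝ} (hs : 0 < s) {n : ℕ} {φ : Fin n → SignedMeasure 𝔼}
    (hφ : ∀ k, φ k ∈ rieszSpace d α) (t : Fin n → ℝ) :
    ∫ ω, Complex.exp (Complex.I * ((∑ k, t k * centredIntegral P N (limitIntensity d γ)
        (fun z => dilate s (φ k) (grain C z)) ω : ℝ) : ℂ)) ∂P =
      Complex.exp (s ^ (((γ - 1) * d : ℝ)) •
        ∫ z, expRem (field C (∑ k, t k • φ k) z) ∂(limitIntensity d γ)) := by
  have hspec := fun k => centredIntegral_dilate_spec hC hC1 hb hγ hα hN hs (hφ k)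
  have hmem : MemLp (fun z => field C (∑ k, t k • φ k) (dilation s z)) 2 (limitIntensity d γ) := by
    obtain ⟨K, hK⟩ := exists_lintegral_sum_sq_le hC hC1 hb (by linarith) hφ t
    exact memLp_field_dilation hs (memLp_field_limitIntensity hC hC1 hγ (by linarith) hK)
  have hsum := hN.isL2Centred_sum Finset.univ
    (f := fun k z => t k * field C (φ k) (dilation s z))
    (fun k => (((measurable_field hC (φ k)).comp
      (measurable_dilation s)).const_mul (t k)).aestronglyMeasurable)
    (fun k => (hspec k).2.1.const_mul (t k))
    (fun k => IsPoissonRandomMeasure.isL2Centred_const_mul (t k) (hspec k).2.2)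
  simp_rw [← field_sum C Finset.univ t φ] at hsum
  rw [← integral_expRem_field_dilation hC hs]
  refine hN.integral_exp_of_isL2Centred hmem ?_ hsum
  exact Finset.aestronglyMeasurable_fun_sum _ fun k _ => (hspec k).2.1.const_mul (t k)

theorem tendstoFidi_intermediate [NeZero d] (hC : MeasurableSet C)
    (hC1 : volume C = 1)
    (hb : Bornology.IsBounded C) (hfr : volume (frontier C) = 0)
    {F : Measure ℝ} [IsProbabilityMeasure F] (hF0 : F (Iic 0) = 0) (hF1 : ∫ v, v ∂F = 1)
    {γ α : ℝ} (hγ : 1 < γ) (hF : HasRegularlyVaryingTail F γ) (hα : α < 2 - γ)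
    {ι : Type*} {l : Filter ι} [l.IsCountablyGenerated] {lam ρ : ι → ℝ}
    (hlam : ∀ i, 0 < lam i) (hρ : ∀ i, 0 < ρ i) (hρ0 : Tendsto ρ l (𝓝 0))
    {Ω : ι → Type*} [∀ i, MeasurableSpace (Ω i)] {P : (i : ι) → Measure (Ω i)}
    [∀ i, IsProbabilityMeasure (P i)] {N : (i : ι) → Ω i → Measure (𝔼 × ℝ × SO d)}
    (hN : ∀ i, IsPoissonRandomMeasure (N i) (grainIntensity d (lam i) (ρ i) F) (P i))
    {Ω' : Type*} [MeasurableSpace Ω'] {P' : Measure Ω'} [IsProbabilityMeasure P']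
    {σ₀ : ℝ} (hσ₀ : 0 < σ₀)
    (hc : Tendsto (fun i => lam i * tail (scaledLaw F (ρ i)) 1) l (𝓝 σ₀))
    {Nγ : Ω' → Measure (𝔼 × ℝ × SO d)} (hNγ : IsPoissonRandomMeasure Nγ (limitIntensity d γ) P') :
    TendstoFidi (rieszSpace d α) (fun i φ ω => centredField C (N i) (P i) φ ω) l
      (fun φ => centredIntegral P' Nγ (limitIntensity d γ)
        (fun z => dilate ((γ * σ₀) ^ (1 / ((γ - 1) * d))) φ (grain C z))) P P' := by
  intro n φ hφ
  have hd : (0 : ℝ) < d := by exact_mod_cast Nat.pos_of_ne_zero (NeZero.ne d)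
  have hγ0 : 0 < γ - 1 := by linarith
  have hγσ : 0 < γ * σ₀ := by positivity
  have hs : 0 < (γ * σ₀) ^ (1 / ((γ - 1) * d)) := by positivity
  refine tendstoInDistribution_of_tendsto_integral_exp
    (fun i k => aemeasurable_centredField hC hC1 hF0 hF1 (hρ i) (hN i) (φ k))
    (fun k => (centredIntegral_dilate_spec hC hC1 hb hγ hα hNγ hs (hφ k)).2.1.aemeasurable)
    fun t => ?_
  obtain ⟨K, hK⟩ := exists_lintegral_sum_sq_le hC hC1 hb (by linarith) hφ t
  have hmem := memLp_field_limitIntensity (γ := γ) hC hC1 hγ (by linarith) hK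
  rw [integral_exp_sum_centredIntegral hC hC1 hb hγ hα hNγ hs hφ t]
  have key := tendsto_integral_expRem_grainIntensity hC hC1 hb hfr hF0 hF1 hγ hF
    (p := 2 - α) (by linarith) hK hlam hρ hρ0 (s := fun _ => 1)
    (Eventually.of_forall fun _ => one_pos) (c := σ₀) (by simpa using hc)
    (fun v _ => tendsto_const_nhds)
  -- The total factor is `γ σ₀`: `σ₀` from the number of large grains, `γ` from the density `γ
  -- v^{-γ-1}` of the limiting tail `v^{-γ}`. The dilation is the one whose `(γ-1)d`-th power equals
  -- it.
  have e : σ₀ • ∫ v in Ioi 0, (γ * v ^ (-γ - 1)) • remMean (field C (∑ k, t k • φ k)) 1 v =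
      ((γ * σ₀) ^ (1 / ((γ - 1) * d))) ^ ((γ - 1) * d) •
        ∫ z, expRem (field C (∑ k, t k • φ k) z) ∂(limitIntensity d γ) := by
    rw [integral_limitIntensity (integrable_expRem_of_memLp hmem), ← Real.rpow_mul hγσ.le,
      one_div_mul_cancel (by positivity), Real.rpow_one, mul_comm γ, mul_smul]
    simp_rw [mul_smul]
    rw [integral_smul]
    simp [remMean]
  rw [e] at key
  refine ((Complex.continuous_exp.tendsto _).comp key).congr fun i => ?_
  have h := integral_exp_sum_centredField hC hC1 hF0 hF1 (hρ i) (hN i) φ t 1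
  simp only [div_one] at h
  simp only [Function.comp_apply, div_one]
  exact h.symm

end Intermediate

/-! ### The stable characteristic exponent -/

theorem integrable_powerLaw_iff {γ : ℝ} {g : ℝ → ℂ} :
    Integrable g (powerLaw γ) ↔ IntegrableOn (fun v => v ^ (-γ - 1) • g v) (Ioi 0) := by
  have hm : Measurable fun v : ℝ => v ^ (-γ - 1) := measurable_id.pow_const _
  have h := integrable_withDensity_iff_integrable_smul (μ := volume.restrict (Ioi (0 : ℝ)))
    (f := fun v : ℝ => (v ^ (-γ - 1)).toNNReal) hm.real_toNNReal (g := g)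
  refine h.trans ?_
  refine integrableOn_congr_fun (fun v hv => ?_) measurableSet_Ioi
  change ((v ^ (-γ - 1)).toNNReal : ℝ) • g v = _
  rw [Real.coe_toNNReal _ (Real.rpow_nonneg (le_of_lt hv) _)]

theorem integrable_powerLaw_of_norm_le {E : Type*} [NormedAddCommGroup E] [MeasurableSpace E]
    [BorelSpace E] [SecondCountableTopology E] {γ p : ℝ} (hγ : 1 < γ) (hp : γ < p) {g : ℝ → E}
    (hg : Measurable g) {K₁ K₂ : ℝ} (h1 : ∀ v > 0, ‖g v‖ ≤ K₁ * v ^ p)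
    (h2 : ∀ v > 0, ‖g v‖ ≤ K₂ * v) : Integrable g (powerLaw γ) := by
  refine ⟨hg.aestronglyMeasurable, ?_⟩
  refine lintegral_powerLaw_lt_top hγ hp hg.enorm (K₁ := K₁.toNNReal) (K₂ := K₂.toNNReal) ?_ ?_
  · intro v hv
    rw [← ofReal_norm, ENNReal.ofNNReal_toNNReal,
      ← ENNReal.ofReal_mul' (Real.rpow_nonneg (le_of_lt hv) _)]
    exact ENNReal.ofReal_le_ofReal (h1 v hv)
  · intro v hv
    rw [← ofReal_norm, ENNReal.ofNNReal_toNNReal, ← ENNReal.ofReal_mul' (le_of_lt hv)]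
    exact ENNReal.ofReal_le_ofReal (h2 v hv)

theorem integrableOn_rpow_mul_cexp {a : ℝ} (ha : 0 < a) {z : ℂ} (hz : z.re < 0) :
    IntegrableOn (fun v : ℝ => v ^ (a - 1) • Complex.exp (z * v)) (Ioi 0) := by
  have h := integrableOn_rpow_mul_exp_neg_mul_rpow (p := 1) (s := a - 1) (b := -z.re)
    (by linarith) one_pos (by linarith)
  simp only [Real.rpow_one, neg_neg] at h
  refine h.mono' ?_ ((ae_restrict_mem measurableSet_Ioi).mono fun v hv => ?_)
  · have : Measurable fun v : ℝ => v ^ (a - 1) • Complex.exp (z * v) := by fun_prop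
    exact this.aestronglyMeasurable
  · have hv' : (0 : ℝ) < v := hv
    rw [norm_smul, Complex.norm_exp, Real.norm_of_nonneg (by positivity)]
    simp

/-- For negative real `z` this is the Gamma integral. Both sides are analytic in the left
half-plane, the left one as the complex moment generating function of `v^{a-1} dv`, so the identity
theorem extends it. -/
theorem integral_rpow_mul_cexp {a : ℝ} (ha : 0 < a) {z : ℂ} (hz : z.re < 0) :
    ∫ v in Ioi (0 : ℝ), v ^ (a - 1) • Complex.exp (z * v) = Real.Gamma a * (-z) ^ (-(a : ℂ)) := by
  have hform : ∀ w : ℂ, complexMGF id (powerLaw (-a)) w =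
      ∫ v in Ioi (0 : ℝ), v ^ (a - 1) • Complex.exp (w * v) := fun w => by
    rw [complexMGF, integral_powerLaw, neg_neg]
    rfl
  have hset : Iio (0 : ℝ) ⊆ integrableExpSet id (powerLaw (-a)) := fun t ht => by
    have h1 := integrableOn_rpow_mul_cexp ha (z := t) (by simpa using ht)
    have h2 : Integrable (fun v : ℝ => Complex.exp ((t : ℂ) * v)) (powerLaw (-a)) := by
      rw [integrable_powerLaw_iff, neg_neg]
      exact h1
    have h3 := h2.re
    refine h3.congr (ae_of_all _ fun v => ?_)
    change (Complex.exp ((t : ℂ) * v)).re = Real.exp (t * v)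
    rw [← Complex.ofReal_mul, Complex.exp_ofReal_re]
  have hint : Iio (0 : ℝ) ⊆ interior (integrableExpSet id (powerLaw (-a))) :=
    interior_maximal hset isOpen_Iio
  have hf : AnalyticOnNhd ℂ (complexMGF id (powerLaw (-a))) {z : ℂ | z.re < 0} := fun w hw =>
    analyticAt_complexMGF (hint hw)
  have hg : AnalyticOnNhd ℂ (fun z : ℂ => Real.Gamma a * (-z) ^ (-(a : ℂ))) {z : ℂ | z.re < 0} := by
    refine DifferentiableOn.analyticOnNhd (fun w hw => ?_)
      (isOpen_lt Complex.continuous_re continuous_const)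
    refine DifferentiableAt.differentiableWithinAt ?_
    refine DifferentiableAt.const_mul ?_ _
    refine DifferentiableAt.cpow_const differentiableAt_id.neg (Or.inl ?_)
    simpa using hw
  have hfreq : ∃ᶠ w in 𝓝[≠] ((-1 : ℝ) : ℂ), complexMGF id (powerLaw (-a)) w =
      Real.Gamma a * (-w) ^ (-(a : ℂ)) := by
    have ht : Tendsto (fun x : ℝ => (x : ℂ)) (𝓝[≠] (-1)) (𝓝[≠] ((-1 : ℝ) : ℂ)) := by
      refine tendsto_nhdsWithin_iff.2 ⟨?_, ?_⟩
      · exact (Complex.continuous_ofReal.tendsto _).mono_left nhdsWithin_le_nhds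
      · filter_upwards [self_mem_nhdsWithin] with x hx
        exact fun h => hx (Complex.ofReal_injective h)
    refine ht.frequently (Eventually.frequently ?_)
    have h0 : ∀ᶠ x : ℝ in 𝓝[≠] (-1), x < 0 :=
      (eventually_lt_nhds (by norm_num)).filter_mono nhdsWithin_le_nhds
    filter_upwards [h0] with x hx
    have h1 := Complex.integral_cpow_mul_exp_neg_mul_Ioi (a := a) (r := -x) (by simpa using ha)
      (by linarith)
    rw [hform, Complex.cpow_neg, ← Complex.ofReal_neg]
    rw [one_div, Complex.inv_cpow _ _ ?_, Complex.Gamma_ofReal, mul_comm] at h1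
    · rw [← h1]
      refine setIntegral_congr_fun measurableSet_Ioi fun v hv => ?_
      have hv' : (0 : ℝ) ≤ v := le_of_lt hv
      simp only [Complex.real_smul, Complex.ofReal_cpow hv']
      simp
    · rw [Complex.arg_ofReal_of_nonneg (by linarith)]
      exact Real.pi_pos.ne
  have hpre : IsPreconnected {z : ℂ | z.re < 0} := (convex_halfSpace_re_lt 0).isPreconnected
  have h := hf.eqOn_of_preconnected_of_frequently_eq hg hpre (z₀ := ((-1 : ℝ) : ℂ))
    (by simp) hfreq hz
  rw [← hform]
  exact h

theorem norm_exp_sub_one_sub_le_sq {z : ℂ} (hz : z.re ≤ 0) :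
    ‖Complex.exp z - 1 - z‖ ≤ ‖z‖ ^ 2 := by
  have hconv : Convex ℝ ({w : ℂ | w.re ≤ 0} ∩ Metric.closedBall 0 ‖z‖) :=
    (convex_halfSpace_re_le 0).inter (convex_closedBall _ _)
  have h := hconv.norm_image_sub_le_of_norm_hasDerivWithin_le (C := ‖z‖)
    (f := fun w => Complex.exp w - 1 - w) (f' := fun w => Complex.exp w - 1) (x := 0) (y := z)
    (fun w _ => (((Complex.hasDerivAt_exp w).sub_const 1).sub (hasDerivAt_id w)).hasDerivWithinAt)
    (fun w hw => ?_) (by simp) (by simpa using hz)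
  · simpa [sq] using h
  · rw [norm_sub_rev]
    exact (norm_one_sub_exp_le hw.1).trans (by simpa using hw.2)

theorem norm_exp_sub_one_sub_le_two_mul {z : ℂ} (hz : z.re ≤ 0) :
    ‖Complex.exp z - 1 - z‖ ≤ 2 * ‖z‖ := by
  refine (norm_sub_le _ _).trans ?_
  rw [norm_sub_rev]
  linarith [norm_one_sub_exp_le hz]

theorem integrable_powerLaw_exp {γ : ℝ} (hγ : γ ∈ Ioo (1 : ℝ) 2) {z : ℂ} (hz : z.re ≤ 0) :
    Integrable (fun v : ℝ => Complex.exp (z * v) - 1 - z * v) (powerLaw γ) := by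
  have hre : ∀ v : ℝ, v > 0 → (z * v).re ≤ 0 := fun v hv => by
    simpa using mul_nonpos_of_nonpos_of_nonneg hz (le_of_lt hv)
  have hn : ∀ v : ℝ, v > 0 → ‖z * v‖ = ‖z‖ * v := fun v hv => by
    rw [norm_mul, Complex.norm_real, Real.norm_of_nonneg (le_of_lt hv)]
  refine integrable_powerLaw_of_norm_le hγ.1 (p := 2) hγ.2 (by fun_prop) (K₁ := ‖z‖ ^ 2)
    (K₂ := 2 * ‖z‖) (fun v hv => ?_) fun v hv => ?_
  · refine (norm_exp_sub_one_sub_le_sq (hre v hv)).trans (le_of_eq ?_)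
    rw [hn v hv, mul_pow, Real.rpow_two]
  · refine (norm_exp_sub_one_sub_le_two_mul (hre v hv)).trans (le_of_eq ?_)
    rw [hn v hv, mul_assoc]

/-- Two integrations by parts lower the singularity from `v^{-γ-1}` to `v^{1-γ}`, where the Gamma
integral applies. They are packaged in the boundary function `G`, whose derivative is the difference
of the two integrands. -/
theorem integral_powerLaw_exp {γ : ℝ} (hγ : γ ∈ Ioo (1 : ℝ) 2) {z : ℂ} (hz : z.re < 0) :
    ∫ v, (Complex.exp (z * v) - 1 - z * v) ∂(powerLaw γ) =
      ((Real.Gamma (2 - γ) / (γ * (γ - 1)) : ℝ) : ℂ) * (z ^ 2 * (-z) ^ ((γ - 2 : ℝ) : ℂ)) := by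
  obtain ⟨hγ1, hγ2⟩ := hγ
  have hγ0 : 0 < γ := by linarith
  have hγ3 : 0 < γ - 1 := by linarith
  have hre : ∀ v : ℝ, 0 < v → (z * v).re ≤ 0 := fun v hv => by
    simpa using mul_nonpos_of_nonpos_of_nonneg hz.le (le_of_lt hv)
  have hn : ∀ v : ℝ, 0 < v → ‖z * v‖ = ‖z‖ * v := fun v hv => by
    rw [norm_mul, Complex.norm_real, Real.norm_of_nonneg (le_of_lt hv)]
  have hE2 : ∀ v : ℝ, 0 < v → ‖Complex.exp (z * v) - 1 - z * v‖ ≤ (‖z‖ * v) ^ 2 := fun v hv =>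
    hn v hv ▸ norm_exp_sub_one_sub_le_sq (hre v hv)
  have hE1 : ∀ v : ℝ, 0 < v → ‖Complex.exp (z * v) - 1 - z * v‖ ≤ 2 * (‖z‖ * v) := fun v hv =>
    hn v hv ▸ norm_exp_sub_one_sub_le_two_mul (hre v hv)
  have hF1 : ∀ v : ℝ, 0 < v → ‖Complex.exp (z * v) - 1‖ ≤ ‖z‖ * v := fun v hv => by
    rw [← hn v hv, norm_sub_rev]; exact norm_one_sub_exp_le (hre v hv)
  have hF0 : ∀ v : ℝ, 0 < v → ‖Complex.exp (z * v) - 1‖ ≤ 2 := fun v hv => by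
    refine (norm_sub_le _ _).trans ?_
    have : ‖Complex.exp (z * v)‖ ≤ 1 := by
      rw [Complex.norm_exp]; exact Real.exp_le_one_iff.2 (hre v hv)
    rw [norm_one]; linarith
  set E : ℝ → ℂ := fun v => Complex.exp (z * v) - 1 - z * v with hE
  set D : ℝ → ℂ := fun v => Complex.exp (z * v) - 1 with hD
  set c : ℝ := (γ * (γ - 1))⁻¹ with hc
  set G : ℝ → ℂ := fun v => -(γ⁻¹ • (v ^ (-γ) • E v)) - c • (v ^ (1 - γ) • (z * D v)) with hG
  set f₁ : ℝ → ℂ := fun v => v ^ (-γ - 1) • E v with hf₁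
  set f₂ : ℝ → ℂ := fun v => v ^ ((2 - γ) - 1) • Complex.exp (z * v) with hf₂
  have hi1 : IntegrableOn f₁ (Ioi 0) :=
    integrable_powerLaw_iff.1 (integrable_powerLaw_exp ⟨hγ1, hγ2⟩ hz.le)
  have hi2 : IntegrableOn f₂ (Ioi 0) := integrableOn_rpow_mul_cexp (by linarith) hz
  have hderiv : ∀ v ∈ Ioi (0 : ℝ), HasDerivAt G (f₁ v - (c : ℂ) * z ^ 2 * f₂ v) v := by
    intro v hv
    have hv' : (0 : ℝ) < v := hv
    have hz1 : HasDerivAt (fun v : ℝ => z * (v : ℂ)) z v := by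
      simpa using (Complex.ofRealCLM.hasDerivAt (x := v)).const_mul z
    have hDd : HasDerivAt D (Complex.exp (z * v) * z) v := (hz1.cexp).sub_const 1
    have hEd : HasDerivAt E (Complex.exp (z * v) * z - z) v := hDd.sub hz1
    have hp1 : HasDerivAt (fun v : ℝ => v ^ (-γ)) (-γ * v ^ (-γ - 1)) v :=
      Real.hasDerivAt_rpow_const (Or.inl hv'.ne')
    have hp2 : HasDerivAt (fun v : ℝ => v ^ (1 - γ)) ((1 - γ) * v ^ (1 - γ - 1)) v :=
      Real.hasDerivAt_rpow_const (Or.inl hv'.ne')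
    have h1 := ((hp1.smul hEd).const_smul γ⁻¹).neg.sub
      ((hp2.smul (hDd.const_mul z)).const_smul c)
    refine h1.congr_deriv ?_
    simp only [hf₁, hf₂, hE, hD, Complex.real_smul, hc]
    have e1 : (2 - γ) - 1 = 1 - γ := by ring
    have e2 : 1 - γ - 1 = -γ := by ring
    rw [e1, e2]
    have hγC : (γ : ℂ) ≠ 0 := by exact_mod_cast hγ0.ne'
    have hγC1 : (γ : ℂ) - 1 ≠ 0 := by exact_mod_cast hγ3.ne'
    push_cast
    field_simp
    ring
  -- At 0 the bounds `‖E v‖ ≤ (‖z‖ v)²` and `‖D v‖ ≤ ‖z‖ v` give `G = O(v^{2-γ})`; at infinity a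
  -- linear bound on `E` and a constant bound on `D` give `G = O(v^{1-γ})`. Both vanish for `1 < γ <
  -- 2`.
  have hcont : ContinuousWithinAt G (Ici 0) 0 := by
    have hG0 : G 0 = 0 := by
      simp [hG, hE, hD]
    rw [ContinuousWithinAt, hG0]
    have hlim : Tendsto (fun v : ℝ => (γ⁻¹ * ‖z‖ ^ 2 + c * ‖z‖ ^ 2) * v ^ (2 - γ)) (𝓝[Ici 0] 0)
        (𝓝 0) := by
      have h := (Real.continuousAt_rpow_const (0 : ℝ) (2 - γ) (Or.inr (by linarith))).tendsto
      rw [Real.zero_rpow (by linarith)] at h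
      simpa using (h.mono_left (nhdsWithin_le_nhds (s := Ici 0))).const_mul
        (γ⁻¹ * ‖z‖ ^ 2 + c * ‖z‖ ^ 2)
    refine squeeze_zero_norm' ?_ hlim
    filter_upwards [self_mem_nhdsWithin] with v hv
    rcases (show (0 : ℝ) ≤ v from hv).eq_or_lt with h0 | hv'
    · rw [← h0, hG0, norm_zero, Real.zero_rpow (by linarith), mul_zero]
    · have hc0 : 0 < c := by positivity
      refine (norm_sub_le _ _).trans ?_
      rw [norm_neg, norm_smul, norm_smul, norm_smul, norm_smul, norm_mul,
        Real.norm_of_nonneg (by positivity), Real.norm_of_nonneg (by positivity),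
        Real.norm_of_nonneg hc0.le, Real.norm_of_nonneg (by positivity)]
      have e1 : v ^ (2 - γ) = v ^ (-γ) * v ^ 2 := by
        rw [← Real.rpow_natCast v 2, ← Real.rpow_add hv']; congr 1; push_cast; ring
      have e2 : v ^ (2 - γ) = v ^ (1 - γ) * v := by
        rw [← Real.rpow_add_one hv'.ne']; congr 1; ring
      calc γ⁻¹ * (v ^ (-γ) * ‖E v‖) + c * (v ^ (1 - γ) * (‖z‖ * ‖D v‖))
          ≤ γ⁻¹ * (v ^ (-γ) * (‖z‖ * v) ^ 2) + c * (v ^ (1 - γ) * (‖z‖ * (‖z‖ * v))) := by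
            gcongr
            · exact hE2 v hv'
            · exact hF1 v hv'
        _ = γ⁻¹ * ‖z‖ ^ 2 * (v ^ (-γ) * v ^ 2) + c * ‖z‖ ^ 2 * (v ^ (1 - γ) * v) := by ring
        _ = _ := by rw [← e1, ← e2]; ring
  have hinf : Tendsto G atTop (𝓝 0) := by
    have hlim : Tendsto (fun v : ℝ => (γ⁻¹ * (2 * ‖z‖) + c * (‖z‖ * 2)) * v ^ (-(γ - 1))) atTop
        (𝓝 0) := by
      simpa using (tendsto_rpow_neg_atTop hγ3).const_mul (γ⁻¹ * (2 * ‖z‖) + c * (‖z‖ * 2))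
    refine squeeze_zero_norm' ?_ hlim
    filter_upwards [eventually_gt_atTop 0] with v hv'
    have hc0 : 0 < c := by positivity
    refine (norm_sub_le _ _).trans ?_
    rw [norm_neg, norm_smul, norm_smul, norm_smul, norm_smul, norm_mul,
      Real.norm_of_nonneg (by positivity), Real.norm_of_nonneg (by positivity),
      Real.norm_of_nonneg hc0.le, Real.norm_of_nonneg (by positivity)]
    have e1 : v ^ (1 - γ) = v ^ (-γ) * v := by
      rw [← Real.rpow_add_one hv'.ne']; congr 1; ring
    have e2 : v ^ (-(γ - 1)) = v ^ (1 - γ) := by congr 1; ring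
    calc γ⁻¹ * (v ^ (-γ) * ‖E v‖) + c * (v ^ (1 - γ) * (‖z‖ * ‖D v‖))
        ≤ γ⁻¹ * (v ^ (-γ) * (2 * (‖z‖ * v))) + c * (v ^ (1 - γ) * (‖z‖ * 2)) := by
          gcongr
          · exact hE1 v hv'
          · exact hF0 v hv'
      _ = γ⁻¹ * (2 * ‖z‖) * (v ^ (-γ) * v) + c * (‖z‖ * 2) * v ^ (1 - γ) := by ring
      _ = _ := by rw [← e1, e2]; ring
  have hG0 : G 0 = 0 := by simp [hG, hE, hD]
  have key := integral_Ioi_of_hasDerivAt_of_tendsto hcont hderiv (hi1.sub (hi2.const_mul _)) hinf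
  rw [hG0, sub_zero, integral_sub hi1 (hi2.const_mul _), sub_eq_zero, integral_const_mul,
    integral_rpow_mul_cexp (by linarith) hz] at key
  rw [integral_powerLaw]
  refine key.trans ?_
  rw [hc]
  push_cast
  rw [neg_sub]
  ring

/-- The boundary case `z = i` of the half-plane formula, reached from `z = -ε + i` by dominated
convergence; the value comes from the principal branch, `log (-i) = -iπ/2`. -/
theorem integral_expRem_powerLaw {γ : ℝ} (hγ : γ ∈ Ioo (1 : ℝ) 2) :
    ∫ v, expRem v ∂(powerLaw γ) =
      ((Real.Gamma (2 - γ) / (γ * (γ - 1)) * Real.cos (Real.pi * γ / 2) : ℝ) : ℂ) *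
        (1 - Complex.I * ((Real.tan (Real.pi * γ / 2) : ℝ) : ℂ)) := by
  have hl : Tendsto (fun ε : ℝ => ∫ v, (Complex.exp ((-ε + Complex.I) * v) - 1 -
      (-ε + Complex.I) * v) ∂(powerLaw γ)) (𝓝[>] 0) (𝓝 (∫ v, expRem v ∂(powerLaw γ))) := by
    refine tendsto_integral_filter_of_dominated_convergence
      -- For `0 < ε < 1` one has `‖-ε + i‖ ≤ 2`, so the quadratic and linear bounds hold with
      -- constant 4, uniformly in `ε`.
      (fun v => min (4 * v ^ (2 : ℝ)) (4 * |v|)) ?_ ?_ ?_ ?_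
    · refine Eventually.of_forall fun ε => Measurable.aestronglyMeasurable (by fun_prop)
    · have h1 : ∀ᶠ ε : ℝ in 𝓝[>] 0, ε < 1 :=
        (eventually_lt_nhds one_pos).filter_mono nhdsWithin_le_nhds
      filter_upwards [self_mem_nhdsWithin, h1] with ε hε hε1
      have hε0 : (0 : ℝ) < ε := hε
      filter_upwards [ae_powerLaw_pos γ] with v hv
      have hre : ((-(ε : ℂ) + Complex.I) * v).re ≤ 0 := by
        simp; positivity
      have hn : ‖(-(ε : ℂ) + Complex.I) * v‖ ≤ 2 * v := by
        rw [norm_mul, Complex.norm_real, Real.norm_of_nonneg hv.le]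
        gcongr
        refine (norm_add_le _ _).trans ?_
        rw [norm_neg, Complex.norm_I, Complex.norm_real, Real.norm_of_nonneg hε0.le]
        linarith
      refine le_min ?_ ?_
      · refine (norm_exp_sub_one_sub_le_sq hre).trans ?_
        rw [Real.rpow_two]
        nlinarith [norm_nonneg ((-(ε : ℂ) + Complex.I) * v)]
      · refine (norm_exp_sub_one_sub_le_two_mul hre).trans ?_
        rw [abs_of_pos hv]; linarith
    · refine integrable_powerLaw_of_norm_le hγ.1 (p := 2) hγ.2 (by fun_prop) (K₁ := 4) (K₂ := 4)
        (fun v hv => ?_) fun v hv => ?_ <;>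
      rw [Real.norm_of_nonneg (le_min (by positivity) (by positivity))]
      · exact min_le_left _ _
      · exact (min_le_right _ _).trans (by rw [abs_of_pos hv])
    · refine ae_of_all _ fun v => ?_
      have h : Continuous fun ε : ℝ => Complex.exp ((-(ε : ℂ) + Complex.I) * v) - 1 -
        (-(ε : ℂ) + Complex.I) * v := by fun_prop
      have h2 := (h.tendsto 0).mono_left (nhdsWithin_le_nhds (s := Ioi 0))
      simpa [expRem] using h2
  have hr : Tendsto (fun ε : ℝ => ((Real.Gamma (2 - γ) / (γ * (γ - 1)) : ℝ) : ℂ) *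
      ((-(ε : ℂ) + Complex.I) ^ 2 * (-(-(ε : ℂ) + Complex.I)) ^ ((γ - 2 : ℝ) : ℂ))) (𝓝[>] 0)
      (𝓝 (((Real.Gamma (2 - γ) / (γ * (γ - 1)) : ℝ) : ℂ) *
        (Complex.I ^ 2 * (-Complex.I) ^ ((γ - 2 : ℝ) : ℂ)))) := by
    refine Tendsto.const_mul _ (Tendsto.mul ?_ ?_)
    · have h : Continuous fun ε : ℝ => (-(ε : ℂ) + Complex.I) ^ 2 := by fun_prop
      simpa using (h.tendsto 0).mono_left (nhdsWithin_le_nhds (s := Ioi 0))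
    · have h : ContinuousAt (fun ε : ℝ => (-(-(ε : ℂ) + Complex.I)) ^ ((γ - 2 : ℝ) : ℂ)) 0 := by
        refine ContinuousAt.cpow (by fun_prop) continuousAt_const (Or.inr ?_)
        simp
      simpa using h.tendsto.mono_left (nhdsWithin_le_nhds (s := Ioi 0))
  have heq : ∀ᶠ ε : ℝ in 𝓝[>] 0, ∫ v, (Complex.exp ((-ε + Complex.I) * v) - 1 -
      (-ε + Complex.I) * v) ∂(powerLaw γ) = ((Real.Gamma (2 - γ) / (γ * (γ - 1)) : ℝ) : ℂ) *
      ((-(ε : ℂ) + Complex.I) ^ 2 * (-(-(ε : ℂ) + Complex.I)) ^ ((γ - 2 : ℝ) : ℂ)) := by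
    filter_upwards [self_mem_nhdsWithin] with ε hε
    have hε0 : (0 : ℝ) < ε := hε
    exact integral_powerLaw_exp hγ (by simpa using hε0)
  rw [tendsto_nhds_unique (hl.congr' heq) hr]
  have hcos : Real.cos (Real.pi * γ / 2) ≠ 0 := by
    refine (Real.cos_neg_of_pi_div_two_lt_of_lt ?_ ?_).ne
    · nlinarith [Real.pi_pos, hγ.1]
    · nlinarith [Real.pi_pos, hγ.2]
  have hpow : Complex.I ^ 2 * (-Complex.I) ^ ((γ - 2 : ℝ) : ℂ) =
      Complex.cos ((Real.pi * γ / 2 : ℝ) : ℂ) -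
        Complex.sin ((Real.pi * γ / 2 : ℝ) : ℂ) * Complex.I := by
    rw [Complex.cpow_def_of_ne_zero (by simp), Complex.log_neg_I, Complex.I_sq]
    have e : -((Real.pi : ℂ) / 2) * Complex.I * ((γ - 2 : ℝ) : ℂ) =
        (-((Real.pi * γ / 2 : ℝ) : ℂ)) * Complex.I + Real.pi * Complex.I := by
      push_cast; ring
    rw [e, Complex.exp_add, Complex.exp_pi_mul_I, Complex.exp_mul_I, Complex.cos_neg,
      Complex.sin_neg]
    ring
  rw [hpow, Complex.ofReal_mul, mul_assoc]
  congr 1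
  rw [Real.tan_eq_sin_div_cos]
  push_cast
  have : Complex.cos (Real.pi * γ / 2) ≠ 0 := by exact_mod_cast hcos
  field_simp

theorem expRem_neg (u : ℝ) : expRem (-u) = (starRingEnd ℂ) (expRem u) := by
  simp [expRem, ← Complex.exp_conj]

theorem integral_expRem_mul_powerLaw_of_pos {γ : ℝ} (hγ : γ ∈ Ioo (1 : ℝ) 2) {u : ℝ} (hu : 0 < u) :
    ∫ v, expRem (v * u) ∂(powerLaw γ) = ((u ^ γ : ℝ) : ℂ) *
      (((Real.Gamma (2 - γ) / (γ * (γ - 1)) * Real.cos (Real.pi * γ / 2) : ℝ) : ℂ) *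
        (1 - Complex.I * ((Real.tan (Real.pi * γ / 2) : ℝ) : ℂ))) := by
  have h := integral_map (μ := powerLaw γ) (measurable_const_mul u).aemeasurable
    (f := expRem) measurable_expRem.aestronglyMeasurable
  simp_rw [mul_comm _ u]
  rw [← h, map_mul_left_powerLaw γ hu, integral_smul_measure, ENNReal.toReal_ofReal (by positivity),
    integral_expRem_powerLaw hγ, Complex.real_smul]

/-- Positive `u` scales out as `u^γ`; a negative sign conjugates `expRem`, which reverses only the
tangent term and so produces the skewness. -/
theorem integral_expRem_mul_powerLaw {γ : ℝ} (hγ : γ ∈ Ioo (1 : ℝ) 2) (u : ℝ) :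
    ∫ v, expRem (v * u) ∂(powerLaw γ) =
      ((Real.Gamma (2 - γ) / (γ * (γ - 1)) * Real.cos (Real.pi * γ / 2) : ℝ) : ℂ) *
        ((((max u 0) ^ γ + (-min u 0) ^ γ : ℝ) : ℂ) -
          Complex.I * ((Real.tan (Real.pi * γ / 2) * ((max u 0) ^ γ - (-min u 0) ^ γ) : ℝ) : ℂ)) := by
  have hγ0 : γ ≠ 0 := by linarith [hγ.1]
  rcases lt_trichotomy u 0 with hu | rfl | hu
  · have h := integral_expRem_mul_powerLaw_of_pos hγ (neg_pos.2 hu)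
    have h2 : ∀ v, expRem (v * u) = (starRingEnd ℂ) (expRem (v * -u)) := fun v => by
      rw [← expRem_neg, mul_neg, neg_neg]
    simp_rw [h2]
    rw [integral_conj, h, max_eq_right hu.le, min_eq_left hu.le, Real.zero_rpow hγ0]
    simp only [map_mul, map_sub, Complex.conj_ofReal, map_one, Complex.conj_I]
    push_cast
    ring
  · simp [Real.zero_rpow hγ0]
  · rw [integral_expRem_mul_powerLaw_of_pos hγ hu, max_eq_left hu.le, min_eq_right hu.le, neg_zero,
      Real.zero_rpow hγ0]
    push_cast
    ring

theorem cos_pi_mul_div_two_neg {γ : ℝ} (hγ : γ ∈ Ioo (1 : ℝ) 2) :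
    Real.cos (Real.pi * γ / 2) < 0 := by
  refine Real.cos_neg_of_pi_div_two_lt_of_lt ?_ ?_
  · nlinarith [Real.pi_pos, hγ.1]
  · nlinarith [Real.pi_pos, hγ.2]

theorem neg_gamma_mul_cos_pos {γ : ℝ} (hγ : γ ∈ Ioo (1 : ℝ) 2) :
    0 < -(Real.Gamma (2 - γ) / (γ * (γ - 1)) * Real.cos (Real.pi * γ / 2)) := by
  obtain ⟨h1, h2⟩ := hγ
  have hG : 0 < Real.Gamma (2 - γ) := Real.Gamma_pos_of_pos (by linarith)
  have hd : 0 < γ * (γ - 1) := mul_pos (by linarith) (by linarith)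
  have := mul_neg_of_pos_of_neg (div_pos hG hd) (cos_pi_mul_div_two_neg ⟨h1, h2⟩)
  linarith

theorem stableConst_pos {γ : ℝ} (hγ : γ ∈ Ioo (1 : ℝ) 2) : 0 < stableConst γ :=
  Real.rpow_pos_of_pos (neg_gamma_mul_cos_pos hγ) _

theorem stableConst_rpow {γ : ℝ} (hγ : γ ∈ Ioo (1 : ℝ) 2) : stableConst γ ^ γ =
    -(Real.Gamma (2 - γ) / (γ * (γ - 1)) * Real.cos (Real.pi * γ / 2)) := by
  have hγ0 : γ ≠ 0 := by linarith [hγ.1]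
  rw [stableConst, ← Real.rpow_mul (neg_gamma_mul_cos_pos hγ).le, one_div_mul_cancel hγ0,
    Real.rpow_one]

/-- The constant `c_γ` is chosen so that `c_γ^γ` cancels the Gamma-cosine factor. The cosine is
negative for `1 < γ < 2`, whence the minus sign. -/
theorem integral_expRem_mul_div_stableConst {γ : ℝ} (hγ : γ ∈ Ioo (1 : ℝ) 2) (u : ℝ) :
    ∫ v, expRem (v * (u / stableConst γ)) ∂(powerLaw γ) =
      -((((max u 0) ^ γ + (-min u 0) ^ γ : ℝ) : ℂ) -
        Complex.I * ((Real.tan (Real.pi * γ / 2) * ((max u 0) ^ γ - (-min u 0) ^ γ) : ℝ) : ℂ)) := by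
  have hc := stableConst_pos hγ
  have hcγ := stableConst_rpow hγ
  have hcp : 0 < stableConst γ ^ γ := Real.rpow_pos_of_pos hc _
  have e1 : max (u / stableConst γ) 0 = max u 0 / stableConst γ := by
    rw [← max_div_div_right hc.le, zero_div]
  have e2 : -min (u / stableConst γ) 0 = -min u 0 / stableConst γ := by
    rw [neg_div, ← min_div_div_right hc.le, zero_div]
  rw [integral_expRem_mul_powerLaw hγ, e1, e2, Real.div_rpow (le_max_right _ _) hc.le,
    Real.div_rpow (by simp) hc.le, ← neg_eq_iff_eq_neg.2 hcγ, ← add_div, ← sub_div]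
  have hcC : ((stableConst γ ^ γ : ℝ) : ℂ) ≠ 0 := by exact_mod_cast hcp.ne'
  push_cast at hcC ⊢
  field_simp

/-! ### Powers, norms and skewness of functions in L^γ -/

section StableFunctional

variable {X : Type*} [MeasurableSpace X] {μ : Measure X}

theorem memLp_of_memLp_one_of_memLp_two {γ : ℝ} (hγ : γ ∈ Ioo (1 : ℝ) 2) {f : X → ℝ}
    (h1 : MemLp f 1 μ) (h2 : MemLp f 2 μ) : MemLp f (ENNReal.ofReal γ) μ := by
  have hγ0 : 0 < γ := by linarith [hγ.1]
  rw [← integrable_norm_rpow_iff h1.1 (by simpa using hγ0) ENNReal.ofReal_ne_top,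
    ENNReal.toReal_ofReal hγ0.le]
  refine ((memLp_one_iff_integrable.1 h1).norm.add h2.integrable_sq).mono'
    (h1.1.norm.aemeasurable.pow_const γ).aestronglyMeasurable (ae_of_all _ fun x => ?_)
  rw [Real.norm_of_nonneg (by positivity), Pi.add_apply, Real.norm_eq_abs]
  rcases le_total |f x| 1 with h | h
  · have := Real.rpow_le_rpow_of_exponent_ge' (abs_nonneg (f x)) h zero_le_one hγ.1.le
    rw [Real.rpow_one] at this
    nlinarith [sq_nonneg (f x)]
  · have := Real.rpow_le_rpow_of_exponent_le h hγ.2.le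
    rw [Real.rpow_two, sq_abs] at this
    linarith [abs_nonneg (f x)]

theorem memLp_max_zero {γ : ℝ} {f : X → ℝ} (hf : MemLp f (ENNReal.ofReal γ) μ) :
    MemLp (fun x => max (f x) 0) (ENNReal.ofReal γ) μ := hf.pos_part

theorem memLp_neg_min_zero {γ : ℝ} {f : X → ℝ} (hf : MemLp f (ENNReal.ofReal γ) μ) :
    MemLp (fun x => -min (f x) 0) (ENNReal.ofReal γ) μ := by
  have h := hf.neg_part
  refine h.ae_eq (ae_of_all _ fun x => ?_)
  simp only [← max_neg_neg, neg_zero]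

theorem integrable_rpow_of_memLp {γ : ℝ} (hγ : 0 < γ) {f : X → ℝ} (hf0 : ∀ x, 0 ≤ f x)
    (hf : MemLp f (ENNReal.ofReal γ) μ) : Integrable (fun x => f x ^ γ) μ := by
  have h := hf.integrable_norm_rpow (by simpa using hγ) ENNReal.ofReal_ne_top
  rw [ENNReal.toReal_ofReal hγ.le] at h
  simpa only [Real.norm_of_nonneg (hf0 _)] using h

end StableFunctional

theorem normL_rpow {d : ℕ} {γ : ℝ} (hγ : 0 < γ) {f : EuclideanSpace ℝ (Fin d) → ℝ}
    (hf : MemLp f (ENNReal.ofReal γ) volume) : normL γ f ^ γ = ∫ x, |f x| ^ γ := by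
  rw [normL, hf.eLpNorm_eq_integral_rpow_norm (by simpa using hγ) ENNReal.ofReal_ne_top,
    ENNReal.toReal_ofReal hγ.le, ENNReal.toReal_ofReal (by positivity),
    ← Real.rpow_mul (by positivity), inv_mul_cancel₀ hγ.ne', Real.rpow_one]
  rfl

theorem max_rpow_add_min_rpow {γ : ℝ} (hγ : 0 < γ) (u : ℝ) :
    (max u 0) ^ γ + (-min u 0) ^ γ = |u| ^ γ := by
  rcases le_total u 0 with h | h
  · rw [max_eq_right h, min_eq_left h, Real.zero_rpow hγ.ne', abs_of_nonpos h, zero_add]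
  · rw [max_eq_left h, min_eq_right h, neg_zero, Real.zero_rpow hγ.ne', abs_of_nonneg h, add_zero]

/-- The normalisation in the skewness cancels. If the norm is zero, the negative power is only a
default value, but then the right side vanishes as well. -/
theorem normL_rpow_mul_skewness {d : ℕ} {γ : ℝ} (hγ : 0 < γ) {f : EuclideanSpace ℝ (Fin d) → ℝ}
    (hf : MemLp f (ENNReal.ofReal γ) volume) :
    normL γ f ^ γ * skewness γ f =
      ∫ x, ((max (f x) 0) ^ γ - (-min (f x) 0) ^ γ) := by
  have hp := integrable_rpow_of_memLp hγ (fun x => le_max_right (f x) 0) (memLp_max_zero hf)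
  have hn := integrable_rpow_of_memLp (f := fun x => -min (f x) 0) hγ (fun x => by simp)
    (memLp_neg_min_zero hf)
  have e : normL γ (fun x => max (f x) 0) ^ γ - normL γ (fun x => -min (f x) 0) ^ γ =
      ∫ x, ((max (f x) 0) ^ γ - (-min (f x) 0) ^ γ) := by
    rw [normL_rpow hγ (memLp_max_zero hf), normL_rpow hγ (memLp_neg_min_zero hf),
      integral_sub hp hn]
    congr 1
    · exact integral_congr_ae (ae_of_all _ fun x => by
        simp only [abs_of_nonneg (le_max_right (f x) 0)])
    · exact integral_congr_ae (ae_of_all _ fun x => by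
        simp only [abs_of_nonneg (show (0 : ℝ) ≤ -min (f x) 0 by simp)])
  have h0 : 0 ≤ normL γ f := ENNReal.toReal_nonneg
  rw [skewness, e, ← mul_assoc]
  rcases h0.eq_or_lt with h | h
  · have h2 : ∫ x, |f x| ^ γ = 0 := by rw [← normL_rpow hγ hf, ← h, Real.zero_rpow hγ.ne']
    have h3 : ∫ x, ((max (f x) 0) ^ γ - (-min (f x) 0) ^ γ) = 0 := by
      have h4 : |∫ x, ((max (f x) 0) ^ γ - (-min (f x) 0) ^ γ)| ≤ ∫ x, |f x| ^ γ := by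
        have hi : Integrable fun x => |f x| ^ γ :=
          (hp.add hn).congr (ae_of_all _ fun x => max_rpow_add_min_rpow hγ _)
        rw [← Real.norm_eq_abs]
        refine norm_integral_le_of_norm_le hi (ae_of_all _ fun x => ?_)
        rw [← max_rpow_add_min_rpow hγ]
        have a1 : 0 ≤ (max (f x) 0) ^ γ := Real.rpow_nonneg (le_max_right _ _) _
        have a2 : 0 ≤ (-min (f x) 0) ^ γ := Real.rpow_nonneg (by simp) _
        rw [Real.norm_eq_abs, abs_le]
        constructor <;> linarith
      rw [h2] at h4
      exact abs_nonpos_iff.1 h4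
    rw [h3, mul_zero]
  · rw [← Real.rpow_add h, add_neg_cancel, Real.rpow_zero, one_mul]

/-- Fubini reduces the stable exponent to the scalar formula at each `f x`. Joint integrability uses
`f ∈ L²` for small `v` and `f ∈ L¹` for large `v`. -/
theorem integral_integral_expRem_powerLaw {d : ℕ} {γ : ℝ} (hγ : γ ∈ Ioo (1 : ℝ) 2)
    {f : EuclideanSpace ℝ (Fin d) → ℝ} (hfm : Measurable f) (h1 : MemLp f 1 volume)
    (h2 : MemLp f 2 volume) :
    ∫ v, (∫ x, expRem (v * (f x / stableConst γ))) ∂(powerLaw γ) =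
      -((normL γ f ^ γ : ℝ) : ℂ) *
        (1 - Complex.I * ((skewness γ f * Real.tan (Real.pi * γ / 2) : ℝ) : ℂ)) := by
  have hγ0 : 0 < γ := by linarith [hγ.1]
  set c := stableConst γ with hc
  have hfγ := memLp_of_memLp_one_of_memLp_two hγ h1 h2
  have hp := integrable_rpow_of_memLp hγ0 (fun x => le_max_right (f x) 0) (memLp_max_zero hfγ)
  have hn := integrable_rpow_of_memLp (f := fun x => -min (f x) 0) hγ0 (fun x => by simp)
    (memLp_neg_min_zero hfγ)
  have hm : Measurable fun p : ℝ × EuclideanSpace ℝ (Fin d) => expRem (p.1 * (f p.2 / c)) :=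
    measurable_expRem.comp (measurable_fst.mul ((hfm.comp measurable_snd).div_const c))
  have hi1 : Integrable fun x => f x / c := (memLp_one_iff_integrable.1 h1).div_const c
  have hi2 : Integrable fun x => (f x / c) ^ 2 := by
    simp_rw [div_pow]; exact h2.integrable_sq.div_const _
  have hint : Integrable (fun p : ℝ × EuclideanSpace ℝ (Fin d) => expRem (p.1 * (f p.2 / c)))
      ((powerLaw γ).prod volume) := by
    refine ⟨hm.aestronglyMeasurable, ?_⟩
    rw [HasFiniteIntegral, lintegral_prod _ hm.enorm.aemeasurable]
    refine lintegral_powerLaw_lt_top hγ.1 (p := 2) hγ.2 hm.enorm.lintegral_prod_right'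
      (K₁ := (∫⁻ x, ‖(f x / c) ^ 2‖ₑ).toNNReal) (K₂ := (2 * ∫⁻ x, ‖f x / c‖ₑ).toNNReal) ?_ ?_
    · intro v hv
      rw [ENNReal.coe_toNNReal hi2.2.ne, mul_comm,
        ← lintegral_const_mul' _ _ ENNReal.ofReal_ne_top]
      refine lintegral_mono fun x => ?_
      rw [← ofReal_norm, ← ofReal_norm, ← ENNReal.ofReal_mul (by positivity)]
      refine ENNReal.ofReal_le_ofReal ((norm_expRem_le_sq _).trans (le_of_eq ?_))
      rw [Real.norm_of_nonneg (sq_nonneg _), Real.rpow_two, mul_pow]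
    · intro v hv
      rw [ENNReal.coe_toNNReal (ENNReal.mul_ne_top (by simp) hi1.2.ne), mul_comm, ← mul_assoc,
        ← lintegral_const_mul' _ _ (ENNReal.mul_ne_top ENNReal.ofReal_ne_top (by simp))]
      refine lintegral_mono fun x => ?_
      have e2 : (2 : ℝ≥0∞) = ENNReal.ofReal 2 := by simp
      rw [← ofReal_norm, ← ofReal_norm, e2, ← ENNReal.ofReal_mul (le_of_lt hv),
        ← ENNReal.ofReal_mul (by have := le_of_lt hv; positivity)]
      refine ENNReal.ofReal_le_ofReal ((norm_expRem_le_two_mul _).trans (le_of_eq ?_))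
      rw [abs_mul, abs_of_pos hv, Real.norm_eq_abs]
      ring
  change ∫ v, (∫ x, expRem (v * (f x / c))) ∂(powerLaw γ) = _
  rw [integral_integral_swap hint]
  simp_rw [hc, integral_expRem_mul_div_stableConst hγ]
  have e1 : -((normL γ f ^ γ : ℝ) : ℂ) *
        (1 - Complex.I * ((skewness γ f * Real.tan (Real.pi * γ / 2) : ℝ) : ℂ)) =
      -(((normL γ f ^ γ : ℝ) : ℂ) - Complex.I *
        ((Real.tan (Real.pi * γ / 2) * (normL γ f ^ γ * skewness γ f) : ℝ) : ℂ)) := by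
    push_cast; ring
  rw [e1, normL_rpow_mul_skewness hγ0 hfγ, normL_rpow hγ0 hfγ, integral_neg,
    integral_sub ((hp.add hn).ofReal) (((hp.sub hn).const_mul _).ofReal.const_mul _),
    integral_const_mul, integral_complex_ofReal, integral_complex_ofReal, integral_const_mul]
  simp_rw [max_rpow_add_min_rpow hγ0]

/-! ### The small-grain limit -/

theorem lintegral_sq_le {X : Type*} [MeasurableSpace X] {μ : Measure X} {g : X → ℝ≥0∞}
    (hg : AEMeasurable g μ) : (∫⁻ x, g x ∂μ) ^ 2 ≤ μ univ * ∫⁻ x, g x ^ 2 ∂μ := by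
  have h := ENNReal.lintegral_mul_le_Lp_mul_Lq μ Real.HolderConjugate.two_two hg
    (aemeasurable_const (b := (1 : ℝ≥0∞)))
  simp only [Pi.mul_apply, mul_one, ENNReal.rpow_two] at h
  refine (pow_le_pow_left' h 2).trans (le_of_eq ?_)
  rw [mul_pow, ← ENNReal.rpow_two, ← ENNReal.rpow_two, ← ENNReal.rpow_mul, ← ENNReal.rpow_mul]
  norm_num
  rw [mul_comm]

/-- Continuity of translation in L¹, read off the continuous action of the group on `Lp`. -/
theorem tendsto_lintegral_enorm_translate_sub {G : Type*} [NormedAddCommGroup G]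
    [MeasurableSpace G] [BorelSpace G] [SecondCountableTopology G] [LocallyCompactSpace G]
    {μ : Measure G} [IsLocallyFiniteMeasure μ] [μ.InnerRegularCompactLTTop]
    [μ.IsAddLeftInvariant] {f : G → ℝ} (hf : Integrable f μ) :
    Tendsto (fun u => ∫⁻ x, ‖f (x + u) - f x‖ₑ ∂μ) (𝓝 0) (𝓝 0) := by
  have : Fact ((1 : ℝ≥0∞) ≤ 1) := ⟨le_rfl⟩
  have : Fact ((1 : ℝ≥0∞) ≠ ∞) := ⟨ENNReal.one_ne_top⟩
  have hf1 : MemLp f 1 μ := memLp_one_iff_integrable.2 hf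
  have hc : Continuous fun u : G => DomAddAct.mk u +ᵥ hf1.toLp f :=
    (DomAddAct.continuous_mk.vadd continuous_const)
  have h := (hc.tendsto 0).edist (tendsto_const_nhds (x := DomAddAct.mk (0 : G) +ᵥ hf1.toLp f))
  rw [edist_self] at h
  refine h.congr fun u => ?_
  rw [DomAddAct.mk_vadd_toLp, DomAddAct.mk_vadd_toLp, Lp.edist_toLp_toLp,
    eLpNorm_one_eq_lintegral_enorm]
  refine lintegral_congr fun x => ?_
  simp [add_comm]

/-! ### Grains measured by an integrable density -/

section Density

variable {d : ℕ} {C : Set (EuclideanSpace ℝ (Fin d))}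

local notation "𝔼" => EuclideanSpace ℝ (Fin d)

theorem field_withDensity (hC : MeasurableSet C) {f : 𝔼 → ℝ} (hf : Integrable f volume)
    (z : 𝔼 × ℝ × SO d) :
    field C (volume.withDensityᵥ f) z = ∫ u in shape C z.2.1 z.2.2, f (z.1 + u) := by
  rw [field, withDensityᵥ_apply hf (measurableSet_grain hC z)]
  have h := (measurePreserving_add_left (volume : Measure 𝔼) z.1).setIntegral_preimage_emb
    (measurableEmbedding_addLeft z.1) f {y | y - z.1 ∈ shape C z.2.1 z.2.2}
  rw [← h]
  congr 2
  ext u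
  simp

/-- The domain of the inner integral depends on the orientation, so it is encoded as an indicator
before the order of integration is changed. -/
theorem lintegral_lintegral_shape (hC : MeasurableSet C)
    {g : 𝔼 → 𝔼 → ℝ≥0∞} (hg : Measurable (Function.uncurry g)) (v : ℝ) :
    ∫⁻ q, (∫⁻ u in shape C v q.2, g q.1 u) ∂(placeMeasure d) =
      ∫⁻ θ, (∫⁻ u in shape C v θ, ∫⁻ x, g x u) ∂(haarSO d) := by
  have hS := (measurableSet_shape_prod hC).preimage
    ((show Measurable fun p : SO d × 𝔼 => (((0 : 𝔼), v, p.1), p.2) by fun_prop))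
  have hS' : MeasurableSet {p : SO d × 𝔼 | p.2 ∈ shape C v p.1} := by simpa using hS
  have hm : Measurable fun p : (𝔼 × SO d) × 𝔼 =>
      {p : SO d × 𝔼 | p.2 ∈ shape C v p.1}.indicator (fun _ => (1 : ℝ≥0∞)) (p.1.2, p.2) *
        g p.1.1 p.2 :=
    ((measurable_const.indicator hS').comp ((measurable_snd.comp measurable_fst).prodMk
      measurable_snd)).mul (hg.comp ((measurable_fst.comp measurable_fst).prodMk measurable_snd))
  have hind : ∀ (θ : SO d) (k : 𝔼 → ℝ≥0∞), ∫⁻ u in shape C v θ, k u =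
      ∫⁻ u, {p : SO d × 𝔼 | p.2 ∈ shape C v p.1}.indicator (fun _ => (1 : ℝ≥0∞)) (θ, u) * k u := by
    intro θ k
    rw [← lintegral_indicator (measurableSet_shape hC v θ)]
    refine lintegral_congr fun u => ?_
    by_cases hu : u ∈ shape C v θ <;> simp [indicator, hu]
  simp_rw [hind]
  rw [placeMeasure, lintegral_prod_symm _ hm.lintegral_prod_right'.aemeasurable]
  refine lintegral_congr fun θ => ?_
  rw [lintegral_lintegral_swap]
  · refine lintegral_congr fun u => ?_
    have hgu : Measurable fun x => g x u := hg.comp (measurable_id.prodMk measurable_const)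
    exact lintegral_const_mul
      ({p : SO d × 𝔼 | p.2 ∈ shape C v p.1}.indicator (fun _ => (1 : ℝ≥0∞)) (θ, u)) hgu
  · exact (hm.comp (show Measurable fun p : 𝔼 × 𝔼 => ((p.1, θ), p.2) by fun_prop)).aemeasurable

theorem lintegral_enorm_field_withDensity_le [NeZero d] (hC : MeasurableSet C)
    (hC1 : volume C = 1) {f : 𝔼 → ℝ} (hfm : Measurable f) (hf : Integrable f volume) {v : ℝ}
    (hv : 0 < v) :
    ∫⁻ q, ‖field C (volume.withDensityᵥ f) (q.1, v, q.2)‖ₑ ∂(placeMeasure d) ≤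
      ENNReal.ofReal v * ∫⁻ x, ‖f x‖ₑ := by
  calc _ ≤ ∫⁻ q, (∫⁻ u in shape C v q.2, ‖f (q.1 + u)‖ₑ) ∂(placeMeasure d) := by
        refine lintegral_mono fun q => ?_
        simp only [field_withDensity hC hf]
        exact enorm_integral_le_lintegral_enorm _
    _ = ∫⁻ θ, (∫⁻ u in shape C v θ, ∫⁻ x, ‖f (x + u)‖ₑ) ∂(haarSO d) :=
        lintegral_lintegral_shape hC (g := fun x u => ‖f (x + u)‖ₑ) (by fun_prop) v
    _ = _ := by
        have h : ∀ u : 𝔼, ∫⁻ x, ‖f (x + u)‖ₑ = ∫⁻ x, ‖f x‖ₑ := fun u =>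
          lintegral_add_right_eq_self (fun x => ‖f x‖ₑ) u
        simp_rw [h, setLIntegral_const, volume_shape hC hv, hC1]
        simp [mul_comm]

/-- Cauchy–Schwarz on a grain of volume `v` gains one factor `v`, averaging over locations another.
The exponent `2 > γ` replaces the Riesz exponent here. -/
theorem lintegral_enorm_field_withDensity_sq_le [NeZero d] (hC : MeasurableSet C)
    (hC1 : volume C = 1) {f : 𝔼 → ℝ} (hfm : Measurable f) (hf : Integrable f volume) {v : ℝ}
    (hv : 0 < v) :
    ∫⁻ q, ‖field C (volume.withDensityᵥ f) (q.1, v, q.2)‖ₑ ^ 2 ∂(placeMeasure d) ≤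
      ENNReal.ofReal (v ^ 2) * ∫⁻ x, ‖f x‖ₑ ^ 2 := by
  calc _ ≤ ∫⁻ q, ENNReal.ofReal v * (∫⁻ u in shape C v q.2, ‖f (q.1 + u)‖ₑ ^ 2)
          ∂(placeMeasure d) := by
        refine lintegral_mono fun q => ?_
        simp only [field_withDensity hC hf]
        refine (pow_le_pow_left' (enorm_integral_le_lintegral_enorm _) 2).trans ?_
        refine (lintegral_sq_le (by fun_prop)).trans (le_of_eq ?_)
        rw [Measure.restrict_apply_univ, volume_shape hC hv, hC1, mul_one]
    _ = ENNReal.ofReal v * ∫⁻ θ, (∫⁻ u in shape C v θ, ∫⁻ x, ‖f (x + u)‖ₑ ^ 2) ∂(haarSO d) := by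
        rw [lintegral_const_mul' _ _ ENNReal.ofReal_ne_top]
        congr 1
        exact lintegral_lintegral_shape hC (g := fun x u => ‖f (x + u)‖ₑ ^ 2) (by fun_prop) v
    _ = _ := by
        have h : ∀ u : 𝔼, ∫⁻ x, ‖f (x + u)‖ₑ ^ 2 = ∫⁻ x, ‖f x‖ₑ ^ 2 := fun u =>
          lintegral_add_right_eq_self (fun x => ‖f x‖ₑ ^ 2) u
        simp_rw [h, setLIntegral_const, volume_shape hC hv, hC1]
        rw [lintegral_const, measure_univ, sq, ENNReal.ofReal_mul hv.le]
        ring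

theorem lintegral_enorm_field_withDensity_sub_le [NeZero d] (hC : MeasurableSet C)
    (hC1 : volume C = 1) {f : 𝔼 → ℝ} (hfm : Measurable f) (hf : Integrable f volume) {v : ℝ}
    (hv : 0 < v) {ε : ℝ≥0∞}
    (h : ∀ θ, ∀ u ∈ shape C v θ, ∫⁻ x, ‖f (x + u) - f x‖ₑ ≤ ε) :
    ∫⁻ q, ‖field C (volume.withDensityᵥ f) (q.1, v, q.2) - v * f q.1‖ₑ ∂(placeMeasure d) ≤
      ENNReal.ofReal v * ε := by
  have hvol : ∀ θ : SO d, volume (shape C v θ) = ENNReal.ofReal v := fun θ => by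
    rw [volume_shape hC hv, hC1, mul_one]
  calc _ ≤ ∫⁻ q, (∫⁻ u in shape C v q.2, ‖f (q.1 + u) - f q.1‖ₑ) ∂(placeMeasure d) := by
        refine lintegral_mono fun q => ?_
        have e : v * f q.1 = ∫ _ in shape C v q.2, f q.1 := by
          rw [setIntegral_const, measureReal_def, hvol, ENNReal.toReal_ofReal hv.le, smul_eq_mul]
        have hc : IntegrableOn (fun _ : 𝔼 => f q.1) (shape C v q.2) :=
          integrableOn_const (by rw [hvol]; exact ENNReal.ofReal_ne_top)
        simp only [field_withDensity hC hf]
        rw [e, ← integral_sub (hf.comp_add_left q.1).integrableOn hc]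
        exact enorm_integral_le_lintegral_enorm _
    _ = ∫⁻ θ, (∫⁻ u in shape C v θ, ∫⁻ x, ‖f (x + u) - f x‖ₑ) ∂(haarSO d) :=
        lintegral_lintegral_shape hC (g := fun x u => ‖f (x + u) - f x‖ₑ) (by fun_prop) v
    _ ≤ ∫⁻ θ, (∫⁻ _ in shape C v θ, ε) ∂(haarSO d) := by
        refine lintegral_mono fun θ => ?_
        exact setLIntegral_mono' (measurableSet_shape hC v θ) fun u hu => h θ u hu
    _ = _ := by
        simp_rw [setLIntegral_const, hvol]
        simp [mul_comm]

/-- The deviation from `v f(x)` is an integral of `f(x + u) - f(x)` over a shape of volume `v` and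
radius of order `v^{1/d}`, so it is `o(v)` in L¹ by continuity of translation. -/
theorem tendsto_field_withDensity_sub_div [NeZero d] (hC : MeasurableSet C)
    (hC1 : volume C = 1) (hb : Bornology.IsBounded C) {f : 𝔼 → ℝ} (hfm : Measurable f)
    (hf : Integrable f volume) :
    Tendsto (fun v : ℝ => (∫ q, |field C (volume.withDensityᵥ f) (q.1, v, q.2) - v * f q.1|
      ∂(placeMeasure d)) / v) (𝓝[>] 0) (𝓝 0) := by
  obtain ⟨R, hR0, hR⟩ : ∃ R, 0 < R ∧ ∀ x ∈ C, ‖x‖ ≤ R := by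
    obtain ⟨R, hR⟩ := hb.exists_norm_le
    exact ⟨max R 1, by positivity, fun x hx => (hR x hx).trans (le_max_left _ _)⟩
  have hd : (0 : ℝ) < d := by exact_mod_cast Nat.pos_of_ne_zero (NeZero.ne d)
  have h0 := tendsto_lintegral_enorm_translate_sub hf
  have hr : Tendsto (fun v : ℝ => R * v ^ (1 / (d : ℝ))) (𝓝[>] 0) (𝓝 0) := by
    have h := (Real.continuousAt_rpow_const (0 : ℝ) (1 / (d : ℝ)) (Or.inr (by positivity))).tendsto
    rw [Real.zero_rpow (by positivity)] at h
    simpa using (h.mono_left (nhdsWithin_le_nhds (s := Ioi 0))).const_mul R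
  refine tendsto_order.2 ⟨fun a ha => ?_, fun ε hε => ?_⟩
  · filter_upwards [self_mem_nhdsWithin] with v hv
    have : (0 : ℝ) < v := hv
    exact ha.trans_le (by positivity)
  · have hev : ∀ᶠ u : 𝔼 in 𝓝 0, ∫⁻ x, ‖f (x + u) - f x‖ₑ ≤ ENNReal.ofReal (ε / 2) :=
      (h0.eventually (eventually_lt_nhds (by simpa using hε))).mono fun _ h => h.le
    obtain ⟨δ, hδ, hball⟩ := Metric.eventually_nhds_iff.1 hev
    filter_upwards [self_mem_nhdsWithin, hr.eventually (eventually_lt_nhds hδ)] with v hv hvδ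
    have hv0 : (0 : ℝ) < v := hv
    have h := lintegral_enorm_field_withDensity_sub_le hC hC1 hfm hf hv0
      (ε := ENNReal.ofReal (ε / 2)) fun θ u hu => hball (by
        rw [dist_zero_right]; exact (norm_le_of_mem_shape hR hv0 hu).trans_lt hvδ)
    rw [← ENNReal.ofReal_mul hv0.le] at h
    have h2 : ∫ q, |field C (volume.withDensityᵥ f) (q.1, v, q.2) - v * f q.1|
        ∂(placeMeasure d) ≤ v * (ε / 2) := by
      have hm : Measurable fun q : 𝔼 × SO d =>
          field C (volume.withDensityᵥ f) (q.1, v, q.2) - v * f q.1 :=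
        ((measurable_field hC _).comp (measurable_slice v)).sub
          ((hfm.comp measurable_fst).const_mul v)
      have e := integral_norm_eq_lintegral_enorm (μ := placeMeasure d) hm.aestronglyMeasurable
      simp only [Real.norm_eq_abs] at e
      rw [e]
      exact ENNReal.toReal_le_of_le_ofReal (by positivity) h
    rw [div_lt_iff₀ hv0]
    nlinarith

end Density

-- The set whose infimum defines the quantile of the scaled law is `ρ` times the one for `F` with
-- tail level `1 / u`.
open scoped Pointwise in
theorem tailQuantile_scaledLaw (F : Measure ℝ) [IsProbabilityMeasure F] {ρ u : ℝ} (hρ : 0 < ρ)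
    (hu : 0 < u) : tailQuantile (scaledLaw F ρ) u = ρ * tailInv F (1 / u) := by
  have h : {v : ℝ | 0 ≤ v ∧ ENNReal.ofReal u ≤ 1 / (scaledLaw F ρ) (Ioi v)} =
      ρ • {w : ℝ | 0 ≤ w ∧ tail F w ≤ 1 / u} := by
    ext v
    rw [mem_smul_set_iff_inv_smul_mem₀ hρ.ne']
    have e : (scaledLaw F ρ) (Ioi v) = F (Ioi (ρ⁻¹ • v)) := by
      rw [scaledLaw, Measure.map_apply (measurable_const_mul ρ) measurableSet_Ioi]
      congr 1
      ext w
      simp only [mem_preimage, mem_Ioi, smul_eq_mul]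
      rw [inv_mul_lt_iff₀ hρ]
    simp only [mem_ofPred_eq, e]
    refine and_congr ?_ ?_
    · rw [smul_eq_mul, mul_nonneg_iff_of_pos_left (inv_pos.2 hρ)]
    · rw [one_div, ENNReal.le_inv_iff_le_inv, ← ENNReal.ofReal_inv_of_pos hu,
        ENNReal.le_ofReal_iff_toReal_le (measure_ne_top _ _) (inv_pos.2 hu).le, one_div]
      rfl
  rw [tailQuantile, h, Real.sInf_smul_of_nonneg hρ.le, smul_eq_mul, tailInv]

/-! ### Convergence of the small-grain exponent -/

section SmallGrain

variable {d : ℕ} {C : Set (EuclideanSpace ℝ (Fin d))}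

local notation "𝔼" => EuclideanSpace ℝ (Fin d)

theorem integral_placeMeasure_fst {E : Type*} [NormedAddCommGroup E] [NormedSpace ℝ E]
    (h : 𝔼 → E) : ∫ q, h q.1 ∂(placeMeasure d) = ∫ x, h x := by
  rw [placeMeasure, integral_fun_fst]
  simp

/-- Two errors, with `expRem` 2-Lipschitz: replacing the mass of the grain by volume times density,
and replacing the rescaled volume `u` by its limit `w`. -/
theorem norm_integral_expRem_sub_le [NeZero d] (hC : MeasurableSet C) (hC1 : volume C = 1)
    {f : 𝔼 → ℝ} (hf : Integrable f volume) {a c u w : ℝ}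
    (ha : 0 < a) (hc : 0 < c) (hu : 0 < u) :
    ‖(∫ q, expRem (field C (volume.withDensityᵥ f) (q.1, a * u, q.2) / (c * a)) ∂(placeMeasure d)) -
        ∫ x, expRem (w * (f x / c))‖ ≤
      2 / c * (u * ((∫ q, |field C (volume.withDensityᵥ f) (q.1, a * u, q.2) - a * u * f q.1|
        ∂(placeMeasure d)) / (a * u)) + |u - w| * ∫ x, |f x|) := by
  set ψ := (volume : Measure 𝔼).withDensityᵥ f
  have hau : 0 < a * u := by positivity
  have hi := integrable_slice_field hC hC1 ψ hau
  have hf1 : Integrable (fun q : 𝔼 × SO d => f q.1) (placeMeasure d) := by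
    have h := hf.mul_prod (integrable_const (1 : ℝ) (μ := haarSO d))
    simpa [placeMeasure] using h
  have hi1 : Integrable (fun q : 𝔼 × SO d => |field C ψ (q.1, a * u, q.2) - a * u * f q.1|)
    (placeMeasure d) := (hi.sub (hf1.const_mul (a * u))).abs
  rw [← integral_placeMeasure_fst (fun x => expRem (w * (f x / c))),
    ← integral_placeMeasure_fst (fun x => |f x|),
    ← integral_sub (integrable_expRem (hi.div_const _))
      (integrable_expRem ((hf1.div_const c).const_mul w))]
  have e : 2 / c * (u * ((∫ q, |field C ψ (q.1, a * u, q.2) - a * u * f q.1|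
        ∂(placeMeasure d)) / (a * u)) + |u - w| * ∫ q, |f q.1| ∂(placeMeasure d)) =
      ∫ q, (2 / (c * a) * |field C ψ (q.1, a * u, q.2) - a * u * f q.1| +
        2 / c * |u - w| * |f q.1|) ∂(placeMeasure d) := by
    rw [integral_add (hi1.const_mul _) (hf1.abs.const_mul _), integral_const_mul,
      integral_const_mul]
    field_simp
  rw [e]
  refine norm_integral_le_of_norm_le ((hi1.const_mul _).add (hf1.abs.const_mul _))
    (ae_of_all _ fun q => ?_)
  refine (norm_expRem_sub_le_two_mul _ _).trans ?_
  set b := field C ψ (q.1, a * u, q.2)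
  have e2 : b / (c * a) - w * (f q.1 / c) =
      (c * a)⁻¹ * (b - a * u * f q.1) + c⁻¹ * ((u - w) * f q.1) := by
    field_simp; ring
  rw [e2]
  calc 2 * |(c * a)⁻¹ * (b - a * u * f q.1) + c⁻¹ * ((u - w) * f q.1)|
      ≤ 2 * (|(c * a)⁻¹ * (b - a * u * f q.1)| + |c⁻¹ * ((u - w) * f q.1)|) := by
        gcongr; exact abs_add_le _ _
    _ = _ := by
        rw [abs_mul, abs_mul, abs_mul, abs_of_pos (by positivity : 0 < (c * a)⁻¹),
          abs_of_pos (inv_pos.2 hc)]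
        ring

theorem norm_integral_expRem_field_le [NeZero d] (hC : MeasurableSet C) (hC1 : volume C = 1)
    {f : 𝔼 → ℝ} (hfm : Measurable f) (hf : Integrable f volume) (hf2 : MemLp f 2 volume)
    {a c w : ℝ} (ha : 0 < a) (hc : 0 < c) (hw : 0 < w) :
    ‖∫ q, expRem (field C (volume.withDensityᵥ f) (q.1, a * w, q.2) / (c * a)) ∂(placeMeasure d)‖ ≤
        (∫⁻ x, ‖f x‖ₑ ^ 2).toReal / c ^ 2 * w ^ (2 : ℝ) ∧
    ‖∫ q, expRem (field C (volume.withDensityᵥ f) (q.1, a * w, q.2) / (c * a)) ∂(placeMeasure d)‖ ≤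
        2 * (∫⁻ x, ‖f x‖ₑ).toReal / c * w := by
  set ψ := (volume : Measure 𝔼).withDensityᵥ f
  have haw : 0 < a * w := by positivity
  have hca : 0 < c * a := by positivity
  have hi := integrable_slice_field hC hC1 ψ haw
  have hN2 : ∫⁻ x, ‖f x‖ₑ ^ 2 ≠ ∞ := by
    have h := hf2.2
    rw [eLpNorm_lt_top_iff_lintegral_rpow_enorm_lt_top two_ne_zero ENNReal.ofNat_ne_top] at h
    simpa using h.ne
  constructor
  · have h := norm_remMean_le hca (ENNReal.mul_ne_top ENNReal.ofReal_ne_top hN2)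
      (lintegral_enorm_field_withDensity_sq_le hC hC1 hfm hf haw)
    rw [remMean, norm_smul, Real.norm_of_nonneg (sq_nonneg _), ENNReal.toReal_mul,
      ENNReal.toReal_ofReal (sq_nonneg _), ← le_div_iff₀' (by positivity)] at h
    refine h.trans (le_of_eq ?_)
    rw [Real.rpow_two]
    field_simp
  · have h1 : ∫ q, |field C ψ (q.1, a * w, q.2)| ∂(placeMeasure d) ≤
        a * w * (∫⁻ x, ‖f x‖ₑ).toReal := by
      have e := integral_norm_eq_lintegral_enorm hi.1
      simp only [Real.norm_eq_abs] at e
      rw [e]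
      have h2 := ENNReal.toReal_mono (ENNReal.mul_ne_top ENNReal.ofReal_ne_top hf.2.ne)
        (lintegral_enorm_field_withDensity_le hC hC1 hfm hf haw)
      rwa [ENNReal.toReal_mul, ENNReal.toReal_ofReal haw.le] at h2
    calc _ ≤ ∫ q, 2 / (c * a) * |field C ψ (q.1, a * w, q.2)| ∂(placeMeasure d) := by
          refine norm_integral_le_of_norm_le (hi.abs.const_mul _) (ae_of_all _ fun q => ?_)
          refine (norm_expRem_le_two_mul _).trans (le_of_eq ?_)
          rw [abs_div, abs_of_pos hca]; ring
      _ ≤ 2 / (c * a) * (a * w * (∫⁻ x, ‖f x‖ₑ).toReal) := by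
          rw [integral_const_mul]; gcongr
      _ = _ := by field_simp

/-- Regular variation with `y` the quantile of `F` at level `1 / (γ λ)`: volumes are measured in
units of `a = ρ y`, and since `a → 0` each grain sees only the value of the density at its location.
-/
theorem tendsto_integral_expRem_smallGrain [NeZero d] (hC : MeasurableSet C)
    (hC1 : volume C = 1) (hb : Bornology.IsBounded C)
    {F : Measure ℝ} [IsProbabilityMeasure F] (hF0 : F (Iic 0) = 0) (hF1 : ∫ v, v ∂F = 1)
    {γ : ℝ} (hγ : γ ∈ Ioo (1 : ℝ) 2) (hF : HasRegularlyVaryingTail F γ)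
    {ι : Type*} {l : Filter ι} [l.IsCountablyGenerated] {lam ρ : ι → ℝ}
    (hlam : ∀ i, 0 < lam i) (hρ : ∀ i, 0 < ρ i) (hlam0 : Tendsto lam l atTop)
    (hρ0 : Tendsto ρ l (𝓝 0))
    (h0 : Tendsto (fun i => lam i * tail (scaledLaw F (ρ i)) 1) l (𝓝 0))
    {c : ℝ} (hc : 0 < c) {f : 𝔼 → ℝ} (hfm : Measurable f) (hf : Integrable f volume)
    (hf2 : MemLp f 2 volume) :
    Tendsto (fun i => ∫ z, expRem (field C (volume.withDensityᵥ f) z /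
        (c * tailQuantile (scaledLaw F (ρ i)) (γ * lam i))) ∂(grainIntensity d (lam i) (ρ i) F)) l
      (𝓝 (∫ v, (∫ x, expRem (v * (f x / c))) ∂(powerLaw γ))) := by
  set ψ := (volume : Measure 𝔼).withDensityᵥ f
  have hγ0 : 0 < γ := by linarith [hγ.1]
  set y : ι → ℝ := fun i => tailInv F (1 / (γ * lam i)) with hy
  have hu : Tendsto (fun i => 1 / (γ * lam i)) l (𝓝[>] 0) := by
    simp_rw [one_div]
    exact tendsto_inv_atTop_nhdsGT_zero.comp (hlam0.const_mul_atTop hγ0)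
  have hytop : Tendsto y l atTop := hF.tendsto_tailInv_atTop.comp hu
  have hq : ∀ i, tailQuantile (scaledLaw F (ρ i)) (γ * lam i) = ρ i * y i := fun i =>
    tailQuantile_scaledLaw F (hρ i) (mul_pos hγ0 (hlam i))
  simp_rw [hq]
  set a : ι → ℝ := fun i => ρ i * y i with ha
  have hypos : ∀ᶠ i in l, 0 < y i := hytop.eventually_gt_atTop 0
  have hapos : ∀ᶠ i in l, 0 < a i := hypos.mono fun i hi => mul_pos (hρ i) hi
  have hρinv : Tendsto (fun i => 1 / ρ i) l atTop := by
    simp_rw [one_div]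
    exact tendsto_inv_nhdsGT_zero.comp
      (tendsto_nhdsWithin_iff.2 ⟨hρ0, Eventually.of_forall hρ⟩)
  -- By the Galois connection, `y ≤ (ε/2)/ρ` means `γ λ · tail F ((ε/2)/ρ) ≤ 1`. The left side is `γ
  -- λ · tail F (1/ρ)` times a convergent ratio, so it tends to 0 under the small-grain hypothesis.
  have ha0 : Tendsto a l (𝓝 0) := by
    refine tendsto_order.2 ⟨fun b hb => ?_, fun ε hε => ?_⟩
    · filter_upwards [hapos] with i hi using hb.trans hi
    · have hε2 : 0 < ε / 2 := by positivity
      have h1 := (hF (ε / 2) hε2).comp hρinv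
      have h2 := (h0.mul h1).const_mul γ
      rw [zero_mul, mul_zero] at h2
      filter_upwards [h2.eventually (eventually_le_nhds one_pos)] with i hi
      have hle : y i ≤ ε / 2 * (1 / ρ i) := by
        rw [hy, tailInv_le_iff (by have := hlam i; positivity) (by have := hρ i; positivity)]
        rw [le_div_iff₀ (by have := hlam i; positivity)]
        have htp : tail F (1 / ρ i) ≠ 0 := (hF.tail_pos _).ne'
        rw [tail_scaledLaw_one F (hρ i), Function.comp_apply] at hi
        refine le_trans (le_of_eq ?_) hi
        field_simp
      calc a i = ρ i * y i := rfl
        _ ≤ ρ i * (ε / 2 * (1 / ρ i)) := mul_le_mul_of_nonneg_left hle (hρ i).le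
        _ = ε / 2 := by have := (hρ i).ne'; field_simp
        _ < ε := by linarith
  set N2 := (∫⁻ x, ‖f x‖ₑ ^ 2).toReal
  set N1 := (∫⁻ x, ‖f x‖ₑ).toReal
  have hm := measurable_field hC ψ
  have main := hF.tendsto_integral hF0 hγ.1 (p := 2) (K := max (N2 / c ^ 2) (2 * N1 / c)) hγ.2
    hytop (g := fun i w => ∫ q, expRem (field C ψ (q.1, a i * w, q.2) / (c * a i))
      ∂(placeMeasure d)) (g₀ := fun w => ∫ x, expRem (w * (f x / c))) ?_ ?_ ?_
  -- The tail at the quantile is asymptotic to its level `1 / (γ λ)`; the limit `1 / γ` cancels the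
  -- `γ` of the limiting density.
  · have hk : Tendsto (fun i => lam i * tail F (y i)) l (𝓝 (1 / γ)) := by
      have h1 := (hF.tendsto_tail_tailInv_div.comp hu).const_mul (1 / γ)
      rw [mul_one] at h1
      refine h1.congr fun i => ?_
      have := (hlam i).ne'
      simp only [Function.comp_apply, hy]
      field_simp
    have e : ∫ v, (∫ x, expRem (v * (f x / c))) ∂(powerLaw γ) =
        (1 / γ) • ∫ v in Ioi 0, (γ * v ^ (-γ - 1)) • ∫ x, expRem (v * (f x / c)) := by
      rw [integral_powerLaw]
      simp_rw [mul_smul]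
      rw [integral_smul, smul_smul, one_div_mul_cancel hγ0.ne', one_smul]
    rw [e]
    refine (hk.smul main).congr' ?_
    filter_upwards [hypos] with i hi
    have hfi := (integrable_field hC hC1 hF0 hF1 (lam i) (hρ i) ψ).div_const (c * a i)
    have hme : Measurable fun z => expRem (field C ψ z / (c * a i)) :=
      measurable_expRem.comp (hm.div_const _)
    rw [integral_grainIntensity (hlam i) _ hme (integrable_expRem hfi), smul_smul, mul_assoc,
      mul_inv_cancel₀ (hF.tail_pos _).ne', mul_one]
    congr 2
    ext v
    rw [show a i * (v / y i) = ρ i * v by simp only [ha]; field_simp]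
  · intro i
    have h : StronglyMeasurable fun p : ℝ × (𝔼 × SO d) =>
        expRem (field C ψ (p.2.1, a i * p.1, p.2.2) / (c * a i)) :=
      (measurable_expRem.comp ((hm.comp (by fun_prop)).div_const _)).stronglyMeasurable
    exact h.integral_prod_right'.measurable
  · filter_upwards [hapos] with i hi w hw
    obtain ⟨h1, h2⟩ := norm_integral_expRem_field_le hC hC1 hfm hf hf2 hi hc hw
    constructor
    · refine h1.trans ?_
      gcongr
      exact le_max_left _ _
    · refine h2.trans ?_
      gcongr
      exact le_max_right _ _
  · intro w hw u hu
    have hupos : ∀ᶠ i in l, 0 < u i := hu.eventually (eventually_gt_nhds hw)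
    have hau : Tendsto (fun i => a i * u i) l (𝓝[>] 0) := by
      refine tendsto_nhdsWithin_iff.2 ⟨by simpa using ha0.mul hu, ?_⟩
      filter_upwards [hapos, hupos] with i h1 h2 using mul_pos h1 h2
    have h1 := (tendsto_field_withDensity_sub_div hC hC1 hb hfm hf).comp hau
    have h2 : Tendsto (fun i => |u i - w|) l (𝓝 0) := by
      simpa using (hu.sub_const w).abs
    have h3 := ((hu.mul h1).add (h2.mul_const (∫ x, |f x|))).const_mul (2 / c)
    simp only [mul_zero, zero_mul, add_zero] at h3
    rw [tendsto_iff_norm_sub_tendsto_zero]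
    refine squeeze_zero' (Eventually.of_forall fun _ => norm_nonneg _) ?_ h3
    filter_upwards [hapos, hupos] with i hi1 hi2
    exact norm_integral_expRem_sub_le hC hC1 hf hi1 hc hi2

end SmallGrain

theorem sum_smul_withDensity {X : Type*} [MeasurableSpace X] {μ : Measure X} {ι : Type*}
    (s : Finset ι) (t : ι → ℝ) {f : ι → X → ℝ} (hf : ∀ k, Integrable (f k) μ) :
    ∑ k ∈ s, t k • μ.withDensityᵥ (f k) = μ.withDensityᵥ (fun x => ∑ k ∈ s, t k * f k x) := by
  classical
  induction s using Finset.induction_on with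
  | empty =>
    simp only [Finset.sum_empty]
    exact withDensityᵥ_zero.symm
  | insert a s ha ih =>
    have h1 : Integrable (fun x => t a * f a x) μ := (hf a).const_mul _
    have h2 : Integrable (fun x => ∑ k ∈ s, t k * f k x) μ :=
      integrable_finsetSum _ fun k _ => (hf k).const_mul _
    rw [Finset.sum_insert ha, ih, ← withDensityᵥ_smul (f := f a)]
    refine (withDensityᵥ_add h1 h2).symm.trans ?_
    congr 1
    ext x
    simp [Finset.sum_insert ha]

/-! ### Finite-dimensional convergence to the stable random measure -/

section SmallGrainFidi

variable {d : ℕ} {C : Set (EuclideanSpace ℝ (Fin d))}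

local notation "𝔼" => EuclideanSpace ℝ (Fin d)

theorem IsStableRandomMeasure.sum_ae_eq {Ω : Type*} [MeasurableSpace Ω] {P : Measure Ω} {γ : ℝ}
    {Λ : (𝔼 → ℝ) → Ω → ℝ} (hΛ : IsStableRandomMeasure γ Λ P) {ι : Type*} (s : Finset ι)
    (t : ι → ℝ) {f : ι → 𝔼 → ℝ} (hf : ∀ k, MemLp (f k) (ENNReal.ofReal γ) volume) :
    Λ (fun x => ∑ k ∈ s, t k * f k x) =ᵐ[P] fun ω => ∑ k ∈ s, t k * Λ (f k) ω := by
  classical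
  induction s using Finset.induction_on with
  | empty =>
    have h := hΛ.linear (fun _ => 0) (fun _ => 0) MemLp.zero' MemLp.zero' 0 0
    simpa using h
  | insert a s ha ih =>
    have h2 : MemLp (fun x => ∑ k ∈ s, t k * f k x) (ENNReal.ofReal γ) volume :=
      memLp_finsetSum _ fun k _ => (hf k).const_mul _
    have h := hΛ.linear (f a) _ (hf a) h2 (t a) 1
    simp only [one_mul] at h
    simp only [Finset.sum_insert ha]
    filter_upwards [h, ih] with ω h1 h2
    rw [h1, h2]

theorem normL_congr {γ : ℝ} {f g : 𝔼 → ℝ} (h : f =ᵐ[volume] g) : normL γ f = normL γ g := by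
  rw [normL, normL, eLpNorm_congr_ae h]

theorem skewness_congr {γ : ℝ} {f g : 𝔼 → ℝ} (h : f =ᵐ[volume] g) :
    skewness γ f = skewness γ g := by
  have h1 : (fun x => max (f x) 0) =ᵐ[volume] fun x => max (g x) 0 :=
    h.mono fun x hx => by simp only [hx]
  have h2 : (fun x => -min (f x) 0) =ᵐ[volume] fun x => -min (g x) 0 :=
    h.mono fun x hx => by simp only [hx]
  rw [skewness, skewness, normL_congr h, normL_congr h1, normL_congr h2]

theorem tendstoFidi_smallGrain [NeZero d] (hC : MeasurableSet C)
    (hC1 : volume C = 1) (hb : Bornology.IsBounded C)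
    {F : Measure ℝ} [IsProbabilityMeasure F] (hF0 : F (Iic 0) = 0) (hF1 : ∫ v, v ∂F = 1)
    {γ : ℝ} (hγ : γ ∈ Ioo (1 : ℝ) 2) (hF : HasRegularlyVaryingTail F γ)
    {ι : Type*} {l : Filter ι} [l.IsCountablyGenerated] {lam ρ : ι → ℝ}
    (hlam : ∀ i, 0 < lam i) (hρ : ∀ i, 0 < ρ i) (hlam0 : Tendsto lam l atTop)
    (hρ0 : Tendsto ρ l (𝓝 0))
    {Ω : ι → Type*} [∀ i, MeasurableSpace (Ω i)] {P : (i : ι) → Measure (Ω i)}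
    [∀ i, IsProbabilityMeasure (P i)] {N : (i : ι) → Ω i → Measure (𝔼 × ℝ × SO d)}
    (hN : ∀ i, IsPoissonRandomMeasure (N i) (grainIntensity d (lam i) (ρ i) F) (P i))
    {Ω' : Type*} [MeasurableSpace Ω'] {P' : Measure Ω'} [IsProbabilityMeasure P']
    (h0 : Tendsto (fun i => lam i * tail (scaledLaw F (ρ i)) 1) l (𝓝 0))
    {Λ : (𝔼 → ℝ) → Ω' → ℝ} (hΛ : IsStableRandomMeasure γ Λ P') :
    TendstoFidi {f : 𝔼 → ℝ | MemLp f 1 volume ∧ MemLp f 2 volume}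
      (fun i f ω => centredField C (N i) (P i) (volume.withDensityᵥ f) ω /
        (stableConst γ * tailQuantile (scaledLaw F (ρ i)) (γ * lam i)))
      l Λ P P' := by
  intro n f hf
  have hfγ := fun k => memLp_of_memLp_one_of_memLp_two hγ (hf k).1 (hf k).2
  refine tendstoInDistribution_of_tendsto_integral_exp
    (fun i k => (aemeasurable_centredField hC hC1 hF0 hF1 (hρ i) (hN i) _).div_const _)
    (fun k => hΛ.aemeasurable _ (hfγ k)) fun t => ?_
  have hs1 : MemLp (fun x => ∑ k, t k * f k x) 1 volume :=
    memLp_finsetSum _ fun k _ => (hf k).1.const_mul (t k)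
  have hs2 : MemLp (fun x => ∑ k, t k * f k x) 2 volume :=
    memLp_finsetSum _ fun k _ => (hf k).2.const_mul (t k)
  -- The combination is only almost everywhere measurable; a measurable version has the same signed
  -- measure, norm and skewness.
  obtain ⟨g, hgm, hg⟩ := hs1.1.aemeasurable
  have hg1 : MemLp g 1 volume := (memLp_congr_ae hg).1 hs1
  have hg2 : MemLp g 2 volume := (memLp_congr_ae hg).1 hs2
  have hψ : ∑ k, t k • (volume : Measure 𝔼).withDensityᵥ (f k) = volume.withDensityᵥ g := by
    rw [sum_smul_withDensity _ t fun k => memLp_one_iff_integrable.1 (hf k).1]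
    exact WithDensityᵥEq.congr_ae hg
  have hlim : ∫ ω, Complex.exp (Complex.I * ((∑ k, t k * Λ (f k) ω : ℝ) : ℂ)) ∂P' =
      Complex.exp (∫ v, (∫ x, expRem (v * (g x / stableConst γ))) ∂(powerLaw γ)) := by
    rw [integral_integral_expRem_powerLaw hγ hgm hg1 hg2, ← normL_congr hg, ← skewness_congr hg,
      ← hΛ.charFun_eq _ (memLp_of_memLp_one_of_memLp_two hγ hs1 hs2)]
    refine integral_congr_ae ?_
    filter_upwards [hΛ.sum_ae_eq Finset.univ t hfγ] with ω hω
    rw [hω]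
  rw [hlim]
  have key := tendsto_integral_expRem_smallGrain hC hC1 hb hF0 hF1 hγ hF hlam hρ hlam0 hρ0 h0
    (stableConst_pos hγ) hgm (memLp_one_iff_integrable.1 hg1) hg2
  refine ((Complex.continuous_exp.tendsto _).comp key).congr fun i => ?_
  have h := integral_exp_sum_centredField hC hC1 hF0 hF1 (hρ i) (hN i)
    (fun k => volume.withDensityᵥ (f k)) t
    (stableConst γ * tailQuantile (scaledLaw F (ρ i)) (γ * lam i))
  rw [hψ] at h
  exact h.symm

end SmallGrainFidi

/-! ### The overlap function and the kernel of the large-grain limit -/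

section Overlap

variable {d : ℕ}

local notation "𝔼" => EuclideanSpace ℝ (Fin d)

/-- The volume of the intersection of `C` with its translate by `w`. -/
def overlap (C : Set 𝔼) (w : 𝔼) : ℝ≥0∞ := volume (C ∩ {u | u + w ∈ C})

theorem measurable_overlap {C : Set 𝔼} (hC : MeasurableSet C) : Measurable (overlap C) := by
  have h : MeasurableSet {p : 𝔼 × 𝔼 | p.2 ∈ C ∧ p.2 + p.1 ∈ C} :=
    (measurable_snd hC).inter ((measurable_snd.add measurable_fst) hC)
  exact measurable_measure_prodMk_left h

theorem overlap_neg (C : Set 𝔼) (w : 𝔼) : overlap C (-w) = overlap C w := by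
  have h := measure_preimage_add_right (volume : Measure 𝔼) w (C ∩ {u | u + -w ∈ C})
  rw [overlap, overlap, ← h]
  congr 1
  ext u
  simp [and_comm]

theorem overlap_le (C : Set 𝔼) (w : 𝔼) : overlap C w ≤ volume C :=
  measure_mono inter_subset_left

theorem overlap_zero (C : Set 𝔼) : overlap C 0 = volume C := by
  simp [overlap]

theorem volume_image_add_inter (C : Set 𝔼) (w : 𝔼) :
    volume ((fun y => w + y) '' C ∩ C) = overlap C w := by
  rw [← overlap_neg, overlap]
  congr 1
  ext u
  simp [and_comm, add_comm]

theorem overlap_eq_zero {C : Set 𝔼} {R : ℝ} (hR : ∀ x ∈ C, ‖x‖ ≤ R) {w : 𝔼} (hw : 2 * R < ‖w‖) :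
    overlap C w = 0 := by
  have h : C ∩ {u | u + w ∈ C} = ∅ := by
    refine eq_empty_of_forall_notMem fun u hu => ?_
    have h1 := hR _ hu.1
    have h2 := hR _ hu.2
    have h3 : ‖w‖ ≤ ‖u + w‖ + ‖u‖ := by
      calc ‖w‖ = ‖(u + w) - u‖ := by congr 1; abel
        _ ≤ _ := norm_sub_le _ _
    linarith
  rw [overlap, h, measure_empty]

/-- If the overlap were null, the indicator of `C` and its translate would differ by at least 1 in
L¹, against continuity of translation. -/
theorem eventually_overlap_ne_zero {C : Set 𝔼} (hC : MeasurableSet C) (hC1 : volume C = 1) :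
    ∀ᶠ w in 𝓝 (0 : 𝔼), overlap C w ≠ 0 := by
  have hi : Integrable (C.indicator fun _ => (1 : ℝ)) (volume : Measure 𝔼) :=
    (integrable_indicator_iff hC).2 (integrableOn_const (by simp [hC1]))
  have h := tendsto_lintegral_enorm_translate_sub hi
  filter_upwards [h.eventually_lt_const zero_lt_one] with w hw h0
  refine absurd hw (not_lt.2 ?_)
  have h1 : ∀ᵐ u : 𝔼, u ∉ C ∩ {u | u + w ∈ C} := measure_eq_zero_iff_ae_notMem.1 h0
  calc (1 : ℝ≥0∞) = ∫⁻ u, C.indicator 1 u := by rw [lintegral_indicator_one hC, hC1]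
    _ ≤ _ := lintegral_mono_ae (by
      filter_upwards [h1] with u hu
      by_cases h2 : u ∈ C
      · have h3 : u + w ∉ C := fun h => hu ⟨h2, h⟩
        simp [h2, h3]
      · simp [h2])

/-- The mean overlap of `C` with its translates by `r` in all directions. -/
def meanOverlap (C : Set 𝔼) (e : 𝔼) (r : ℝ) : ℝ≥0∞ :=
  ∫⁻ θ, overlap C (r • rotate θ e) ∂(haarSO d)

theorem Measurable.overlap_smul_rotate {X : Type*} [MeasurableSpace X] {C : Set 𝔼}
    (hC : MeasurableSet C) (e : 𝔼) {r : X → ℝ} (hr : Measurable r) {θ : X → SO d}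
    (hθ : Measurable θ) : Measurable fun x => overlap C (r x • rotate (θ x) e) := by
  have h1 : Measurable fun x => rotate (θ x) e :=
    measurable_rotate.comp (hθ.prodMk measurable_const)
  exact (measurable_overlap hC).comp (hr.smul h1)

theorem measurable_meanOverlap {C : Set 𝔼} (hC : MeasurableSet C) (e : 𝔼) :
    Measurable (meanOverlap C e) :=
  (measurable_fst.overlap_smul_rotate hC e measurable_snd).lintegral_prod_right'

theorem meanOverlap_le {C : Set 𝔼} (hC1 : volume C = 1) (e : 𝔼) (r : ℝ) :
    meanOverlap C e r ≤ 1 := by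
  calc meanOverlap C e r ≤ ∫⁻ _ : SO d, 1 ∂(haarSO d) :=
        lintegral_mono fun θ => (overlap_le C _).trans hC1.le
    _ = 1 := by simp

/-- The constant in front of the Riesz kernel in the covariance of the large-grain limit. -/
def overlapConst (C : Set 𝔼) (γ : ℝ) (e : 𝔼) : ℝ≥0∞ :=
  ∫⁻ v, ENNReal.ofReal v * meanOverlap C e (v ^ (1 / (d : ℝ)))⁻¹ ∂(powerLaw γ)

theorem measurable_mul_meanOverlap {C : Set 𝔼} (hC : MeasurableSet C) (e : 𝔼) :
    Measurable fun v : ℝ => ENNReal.ofReal v * meanOverlap C e (v ^ (1 / (d : ℝ)))⁻¹ :=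
  (by fun_prop : Measurable fun v : ℝ => ENNReal.ofReal v).mul
    ((measurable_meanOverlap hC e).comp (measurable_id.pow_const _).inv)

/-- For small `v` the shift `v^{-1/d}` exceeds the diameter bound `2R` and the overlap vanishes.
Otherwise `1 ≤ (2R)^d v`, so the integrand is at most both `(2R)^d v²` and `v`. -/
theorem overlapConst_lt_top [NeZero d] {C : Set 𝔼} (hC : MeasurableSet C) (hC1 : volume C = 1)
    (hb : Bornology.IsBounded C) {γ : ℝ} (hγ : γ ∈ Ioo (1 : ℝ) 2) {e : 𝔼} (he : ‖e‖ = 1) :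
    overlapConst C γ e < ∞ := by
  obtain ⟨R, hR0, hR⟩ : ∃ R, 0 < R ∧ ∀ x ∈ C, ‖x‖ ≤ R := by
    obtain ⟨R, hR⟩ := hb.exists_norm_le
    exact ⟨max R 1, by positivity, fun x hx => (hR x hx).trans (le_max_left _ _)⟩
  refine lintegral_powerLaw_lt_top (p := 2) (K₁ := ((2 * R) ^ d).toNNReal) (K₂ := 1) hγ.1 hγ.2
    (measurable_mul_meanOverlap hC e) (fun v hv => ?_) fun v hv => ?_
  · have hr : 0 < v ^ (1 / (d : ℝ)) := by positivity
    by_cases h : 2 * R < (v ^ (1 / (d : ℝ)))⁻¹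
    · have h0 : meanOverlap C e (v ^ (1 / (d : ℝ)))⁻¹ = 0 := by
        rw [meanOverlap]
        have : ∀ θ : SO d, overlap C ((v ^ (1 / (d : ℝ)))⁻¹ • rotate θ e) = 0 := fun θ => by
          refine overlap_eq_zero hR ?_
          rwa [norm_smul, norm_rotate, he, mul_one, norm_inv, Real.norm_of_nonneg hr.le]
        rw [lintegral_congr this, lintegral_zero]
      rw [h0, mul_zero]
      exact zero_le
    · have h1 : 1 ≤ 2 * R * v ^ (1 / (d : ℝ)) := by
        rw [not_lt, inv_le_iff_one_le_mul₀ hr] at h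
        exact h
      have h2 : 1 ≤ (2 * R) ^ d * v := by
        have := one_le_pow₀ h1 (n := d)
        rwa [mul_pow, rpow_one_div_natCast_pow hv.le] at this
      calc _ ≤ ENNReal.ofReal v * 1 := by gcongr; exact meanOverlap_le hC1 e _
        _ ≤ ENNReal.ofReal ((2 * R) ^ d * v ^ (2 : ℝ)) := by
          rw [mul_one]
          refine ENNReal.ofReal_le_ofReal ?_
          rw [Real.rpow_two]
          nlinarith
        _ = _ := ENNReal.ofReal_mul (by positivity)
  · calc _ ≤ ENNReal.ofReal v * 1 := by gcongr; exact meanOverlap_le hC1 e _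
      _ = _ := by simp

/-- For large `v` the shift is small and the overlap is positive. Positivity keeps the kernel
infinite on the diagonal, since `0 * ∞ = 0`, and lets finite energy be inferred from finite grain
moments. -/
theorem overlapConst_ne_zero [NeZero d] {C : Set 𝔼} (hC : MeasurableSet C) (hC1 : volume C = 1)
    (γ : ℝ) {e : 𝔼} (he : ‖e‖ = 1) : overlapConst C γ e ≠ 0 := by
  obtain ⟨δ, hδ0, hδ⟩ := Metric.eventually_nhds_iff.1 (eventually_overlap_ne_zero hC hC1)
  have hd : (0 : ℝ) < 1 / d := by
    have : (0 : ℝ) < d := by exact_mod_cast Nat.pos_of_ne_zero (NeZero.ne d)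
    positivity
  have hev : ∀ᶠ v : ℝ in atTop, meanOverlap C e (v ^ (1 / (d : ℝ)))⁻¹ ≠ 0 := by
    have h1 : Tendsto (fun v : ℝ => (v ^ (1 / (d : ℝ)))⁻¹) atTop (𝓝 0) :=
      (tendsto_rpow_atTop hd).inv_tendsto_atTop
    filter_upwards [h1.eventually_lt_const hδ0, eventually_gt_atTop 0] with v hv hv0 h0
    have hr : 0 < v ^ (1 / (d : ℝ)) := by positivity
    have h2 := (lintegral_eq_zero_iff (measurable_const.overlap_smul_rotate hC e measurable_id)).1 h0
    obtain ⟨θ, hθ⟩ := h2.exists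
    refine hδ ?_ hθ
    rw [dist_zero_right, norm_smul, norm_rotate, he, mul_one, norm_inv, Real.norm_of_nonneg hr.le]
    exact hv
  obtain ⟨a, ha⟩ := eventually_atTop.1 hev
  intro h0
  have hm := measurable_mul_meanOverlap hC e
  rw [overlapConst, lintegral_powerLaw hm, lintegral_eq_zero_iff (by fun_prop)] at h0
  have h3 : ∀ᵐ v : ℝ, v ∉ Ioi (max a 0) := by
    filter_upwards [ae_imp_of_ae_restrict h0] with v hv hva
    have hv0 : 0 < v := (le_max_right a 0).trans_lt hva
    have h4 := hv hv0
    have h5 := ha v ((le_max_left a 0).trans hva.le)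
    simp only [Pi.zero_apply, mul_eq_zero, h5, or_false, ENNReal.ofReal_eq_zero] at h4
    have h6 : 0 < v ^ (-γ - 1) := by positivity
    rcases h4 with h4 | h4 <;> linarith
  have h7 := measure_eq_zero_iff_ae_notMem.2 h3
  simp at h7

theorem overlapConst_eq [NeZero d] {C : Set 𝔼} (hC : MeasurableSet C) (γ : ℝ) (e : 𝔼) :
    overlapConst C γ e = ∫⁻ θ, (∫⁻ v in Ioi (0 : ℝ),
      volume ((fun y => v ^ (-1 / (d : ℝ)) • rotate θ e + y) '' C ∩ C) * ENNReal.ofReal (v ^ (-γ)))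
      ∂(haarSO d) := by
  rw [overlapConst, lintegral_powerLaw (measurable_mul_meanOverlap hC e)]
  simp_rw [volume_image_add_inter]
  rw [lintegral_lintegral_swap]
  · refine setLIntegral_congr_fun measurableSet_Ioi fun v hv => ?_
    have hv0 : (0 : ℝ) < v := hv
    rw [lintegral_mul_const' _ _ ENNReal.ofReal_ne_top, ← mul_assoc, ← ENNReal.ofReal_mul (by positivity), mul_comm,
      meanOverlap, ← Real.rpow_neg hv0.le, neg_div,
      show v ^ (-γ - 1) * v = v ^ (-γ) by
        rw [← Real.rpow_add_one hv0.ne', sub_add_cancel]]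
  · have h1 : Measurable fun p : SO d × ℝ => overlap C (p.2 ^ (-1 / (d : ℝ)) • rotate p.1 e) :=
      (measurable_snd.pow_const _).overlap_smul_rotate hC e measurable_fst
    have h2 : Measurable fun p : SO d × ℝ => ENNReal.ofReal (p.2 ^ (-γ)) :=
      (measurable_snd.pow_const _).ennreal_ofReal
    exact (h1.mul h2).aemeasurable

theorem toReal_overlapConst [NeZero d] {C : Set 𝔼} (hC : MeasurableSet C) (hC1 : volume C = 1)
    (hb : Bornology.IsBounded C) {γ : ℝ} (hγ : γ ∈ Ioo (1 : ℝ) 2) {e : 𝔼} (he : ‖e‖ = 1) :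
    (overlapConst C γ e).toReal = ∫ θ, (∫ v in Ioi (0 : ℝ),
      volume.real ((fun y => v ^ (-1 / (d : ℝ)) • rotate θ e + y) '' C ∩ C) * v ^ (-γ))
      ∂(haarSO d) := by
  have hfin := overlapConst_lt_top hC hC1 hb hγ he
  rw [overlapConst_eq hC] at hfin ⊢
  simp_rw [measureReal_def, volume_image_add_inter] at hfin ⊢
  set g : SO d → ℝ → ℝ≥0∞ := fun θ v =>
    overlap C (v ^ (-1 / (d : ℝ)) • rotate θ e) * ENNReal.ofReal (v ^ (-γ)) with hg
  have h1 : Measurable (Function.uncurry g) :=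
    ((measurable_snd.pow_const _).overlap_smul_rotate hC e measurable_fst).mul
      (measurable_snd.pow_const _).ennreal_ofReal
  have h2 : Measurable fun θ => ∫⁻ v in Ioi 0, g θ v := h1.lintegral_prod_right
  have h3 : ∀ θ, Measurable (g θ) := fun θ => h1.of_uncurry_left
  calc (∫⁻ θ, (∫⁻ v in Ioi 0, g θ v) ∂(haarSO d)).toReal
      = ∫ θ, (∫⁻ v in Ioi 0, g θ v).toReal ∂(haarSO d) :=
        (integral_toReal h2.aemeasurable (ae_lt_top h2 hfin.ne)).symm
    _ = _ := by
      refine integral_congr_ae ?_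
      filter_upwards [ae_lt_top h2 hfin.ne] with θ hθ
      rw [← integral_toReal (h3 θ).aemeasurable (ae_lt_top (h3 θ) hθ.ne)]
      refine setIntegral_congr_fun measurableSet_Ioi fun v hv => ?_
      have hv0 : (0 : ℝ) < v := hv
      simp only [hg]
      rw [ENNReal.toReal_mul, ENNReal.toReal_ofReal (by positivity)]

theorem lintegral_powerLaw_ofReal (γ : ℝ) :
    ∫⁻ v, ENNReal.ofReal v ∂(powerLaw γ) = ∞ := by
  rw [lintegral_powerLaw (by fun_prop)]
  by_contra h
  refine not_integrableOn_Ioi_rpow (-γ) ⟨by fun_prop, ?_⟩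
  refine lt_of_le_of_lt (le_of_eq ?_) (lt_top_iff_ne_top.2 h)
  refine setLIntegral_congr_fun measurableSet_Ioi fun v hv => ?_
  have hv0 : (0 : ℝ) < v := hv
  simp only
  rw [Real.enorm_of_nonneg (by positivity), ← ENNReal.ofReal_mul (by positivity),
    ← Real.rpow_add_one hv0.ne', sub_add_cancel]

/-- The Riesz kernel appears: averaging over rotations leaves only `‖w‖`, and the substitution `v ↦
‖w‖^d v` produces `‖w‖^{d - dγ}`. At `w = 0` both sides are infinite. -/
theorem lintegral_overlap_eq [NeZero d] {C : Set 𝔼} (hC : MeasurableSet C) (hC1 : volume C = 1)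
    {γ : ℝ} (hγ : 1 < γ) {e : 𝔼} (he : ‖e‖ = 1) (w : 𝔼) :
    ∫⁻ v, ∫⁻ θ, ENNReal.ofReal v * overlap C ((v ^ (1 / (d : ℝ)))⁻¹ • rotate θ⁻¹ w) ∂(haarSO d)
      ∂(powerLaw γ) = overlapConst C γ e * ‖w‖ₑ ^ (-((γ - 1) * d)) := by
  have hd : (0 : ℝ) < d := by exact_mod_cast Nat.pos_of_ne_zero (NeZero.ne d)
  rcases eq_or_ne w 0 with rfl | hw
  · have h0 : ∀ θ : SO d, rotate θ (0 : 𝔼) = 0 := fun θ => by simpa using norm_rotate θ 0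
    simp_rw [h0, smul_zero, overlap_zero, hC1, mul_one]
    rw [enorm_zero, ENNReal.zero_rpow_of_neg (by nlinarith),
      ENNReal.mul_top (overlapConst_ne_zero hC hC1 γ he)]
    simp [lintegral_powerLaw_ofReal]
  have hw0 : 0 < ‖w‖ := norm_pos_iff.2 hw
  have hin : ∀ v : ℝ, ∫⁻ θ, ENNReal.ofReal v *
      overlap C ((v ^ (1 / (d : ℝ)))⁻¹ • rotate θ⁻¹ w) ∂(haarSO d) =
      ENNReal.ofReal v * meanOverlap C e ((v ^ (1 / (d : ℝ)))⁻¹ * ‖w‖) := fun v => by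
    rw [lintegral_const_mul' _ _ ENNReal.ofReal_ne_top, meanOverlap]
    congr 1
    have h := lintegral_haarSO_rotate_eq
      (g := fun x => overlap C (((v ^ (1 / (d : ℝ)))⁻¹ * ‖w‖) • x))
      (fun x => by rw [smul_neg, overlap_neg]) he
      (f := ‖w‖⁻¹ • w) (by rw [norm_smul, norm_inv, norm_norm, inv_mul_cancel₀ hw0.ne'])
    rw [← h]
    refine lintegral_congr fun θ => ?_
    rw [rotate_smul, smul_smul, mul_assoc, mul_inv_cancel₀ hw0.ne', mul_one]
  simp_rw [hin]
  set r : ℝ := ‖w‖ ^ d with hr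
  have hr0 : 0 < r := by positivity
  have hm : Measurable fun v : ℝ =>
      ENNReal.ofReal v * meanOverlap C e ((v ^ (1 / (d : ℝ)))⁻¹ * ‖w‖) :=
    (by fun_prop : Measurable fun v : ℝ => ENNReal.ofReal v).mul
      ((measurable_meanOverlap hC e).comp ((measurable_id.pow_const _).inv.mul_const _))
  have hmap := map_mul_left_powerLaw γ hr0
  have h1 : ENNReal.ofReal (r ^ γ) * ∫⁻ v, ENNReal.ofReal v *
      meanOverlap C e ((v ^ (1 / (d : ℝ)))⁻¹ * ‖w‖) ∂(powerLaw γ) =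
      ENNReal.ofReal r * overlapConst C γ e := by
    rw [← smul_eq_mul, ← lintegral_smul_measure, ← hmap, lintegral_map hm (measurable_const_mul r),
      overlapConst, ← lintegral_const_mul' _ _ ENNReal.ofReal_ne_top]
    refine lintegral_congr_ae ?_
    filter_upwards [ae_powerLaw_pos γ] with v hv
    have hrd : r ^ (1 / (d : ℝ)) = ‖w‖ := by
      rw [hr, one_div]; exact Real.pow_rpow_inv_natCast hw0.le (NeZero.ne d)
    rw [Real.mul_rpow hr0.le hv.le, hrd, ENNReal.ofReal_mul hr0.le, mul_assoc, mul_inv,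
      mul_comm ‖w‖⁻¹, inv_mul_cancel_right₀ hw0.ne']
  have h2 : ENNReal.ofReal (r ^ γ) ≠ 0 := by simp; positivity
  have h3 : ENNReal.ofReal r = ENNReal.ofReal (r ^ γ) * ‖w‖ₑ ^ (-((γ - 1) * d)) := by
    rw [← ofReal_norm, ENNReal.ofReal_rpow_of_pos hw0,
      ← ENNReal.ofReal_mul (by positivity)]
    congr 1
    rw [hr, ← Real.rpow_natCast, ← Real.rpow_mul hw0.le, ← Real.rpow_add hw0]
    congr 1
    ring
  rw [h3, mul_assoc] at h1
  rw [(ENNReal.mul_right_inj h2 ENNReal.ofReal_ne_top).1 h1, mul_comm]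

/-- Integrating over all grains first counts those containing two given points; that mass depends on
their difference as a multiple of the Riesz kernel. -/
theorem lintegral_measure_grain_mul [NeZero d] {C : Set 𝔼} (hC : MeasurableSet C)
    (hC1 : volume C = 1) {γ : ℝ} (hγ : 1 < γ) {e : 𝔼} (he : ‖e‖ = 1)
    (μ ν : Measure 𝔼) [SFinite μ] [SFinite ν] :
    ∫⁻ z, μ {y | y - z.1 ∈ shape C z.2.1 z.2.2} * ν {y | y - z.1 ∈ shape C z.2.1 z.2.2}
      ∂(limitIntensity d γ) =
    overlapConst C γ e * ∫⁻ x, ∫⁻ y, edist x y ^ (-((γ - 1) * d)) ∂ν ∂μ := by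
  have hmul : Measurable fun z : 𝔼 × ℝ × SO d =>
      μ {y | y - z.1 ∈ shape C z.2.1 z.2.2} * ν {y | y - z.1 ∈ shape C z.2.1 z.2.2} :=
    (measurable_measure_grain hC μ).mul (measurable_measure_grain hC ν)
  rw [limitIntensity_eq, lintegral_rearrange _ hmul]
  set Φ : ℝ × SO d → 𝔼 × 𝔼 → ℝ≥0∞ := fun p q =>
    ENNReal.ofReal p.1 * overlap C ((p.1 ^ (1 / (d : ℝ)))⁻¹ • rotate p.2⁻¹ (q.2 - q.1)) with hΦ
  have hΦm : Measurable (Function.uncurry Φ) := by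
    refine (measurable_fst.comp measurable_fst).ennreal_ofReal.mul
      ((measurable_overlap hC).comp ?_)
    refine (((measurable_fst.comp measurable_fst).pow_const _).inv).smul ?_
    exact measurable_rotate.comp ((measurable_snd.comp measurable_fst).inv.prodMk
      ((measurable_snd.comp measurable_snd).sub (measurable_fst.comp measurable_snd)))
  have hΦ1 : ∀ p, Measurable (Φ p) := fun p =>
    hΦm.comp (measurable_const.prodMk measurable_id)
  have hΦ2 : ∀ q, Measurable fun p => Φ p q := fun q =>
    hΦm.comp (measurable_id.prodMk measurable_const)
  calc ∫⁻ v, ∫⁻ q, μ {y | y - q.1 ∈ shape C v q.2} * ν {y | y - q.1 ∈ shape C v q.2}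
        ∂(placeMeasure d) ∂(powerLaw γ)
      = ∫⁻ v, ∫⁻ θ, ∫⁻ q, Φ (v, θ) q ∂(μ.prod ν) ∂(haarSO d) ∂(powerLaw γ) := by
        refine lintegral_congr_ae ?_
        filter_upwards [ae_powerLaw_pos γ] with v hv
        refine (lintegral_prod_symm _ (hmul.comp (measurable_slice v)).aemeasurable).trans ?_
        refine lintegral_congr fun θ => ?_
        refine (lintegral_measure_translate_mul (measurableSet_shape hC v θ)).trans ?_
        rw [lintegral_prod _ (hΦ1 _).aemeasurable]
        refine lintegral_congr fun y => lintegral_congr fun y' => ?_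
        rw [volume_shape_inter_translate hC hv]
        rfl
    _ = ∫⁻ p, ∫⁻ q, Φ p q ∂(μ.prod ν) ∂((powerLaw γ).prod (haarSO d)) :=
        (lintegral_prod _ hΦm.lintegral_prod_right'.aemeasurable).symm
    _ = ∫⁻ q, ∫⁻ p, Φ p q ∂((powerLaw γ).prod (haarSO d)) ∂(μ.prod ν) :=
        lintegral_lintegral_swap hΦm.aemeasurable
    _ = ∫⁻ q, overlapConst C γ e * edist q.1 q.2 ^ (-((γ - 1) * d)) ∂(μ.prod ν) := by
        refine lintegral_congr fun q => ?_
        rw [lintegral_prod _ (hΦ2 q).aemeasurable, edist_comm, edist_eq_enorm_sub,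
          ← lintegral_overlap_eq hC hC1 hγ he]
    _ = _ := by
        have h : Measurable fun q : 𝔼 × 𝔼 => edist q.1 q.2 ^ (-((γ - 1) * d)) := by fun_prop
        rw [lintegral_const_mul _ h, lintegral_prod _ h.aemeasurable]

end Overlap

/-! ### Double integrals against signed measures -/

section SignedMeasure

variable {X : Type*} [MeasurableSpace X]

theorem MeasureTheory.SignedMeasure.posPart_le_totalVariation (φ : SignedMeasure X) :
    φ.toJordanDecomposition.posPart ≤ φ.totalVariation := by
  intro A
  rw [SignedMeasure.totalVariation, Measure.add_apply]
  exact le_self_add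

theorem MeasureTheory.SignedMeasure.negPart_le_totalVariation (φ : SignedMeasure X) :
    φ.toJordanDecomposition.negPart ≤ φ.totalVariation := by
  intro A
  rw [SignedMeasure.totalVariation, Measure.add_apply]
  exact le_add_self

theorem MeasureTheory.SignedMeasure.integral_eq_sub (φ : SignedMeasure X) {f : X → ℝ}
    (hf : Integrable f φ.totalVariation) :
    ∫ᵛ x, f x ∂•φ = ∫ x, f x ∂φ.toJordanDecomposition.posPart -
      ∫ x, f x ∂φ.toJordanDecomposition.negPart := by
  have hp := hf.mono_measure φ.posPart_le_totalVariation
  have hn := hf.mono_measure φ.negPart_le_totalVariation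
  have hflip : (ContinuousLinearMap.lsmul ℝ ℝ : ℝ →L[ℝ] ℝ →L[ℝ] ℝ) =
      (ContinuousLinearMap.lsmul ℝ ℝ).flip := by
    ext; simp
  conv_lhs => rw [← φ.toSignedMeasure_toJordanDecomposition]
  rw [JordanDecomposition.toSignedMeasure, VectorMeasure.integral_sub_vectorMeasure]
  · rw [hflip, VectorMeasure.integral_toSignedMeasure, VectorMeasure.integral_toSignedMeasure]
  · rwa [VectorMeasure.Integrable, Measure.variation_toSignedMeasure]
  · rwa [VectorMeasure.Integrable, Measure.variation_toSignedMeasure]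

theorem MeasureTheory.SignedMeasure.integral_toReal_eq_sub (φ : SignedMeasure X) {f : X → ℝ≥0∞}
    (hf : Measurable f) (hfin : ∫⁻ x, f x ∂φ.totalVariation ≠ ∞) :
    ∫ᵛ x, (f x).toReal ∂•φ = (∫⁻ x, f x ∂φ.toJordanDecomposition.posPart).toReal -
      (∫⁻ x, f x ∂φ.toJordanDecomposition.negPart).toReal := by
  have hp := ne_top_of_le_ne_top hfin (lintegral_mono' φ.posPart_le_totalVariation le_rfl)
  have hn := ne_top_of_le_ne_top hfin (lintegral_mono' φ.negPart_le_totalVariation le_rfl)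
  rw [φ.integral_eq_sub (integrable_toReal_of_lintegral_ne_top hf.aemeasurable hfin),
    integral_toReal hf.aemeasurable (ae_lt_top hf hp),
    integral_toReal hf.aemeasurable (ae_lt_top hf hn)]

/-- Expansion into the four Jordan parts. The inner integral is finite only almost everywhere, so
the kernel is kept extended-valued until the end. -/
theorem MeasureTheory.SignedMeasure.integral_integral_toReal_eq (φ ψ : SignedMeasure X)
    {k : X → X → ℝ≥0∞} (hk : Measurable (Function.uncurry k))
    (hfin : ∫⁻ x, ∫⁻ y, k x y ∂ψ.totalVariation ∂φ.totalVariation ≠ ∞) :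
    ∫ᵛ x, (∫ᵛ y, (k x y).toReal ∂•ψ) ∂•φ =
      ((∫⁻ x, ∫⁻ y, k x y ∂ψ.toJordanDecomposition.posPart
        ∂φ.toJordanDecomposition.posPart).toReal -
      (∫⁻ x, ∫⁻ y, k x y ∂ψ.toJordanDecomposition.posPart
        ∂φ.toJordanDecomposition.negPart).toReal) -
      ((∫⁻ x, ∫⁻ y, k x y ∂ψ.toJordanDecomposition.negPart
        ∂φ.toJordanDecomposition.posPart).toReal -
      (∫⁻ x, ∫⁻ y, k x y ∂ψ.toJordanDecomposition.negPart
        ∂φ.toJordanDecomposition.negPart).toReal) := by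
  set p := ψ.toJordanDecomposition.posPart with hp
  set n := ψ.toJordanDecomposition.negPart with hn
  have hT : Measurable fun x => ∫⁻ y, k x y ∂ψ.totalVariation := hk.lintegral_prod_right
  have hpm : Measurable fun x => ∫⁻ y, k x y ∂p := hk.lintegral_prod_right
  have hnm : Measurable fun x => ∫⁻ y, k x y ∂n := hk.lintegral_prod_right
  have hpf : ∫⁻ x, ∫⁻ y, k x y ∂p ∂φ.totalVariation ≠ ∞ := ne_top_of_le_ne_top hfin
    (lintegral_mono fun x => lintegral_mono' ψ.posPart_le_totalVariation le_rfl)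
  have hnf : ∫⁻ x, ∫⁻ y, k x y ∂n ∂φ.totalVariation ≠ ∞ := ne_top_of_le_ne_top hfin
    (lintegral_mono fun x => lintegral_mono' ψ.negPart_le_totalVariation le_rfl)
  rw [← φ.integral_toReal_eq_sub hpm hpf, ← φ.integral_toReal_eq_sub hnm hnf,
    ← VectorMeasure.integral_fun_sub]
  · refine VectorMeasure.integral_congr_ae ?_
    rw [← SignedMeasure.totalVariation_eq_variation]
    filter_upwards [ae_lt_top hT hfin] with x hx
    exact ψ.integral_toReal_eq_sub hk.of_uncurry_left hx.ne
  · rw [VectorMeasure.Integrable, ← SignedMeasure.totalVariation_eq_variation]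
    exact integrable_toReal_of_lintegral_ne_top hpm.aemeasurable hpf
  · rw [VectorMeasure.Integrable, ← SignedMeasure.totalVariation_eq_variation]
    exact integrable_toReal_of_lintegral_ne_top hnm.aemeasurable hnf

end SignedMeasure

/-! ### The covariance of the large-grain limit -/

section Covariance

variable {d : ℕ}

local notation "𝔼" => EuclideanSpace ℝ (Fin d)

theorem toReal_edist_rpow (x y : 𝔼) (s : ℝ) : (edist x y ^ s).toReal = ‖x - y‖ ^ s := by
  rw [← ENNReal.toReal_rpow, edist_eq_enorm_sub, toReal_enorm]

/-- The weaker kernel is at most 1 plus the stronger one, and the total variation is finite. -/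
theorem rieszSpace_subset [NeZero d] {α β : ℝ} (h : α ≤ β) (hβ : β < 1) :
    rieszSpace d α ⊆ rieszSpace d β := by
  intro φ hφ
  have hle : ∀ x y : 𝔼, edist x y ^ (-((1 - β) * d)) ≤ 1 + edist x y ^ (-((1 - α) * d)) := by
    intro x y
    have hd : (0 : ℝ) < d := by exact_mod_cast Nat.pos_of_ne_zero (NeZero.ne d)
    rcases le_total 1 (edist x y) with h1 | h1
    · refine le_trans ?_ le_self_add
      exact ENNReal.rpow_le_one_of_one_le_of_neg h1 (neg_neg_of_pos (mul_pos (by linarith) hd))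
    · refine le_trans ?_ le_add_self
      exact ENNReal.rpow_le_rpow_of_exponent_ge h1 (by nlinarith)
  refine lt_of_le_of_lt (lintegral_mono fun x => lintegral_mono fun y => hle x y) ?_
  have h2 : ∀ x : 𝔼, ∫⁻ y, (1 + edist x y ^ (-((1 - α) * d))) ∂φ.totalVariation =
      φ.totalVariation univ + ∫⁻ y, edist x y ^ (-((1 - α) * d)) ∂φ.totalVariation := fun x => by
    rw [lintegral_add_left measurable_const, lintegral_const, one_mul]
  simp_rw [h2]
  rw [lintegral_add_left measurable_const, lintegral_const]
  exact ENNReal.add_lt_top.2 ⟨ENNReal.mul_lt_top (measure_lt_top _ _) (measure_lt_top _ _), hφ⟩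

/-- The grain representation writes a mixed energy as an integral of a product `ab ≤ a² + b²`, hence
it is controlled by the two pure energies. It plays the role of positive definiteness of the Riesz
kernel. -/
theorem lintegral_edist_rpow_mixed_lt_top [NeZero d] {C : Set 𝔼} (hC : MeasurableSet C)
    (hC1 : volume C = 1) (hb : Bornology.IsBounded C) {γ : ℝ} (hγ : γ ∈ Ioo (1 : ℝ) 2)
    {e : 𝔼} (he : ‖e‖ = 1) {μ ν : Measure 𝔼} [SFinite μ] [SFinite ν]
    (hμ : ∫⁻ x, ∫⁻ y, edist x y ^ (-((γ - 1) * d)) ∂μ ∂μ < ∞)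
    (hν : ∫⁻ x, ∫⁻ y, edist x y ^ (-((γ - 1) * d)) ∂ν ∂ν < ∞) :
    ∫⁻ x, ∫⁻ y, edist x y ^ (-((γ - 1) * d)) ∂ν ∂μ < ∞ := by
  have hK := overlapConst_lt_top hC hC1 hb hγ he
  have hK0 := overlapConst_ne_zero hC hC1 γ he
  have h1 := lintegral_measure_grain_mul hC hC1 hγ.1 he μ ν
  have h2 := lintegral_measure_grain_mul hC hC1 hγ.1 he μ μ
  have h3 := lintegral_measure_grain_mul hC hC1 hγ.1 he ν ν
  have hm := measurable_measure_grain hC μ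
  have hle : overlapConst C γ e * ∫⁻ x, ∫⁻ y, edist x y ^ (-((γ - 1) * d)) ∂ν ∂μ < ∞ := by
    rw [← h1]
    refine lt_of_le_of_lt (b := ∫⁻ z, (μ {y | y - z.1 ∈ shape C z.2.1 z.2.2} *
      μ {y | y - z.1 ∈ shape C z.2.1 z.2.2} + ν {y | y - z.1 ∈ shape C z.2.1 z.2.2} *
      ν {y | y - z.1 ∈ shape C z.2.1 z.2.2}) ∂(limitIntensity d γ))
      (lintegral_mono fun z => ?_) ?_
    · rcases le_total (μ {y | y - z.1 ∈ shape C z.2.1 z.2.2})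
        (ν {y | y - z.1 ∈ shape C z.2.1 z.2.2}) with h | h
      · exact (mul_le_mul_left h _).trans le_add_self
      · exact (mul_le_mul_right h _).trans le_self_add
    · have hmm : Measurable fun z : 𝔼 × ℝ × SO d =>
          μ {y | y - z.1 ∈ shape C z.2.1 z.2.2} * μ {y | y - z.1 ∈ shape C z.2.1 z.2.2} :=
        hm.mul hm
      rw [lintegral_add_left hmm, h2, h3]
      exact ENNReal.add_lt_top.2 ⟨ENNReal.mul_lt_top hK hμ, ENNReal.mul_lt_top hK hν⟩
  by_contra h
  rw [not_lt_top_iff.1 h, ENNReal.mul_top hK0] at hle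
  exact lt_irrefl _ hle

theorem integral_toReal_measure_grain_mul [NeZero d] {C : Set 𝔼} (hC : MeasurableSet C)
    (hC1 : volume C = 1) (hb : Bornology.IsBounded C) {γ : ℝ} (hγ : γ ∈ Ioo (1 : ℝ) 2)
    {e : 𝔼} (he : ‖e‖ = 1) {μ ν : Measure 𝔼} [IsFiniteMeasure μ] [IsFiniteMeasure ν]
    (h : ∫⁻ x, ∫⁻ y, edist x y ^ (-((γ - 1) * d)) ∂ν ∂μ < ∞) :
    Integrable (fun z => (μ {y | y - z.1 ∈ shape C z.2.1 z.2.2}).toReal *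
      (ν {y | y - z.1 ∈ shape C z.2.1 z.2.2}).toReal) (limitIntensity d γ) ∧
    ∫ z, (μ {y | y - z.1 ∈ shape C z.2.1 z.2.2}).toReal *
      (ν {y | y - z.1 ∈ shape C z.2.1 z.2.2}).toReal ∂(limitIntensity d γ) =
    (overlapConst C γ e).toReal *
      (∫⁻ x, ∫⁻ y, edist x y ^ (-((γ - 1) * d)) ∂ν ∂μ).toReal := by
  have hm : Measurable fun z : 𝔼 × ℝ × SO d =>
      μ {y | y - z.1 ∈ shape C z.2.1 z.2.2} * ν {y | y - z.1 ∈ shape C z.2.1 z.2.2} :=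
    (measurable_measure_grain hC μ).mul (measurable_measure_grain hC ν)
  have h1 := lintegral_measure_grain_mul hC hC1 hγ.1 he μ ν
  have hne : ∫⁻ z, μ {y | y - z.1 ∈ shape C z.2.1 z.2.2} *
      ν {y | y - z.1 ∈ shape C z.2.1 z.2.2} ∂(limitIntensity d γ) ≠ ∞ := by
    rw [h1]
    exact (ENNReal.mul_lt_top (overlapConst_lt_top hC hC1 hb hγ he) h).ne
  simp_rw [← ENNReal.toReal_mul]
  refine ⟨integrable_toReal_of_lintegral_ne_top hm.aemeasurable hne, ?_⟩
  rw [integral_toReal hm.aemeasurable (ae_lt_top hm hne), h1]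

theorem integral_field_mul_field [NeZero d] {C : Set 𝔼} (hC : MeasurableSet C)
    (hC1 : volume C = 1) (hb : Bornology.IsBounded C) {γ : ℝ} (hγ : γ ∈ Ioo (1 : ℝ) 2)
    {e : 𝔼} (he : ‖e‖ = 1) {φ ψ : SignedMeasure 𝔼} (hφ : φ ∈ rieszSpace d (2 - γ))
    (hψ : ψ ∈ rieszSpace d (2 - γ)) :
    ∫ z, field C φ z * field C ψ z ∂(limitIntensity d γ) =
      (overlapConst C γ e).toReal *
        ∫ᵛ x, (∫ᵛ y, ‖x - y‖ ^ (-((γ - 1) * d)) ∂•ψ) ∂•φ := by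
  have hφ' : ∫⁻ x, ∫⁻ y, edist x y ^ (-((γ - 1) * d)) ∂φ.totalVariation ∂φ.totalVariation < ∞ := by
    have := hφ
    rwa [rieszSpace, mem_ofPred_eq, show (1 - (2 - γ)) = γ - 1 by ring] at this
  have hψ' : ∫⁻ x, ∫⁻ y, edist x y ^ (-((γ - 1) * d)) ∂ψ.totalVariation ∂ψ.totalVariation < ∞ := by
    have := hψ
    rwa [rieszSpace, mem_ofPred_eq, show (1 - (2 - γ)) = γ - 1 by ring] at this
  have hfin := lintegral_edist_rpow_mixed_lt_top hC hC1 hb hγ he hφ' hψ'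
  have hk : Measurable (Function.uncurry fun x y : 𝔼 => edist x y ^ (-((γ - 1) * d))) := by
    have : Measurable fun q : 𝔼 × 𝔼 => edist q.1 q.2 ^ (-((γ - 1) * d)) := by fun_prop
    exact this
  simp_rw [← toReal_edist_rpow]
  rw [φ.integral_integral_toReal_eq ψ hk hfin.ne]
  have key : ∀ μ ν : Measure 𝔼, μ ≤ φ.totalVariation → ν ≤ ψ.totalVariation →
      ∫⁻ x, ∫⁻ y, edist x y ^ (-((γ - 1) * d)) ∂ν ∂μ < ∞ := fun μ ν h1 h2 =>
    lt_of_le_of_lt (lintegral_mono' h1 fun x => lintegral_mono' h2 le_rfl) hfin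
  obtain ⟨ipp, hpp⟩ := integral_toReal_measure_grain_mul hC hC1 hb hγ he
    (key _ _ φ.posPart_le_totalVariation ψ.posPart_le_totalVariation)
  obtain ⟨inp, hnp⟩ := integral_toReal_measure_grain_mul hC hC1 hb hγ he
    (key _ _ φ.negPart_le_totalVariation ψ.posPart_le_totalVariation)
  obtain ⟨ipn, hpn⟩ := integral_toReal_measure_grain_mul hC hC1 hb hγ he
    (key _ _ φ.posPart_le_totalVariation ψ.negPart_le_totalVariation)
  obtain ⟨inn, hnn⟩ := integral_toReal_measure_grain_mul hC hC1 hb hγ he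
    (key _ _ φ.negPart_le_totalVariation ψ.negPart_le_totalVariation)
  rw [mul_sub, mul_sub, mul_sub, ← hpp, ← hnp, ← hpn, ← hnn, ← integral_sub' ipp inp,
    ← integral_sub' ipn inn, ← integral_sub' (ipp.sub inp) (ipn.sub inn)]
  refine integral_congr_ae (ae_of_all _ fun z => ?_)
  simp only [Pi.sub_apply]
  rw [field_eq_sub hC, field_eq_sub hC]
  ring

theorem rieszConst_pos [NeZero d] {a : ℝ} (ha : a ∈ Ioo (0 : ℝ) 1) : 0 < rieszConst a d := by
  have hd : (0 : ℝ) < d := by exact_mod_cast Nat.pos_of_ne_zero (NeZero.ne d)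
  have h1 : 0 < (1 - a) * d / 2 := by
    have := mul_pos (sub_pos.2 ha.2) hd
    linarith
  have h2 : 0 < a * d / 2 := by
    have := mul_pos ha.1 hd
    linarith
  exact div_pos (mul_pos (by positivity) (Real.Gamma_pos_of_pos h1)) (Real.Gamma_pos_of_pos h2)

/-- The covariance of the large-grain limit is the second moment of the field under the limit
intensity. -/
theorem largeGrainConst_sq_mul_rieszInner [NeZero d] {C : Set 𝔼} (hC : MeasurableSet C)
    (hC1 : volume C = 1) (hb : Bornology.IsBounded C) {γ : ℝ} (hγ : γ ∈ Ioo (1 : ℝ) 2)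
    {e : 𝔼} (he : ‖e‖ = 1) {φ ψ : SignedMeasure 𝔼} (hφ : φ ∈ rieszSpace d (2 - γ))
    (hψ : ψ ∈ rieszSpace d (2 - γ)) :
    largeGrainConst C γ ((3 - γ) / 2) e ^ 2 * rieszInner (2 - γ) φ ψ =
      ∫ z, field C φ z * field C ψ z ∂(limitIntensity d γ) := by
  have hc := rieszConst_pos (d := d) (a := 2 - γ) ⟨by linarith [hγ.2], by linarith [hγ.1]⟩
  have h1 : largeGrainConst C γ ((3 - γ) / 2) e ^ 2 =
      (rieszConst (2 - γ) d)⁻¹ * (overlapConst C γ e).toReal := by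
    rw [largeGrainConst, ← toReal_overlapConst hC hC1 hb hγ he,
      show 2 * ((3 - γ) / 2) - 1 = 2 - γ by ring, Real.sq_sqrt (by positivity)]
  rw [h1, integral_field_mul_field hC hC1 hb hγ he hφ hψ, rieszInner,
    show 1 - (2 - γ) = γ - 1 by ring]
  field_simp

end Covariance

/-! ### Large-grain scaling -/

theorem integral_sum_mul_sq {S : Type*} [MeasurableSpace S] {μ : Measure S} {n : ℕ}
    {f : Fin n → S → ℝ} (hf : ∀ k, MemLp (f k) 2 μ) (t : Fin n → ℝ) :
    ∫ x, (∑ k, t k * f k x) ^ 2 ∂μ = ∑ j, ∑ k, t j * t k * ∫ x, f j x * f k x ∂μ := by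
  have hi : ∀ j k, Integrable (fun x => t j * t k * (f j x * f k x)) μ := fun j k =>
    ((hf j).integrable_mul (hf k)).const_mul _
  calc ∫ x, (∑ k, t k * f k x) ^ 2 ∂μ
      = ∫ x, ∑ j, ∑ k, t j * t k * (f j x * f k x) ∂μ := by
        refine integral_congr_ae (ae_of_all _ fun x => ?_)
        simp only
        rw [sq, Finset.sum_mul_sum]
        refine Finset.sum_congr rfl fun j _ => Finset.sum_congr rfl fun k _ => ?_
        ring
    _ = _ := by
        rw [integral_finsetSum _ fun j _ => integrable_finsetSum _ fun k _ => hi j k]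
        refine Finset.sum_congr rfl fun j _ => ?_
        rw [integral_finsetSum _ fun k _ => hi j k]
        simp_rw [integral_const_mul]

theorem ProbabilityTheory.HasGaussianLaw.integral_exp {Ω : Type*} [MeasurableSpace Ω]
    {P : Measure Ω} {Y : Ω → ℝ} (hY : HasGaussianLaw Y P) (h0 : ∫ ω, Y ω ∂P = 0) :
    ∫ ω, Complex.exp (Complex.I * (Y ω : ℂ)) ∂P =
      Complex.exp (-((∫ ω, Y ω ^ 2 ∂P) / 2 : ℝ)) := by
  have h1 := hY.charFun_map_eq 1
  rw [charFun_apply_real, integral_map hY.aemeasurable (by fun_prop)] at h1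
  simp only [Complex.ofReal_one, one_mul, RCLike.inner_apply, conj_trivial, mul_one] at h1
  rw [variance_of_integral_eq_zero hY.aemeasurable h0, h0] at h1
  simp_rw [mul_comm Complex.I]
  rw [h1]
  push_cast
  simp

theorem ProbabilityTheory.IsGaussianProcess.integral_exp_sum {Ω T : Type*} [MeasurableSpace Ω]
    {P : Measure Ω} {X : T → Ω → ℝ} (hX : IsGaussianProcess X P)
    (h0 : ∀ k, ∫ ω, X k ω ∂P = 0) {n : ℕ} (f : Fin n → T) (t : Fin n → ℝ) :
    ∫ ω, Complex.exp (Complex.I * ((∑ k, t k * X (f k) ω : ℝ) : ℂ)) ∂P =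
      Complex.exp (-((∑ j, ∑ k, t j * t k * ∫ ω, X (f j) ω * X (f k) ω ∂P) / 2 : ℝ)) := by
  have hL : ∀ k, MemLp (fun ω => t k * X (f k) ω) 2 P := fun k =>
    (hX.hasGaussianLaw_eval (f k)).memLp_two.const_mul (t k)
  have hY : HasGaussianLaw (fun ω => ∑ k, t k * X (f k) ω) P :=
    ((hX.comp_right f).smul t).hasGaussianLaw_fun_sum (I := Finset.univ)
  have hP := hX.isProbabilityMeasure
  rw [hY.integral_exp]
  · rw [integral_sum_mul_sq fun k => (hX.hasGaussianLaw_eval (f k)).memLp_two]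
  · rw [integral_finsetSum _ fun k _ => (hL k).integrable one_le_two]
    simp [integral_const_mul, h0]

section LargeGrain

variable {d : ℕ} {C : Set (EuclideanSpace ℝ (Fin d))}

local notation "𝔼" => EuclideanSpace ℝ (Fin d)

theorem integral_field_sum_sq [NeZero d] (hC : MeasurableSet C) (hC1 : volume C = 1)
    (hb : Bornology.IsBounded C) {γ α : ℝ} (hγ : 1 < γ) (hα : α < 2 - γ) {n : ℕ}
    {φ : Fin n → SignedMeasure 𝔼} (hφ : ∀ k, φ k ∈ rieszSpace d α) (t : Fin n → ℝ) :
    ∫ z, field C (∑ k, t k • φ k) z ^ 2 ∂(limitIntensity d γ) =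
      ∑ j, ∑ k, t j * t k * ∫ z, field C (φ j) z * field C (φ k) z ∂(limitIntensity d γ) := by
  simp_rw [field_sum]
  exact integral_sum_mul_sq (fun k => memLp_field_of_mem_rieszSpace hC hC1 hb hγ hα (hφ k)) t

theorem tendstoFidi_largeGrain [NeZero d] (hC : MeasurableSet C) (hC1 : volume C = 1)
    (hb : Bornology.IsBounded C) (hfr : volume (frontier C) = 0)
    {F : Measure ℝ} [IsProbabilityMeasure F] (hF0 : F (Iic 0) = 0) (hF1 : ∫ v, v ∂F = 1)
    {γ α : ℝ} (hγ : γ ∈ Ioo (1 : ℝ) 2) (hF : HasRegularlyVaryingTail F γ) (hα : α < 2 - γ)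
    {ι : Type*} {l : Filter ι} [l.IsCountablyGenerated] {lam ρ : ι → ℝ}
    (hlam : ∀ i, 0 < lam i) (hρ : ∀ i, 0 < ρ i) (hρ0 : Tendsto ρ l (𝓝 0))
    {Ω : ι → Type*} [∀ i, MeasurableSpace (Ω i)] {P : (i : ι) → Measure (Ω i)}
    [∀ i, IsProbabilityMeasure (P i)] {N : (i : ι) → Ω i → Measure (𝔼 × ℝ × SO d)}
    (hN : ∀ i, IsPoissonRandomMeasure (N i) (grainIntensity d (lam i) (ρ i) F) (P i))
    {Ω' : Type*} [MeasurableSpace Ω'] {P' : Measure Ω'} [IsProbabilityMeasure P']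
    (hc : Tendsto (fun i => lam i * tail (scaledLaw F (ρ i)) 1) l atTop)
    {W : SignedMeasure 𝔼 → Ω' → ℝ} (hW : IsRieszGaussian ((3 - γ) / 2) W P')
    {e : 𝔼} (he : ‖e‖ = 1) :
    TendstoFidi (rieszSpace d α)
      (fun i φ ω => centredField C (N i) (P i) φ ω /
        (γ * lam i * tail (scaledLaw F (ρ i)) 1) ^ (1 / 2 : ℝ)) l
      (fun φ ω => largeGrainConst C γ ((3 - γ) / 2) e * W φ ω) P P' := by
  intro n φ hφ
  have hγ1 := hγ.1
  have hγ0 : 0 < γ := by linarith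
  have hH : 2 * ((3 - γ) / 2) - 1 = 2 - γ := by ring
  obtain ⟨hW1, hW2, hW3⟩ := hW
  rw [hH] at hW1 hW2 hW3
  have hφ' : ∀ k, φ k ∈ rieszSpace d (2 - γ) := fun k =>
    rieszSpace_subset hα.le (by linarith) (hφ k)
  set c := largeGrainConst C γ ((3 - γ) / 2) e with hc_def
  set s : ι → ℝ := fun i => (γ * lam i * tail (scaledLaw F (ρ i)) 1) ^ (1 / 2 : ℝ) with hs_def
  have hs2 : ∀ i, s i ^ 2 = γ * (lam i * tail (scaledLaw F (ρ i)) 1) := fun i => by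
    have h0 : 0 ≤ γ * lam i * tail (scaledLaw F (ρ i)) 1 :=
      mul_nonneg (mul_nonneg hγ0.le (hlam i).le) measureReal_nonneg
    simp only [hs_def]
    rw [← Real.sqrt_eq_rpow, Real.sq_sqrt h0, mul_assoc]
  have hs : Tendsto s l atTop := by
    refine (tendsto_rpow_atTop (by norm_num : (0 : ℝ) < 1 / 2)).comp ?_
    simp_rw [mul_assoc]
    exact hc.const_mul_atTop hγ0
  refine tendstoInDistribution_of_tendsto_integral_exp
    (fun i k => (aemeasurable_centredField hC hC1 hF0 hF1 (hρ i) (hN i) (φ k)).div_const _)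
    (fun k => (hW1.aemeasurable ⟨φ k, hφ' k⟩).const_mul c) fun t => ?_
  obtain ⟨K, hK⟩ := exists_lintegral_sum_sq_le hC hC1 hb (by linarith) hφ t
  have hmem := memLp_field_limitIntensity (γ := γ) hC hC1 hγ1 (by linarith) hK
  -- The normalisation contains `γ` so that this limit `γ⁻¹` cancels the `γ` of the limiting
  -- density, leaving the intensity `v^{-γ-1} dv` in the covariance.
  have hratio : Tendsto (fun i => lam i * tail (scaledLaw F (ρ i)) 1 / s i ^ 2) l (𝓝 γ⁻¹) := by
    refine tendsto_const_nhds.congr' ?_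
    filter_upwards [hc.eventually_gt_atTop 0] with i hi
    rw [hs2, div_mul_cancel_right₀ hi.ne']
  have key := tendsto_integral_expRem_grainIntensity hC hC1 hb hfr hF0 hF1 hγ1 hF
    (p := 2 - α) (by linarith) hK hlam hρ hρ0 (hs.eventually_gt_atTop 0) hratio
    (fun v hv => tendsto_remMean_atTop hC hC1 _ hs hv)
  have hlim : (γ⁻¹ • ∫ v in Ioi 0, (γ * v ^ (-γ - 1)) •
      (-(((∫ q, field C (∑ k, t k • φ k) (q.1, v, q.2) ^ 2 ∂(placeMeasure d)) / 2 : ℝ) : ℂ))) =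
      (-((∫ z, field C (∑ k, t k • φ k) z ^ 2 ∂(limitIntensity d γ)) / 2 : ℝ) : ℂ) := by
    have h1 : ∫ z, ((field C (∑ k, t k • φ k) z ^ 2 : ℝ) : ℂ) ∂(limitIntensity d γ) =
        ∫ v in Ioi 0, v ^ (-γ - 1) •
          ∫ q, ((field C (∑ k, t k • φ k) (q.1, v, q.2) ^ 2 : ℝ) : ℂ) ∂(placeMeasure d) :=
      integral_limitIntensity hmem.integrable_sq.ofReal
    rw [integral_complex_ofReal] at h1
    push_cast
    rw [h1]
    simp_rw [mul_smul]
    rw [integral_smul, smul_smul, inv_mul_cancel₀ hγ0.ne', one_smul, ← integral_div,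
      ← integral_neg]
    congr 1
    ext v
    rw [integral_complex_ofReal, smul_neg, Complex.real_smul, Complex.real_smul]
    ring
  rw [hlim, integral_field_sum_sq hC hC1 hb hγ1 hα hφ t] at key
  have hWc : ∀ j k, c * c * ∫ ω, W (φ j) ω * W (φ k) ω ∂P' =
      ∫ z, field C (φ j) z * field C (φ k) z ∂(limitIntensity d γ) := fun j k => by
    rw [hW3 _ (hφ' j) _ (hφ' k), ← sq, hc_def,
      largeGrainConst_sq_mul_rieszInner hC hC1 hb hγ he (hφ' j) (hφ' k)]
  have hZ : ∫ ω, Complex.exp (Complex.I * ((∑ k, t k * (c * W (φ k) ω) : ℝ) : ℂ)) ∂P' =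
      Complex.exp (-((∑ j, ∑ k, t j * t k *
        ∫ z, field C (φ j) z * field C (φ k) z ∂(limitIntensity d γ)) / 2 : ℝ)) := by
    have h := hW1.integral_exp_sum (fun k => hW2 k.1 k.2) (fun k => ⟨φ k, hφ' k⟩)
      (fun k => t k * c)
    simp_rw [mul_assoc (t _) c] at h
    rw [h]
    congr 4
    refine Finset.sum_congr rfl fun j _ => Finset.sum_congr rfl fun k _ => ?_
    rw [← hWc]
    ring
  rw [hZ]
  refine ((Complex.continuous_exp.tendsto _).comp key).congr fun i => ?_
  exact (integral_exp_sum_centredField hC hC1 hF0 hF1 (hρ i) (hN i) φ t (s i)).symm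

end LargeGrain

end

/-! ### The three scaling regimes together -/

theorem theorem3 {d : ℕ} [NeZero d]
    -- the grain shape
    (C : Set (EuclideanSpace ℝ (Fin d))) (hC_bdd : Bornology.IsBounded C)
    (hC_meas : MeasurableSet C) (hC_vol : volume C = 1) (hC_bdry : volume (frontier C) = 0)
    -- the distribution of the normalised grain volume
    (F : Measure ℝ) [IsProbabilityMeasure F] (hF_pos : F (Iic 0) = 0)
    (hF_mean : ∫ v, v ∂F = 1)
    (γ : ℝ) (hγ : γ ∈ Ioo (1 : ℝ) 2) (hF_tail : HasRegularlyVaryingTail F γ)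
    (α : ℝ) (hα : α ∈ Ioo (0 : ℝ) (2 - γ))
    -- grain density tending to infinity and mean grain volume tending to zero
    {ι : Type*} (l : Filter ι) [l.IsCountablyGenerated] (lam ρ : ι → ℝ)
    (hlam_pos : ∀ i, 0 < lam i) (hρ_pos : ∀ i, 0 < ρ i)
    (hlam : Tendsto lam l atTop) (hρ : Tendsto ρ l (𝓝 0))
    -- the Poisson random measures of rotated grains
    {Ω : ι → Type*} [∀ i, MeasurableSpace (Ω i)] (P : (i : ι) → Measure (Ω i))
    [∀ i, IsProbabilityMeasure (P i)]
    (N : (i : ι) → Ω i → Measure (EuclideanSpace ℝ (Fin d) × ℝ × SO d))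
    (hN : ∀ i, IsPoissonRandomMeasure (N i) (grainIntensity d (lam i) (ρ i) F) (P i))
    -- a probability space carrying the limits
    {Ω' : Type*} [MeasurableSpace Ω'] (P' : Measure Ω') [IsProbabilityMeasure P'] :
    -- the fields are well defined and have a finite mean
    (∀ i, ∀ φ : SignedMeasure (EuclideanSpace ℝ (Fin d)),
      (∀ᵐ ω ∂(P i), Integrable (fun z => φ (grain C z)) (N i ω)) ∧
      Integrable (grainField C (N i) φ) (P i)) ∧
    -- (i) large-grain scaling
    (Tendsto (fun i => lam i * tail (scaledLaw F (ρ i)) 1) l atTop →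
      ∀ W : SignedMeasure (EuclideanSpace ℝ (Fin d)) → Ω' → ℝ,
      IsRieszGaussian ((3 - γ) / 2) W P' →
      ∀ e : EuclideanSpace ℝ (Fin d), ‖e‖ = 1 →
      TendstoFidi (rieszSpace d α)
        (fun i φ ω => centredField C (N i) (P i) φ ω /
          (γ * lam i * tail (scaledLaw F (ρ i)) 1) ^ (1 / 2 : ℝ))
        l (fun φ ω => largeGrainConst C γ ((3 - γ) / 2) e * W φ ω) P P') ∧
    -- (ii) intermediate scaling
    (∀ σ₀ : ℝ, 0 < σ₀ →
      Tendsto (fun i => lam i * tail (scaledLaw F (ρ i)) 1) l (𝓝 σ₀) →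
      ∀ Nγ : Ω' → Measure (EuclideanSpace ℝ (Fin d) × ℝ × SO d),
      IsPoissonRandomMeasure Nγ (limitIntensity d γ) P' →
      ∀ σ : ℝ, σ = (γ * σ₀) ^ (1 / ((γ - 1) * d)) →
      (∀ φ ∈ rieszSpace d α,
        IsCentredIntegral P' Nγ (limitIntensity d γ) (fun z => dilate σ φ (grain C z))
          (centredIntegral P' Nγ (limitIntensity d γ) (fun z => dilate σ φ (grain C z)))) ∧
      TendstoFidi (rieszSpace d α)
        (fun i φ ω => centredField C (N i) (P i) φ ω)
        l (fun φ => centredIntegral P' Nγ (limitIntensity d γ)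
          (fun z => dilate σ φ (grain C z))) P P') ∧
    -- (iii) small-grain scaling
    (Tendsto (fun i => lam i * tail (scaledLaw F (ρ i)) 1) l (𝓝 0) →
      ∀ Λ : (EuclideanSpace ℝ (Fin d) → ℝ) → Ω' → ℝ,
      IsStableRandomMeasure γ Λ P' →
      TendstoFidi {f : EuclideanSpace ℝ (Fin d) → ℝ | MemLp f 1 volume ∧ MemLp f 2 volume}
        (fun i f ω => centredField C (N i) (P i) (volume.withDensityᵥ f) ω /
          (stableConst γ * tailQuantile (scaledLaw F (ρ i)) (γ * lam i)))
        l Λ P P') := by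
  obtain ⟨hγ1, hγ2⟩ := id hγ
  refine ⟨fun i φ => ⟨ae_integrable_grain hC_meas hC_vol hF_pos hF_mean (hρ_pos i) (hN i) φ,
    integrable_grainField hC_meas hC_vol hF_pos hF_mean (hρ_pos i) (hN i) φ⟩, ?_, ?_, ?_⟩
  · intro hc W hW e he
    exact tendstoFidi_largeGrain hC_meas hC_vol hC_bdd hC_bdry hF_pos hF_mean hγ hF_tail hα.2
      hlam_pos hρ_pos hρ hN hc hW he
  · rintro σ₀ hσ₀ hc Nγ hNγ σ rfl
    have hσ : 0 < (γ * σ₀) ^ (1 / ((γ - 1) * d)) :=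
      Real.rpow_pos_of_pos (mul_pos (by linarith) hσ₀) _
    exact ⟨fun φ hφ =>
      (centredIntegral_dilate_spec hC_meas hC_vol hC_bdd hγ1 hα.2 hNγ hσ hφ).1,
      tendstoFidi_intermediate hC_meas hC_vol hC_bdd hC_bdry hF_pos hF_mean hγ1 hF_tail hα.2
        hlam_pos hρ_pos hρ hN hσ₀ hc hNγ⟩
  · intro h0 Λ hΛ
    exact tendstoFidi_smallGrain hC_meas hC_vol hC_bdd hF_pos hF_mean hγ hF_tail
      hlam_pos hρ_pos hlam hρ hN h0 hΛ
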